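/- **Theorem.** Let $n, f$ be natural numbers with $2f<n$. In an asynchronous message-passing system of $n$ nodes with reliable FIFO channels, in which at most $f$ nodes crash, the algorithm AC-ASO below implements a (linearizable) atomic single-writer snapshot object with $n$ segments. That is: 1. (Linearizability) For every finite or infinite execution with at most $f$ crashes there is a finite or infinite sequence $\sigma$ of distinct operations of the execution, containing all completed $\mathrm{Update}$ and $\mathrm{Scan}$ operations and possibly some operations that were invoked but did not complete, such that * (real-time order) if $Op_1, Op_2$ occur in $\sigma$ and $Op_1$ completes before $Op_2$ is invoked, then $Op_1$ appears before $Op_2$ in $\sigma$; * (sequential specification) every completed Update returns ACK, and every completed Scan returns a vector $Snap$ such that for each node $j$, $Snap[j]$ is the value written by the last Update of node $j$ that precedes the Scan in $\sigma$, or the initial value of segment $j$ if there is none. 2. (Termination) In every fair execution with at most $f$ crashes, each operation invoked by a node that never crashes completes. **System.** Each node runs one client thread, which has at most one pending operation $\mathrm{Update}(v)$ or $\mathrm{Scan}()$ at a time (operations may be invoked at arbitrary times), and atomic message handlers. "Send to all" includes the sender, and may be interrupted only by a crash of the sender, in which case an arbitrary subset of the recipients gets the message. Each ordered pair of nodes is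 connected by a FIFO channel that delays messages arbitrarily. An execution is fair if every message in transit to a node that never crashes is eventually received, and the client thread of a node that never crashes does not remain able to take a step forever without taking one. **Algorithm AC-ASO (node $i$).** Values are pairs $\langle v,\langle t,j\rangle\rangle$ with tag $t\in\mathbb N$ and writer $j$; $H^{\le r}$ is the set of values in $H$ with tag at most $r$. Node $i$ has vectors $V[1..n]$, $D[1..n]$ of sets of values, initially all empty, and $maxTag$, initially $0$. $\mathrm{EQ}(V,i)$ holds iff there is a set $Q$ of at least $n-f$ nodes with $V[j]=V[i]$ for all $j\in Q$. * $\mathrm{Update}(v)$: $r\gets readTag()$; send $(\text{value},\langle v,\langle r+1,i\rangle\rangle)$ to all; call $Lattice(r)$ and ignore its result; $r'\gets\max\{r+1,maxTag\}$; call $LatticeRenewal(r')$; return ACK. * $\mathrm{Scan}()$: $r\gets readTag()$; $S\gets LatticeRenewal(r)$; return the vector whose $j$-th entry is the value of writer $j$ with the largest tag in $S$, or the initial value of segment $j$ if $S$ contains no value of writer $j$. * $Lattice(r)$: call $writeTag(r)$; wait until $\mathrm{EQ}(V^{\le r},i)$ holds, where $V^{\le r}=(V[1]^{\le r},\dots,V[n]^{\le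 r})$; at the first moment when it holds, before any further message is handled at $i$, atomically do the following: if $maxTag\le r$, send $(\text{goodLA},r)$ to all and return $(true,V[i]^{\le r})$, otherwise return $(false,\emptyset)$. * $LatticeRenewal(r)$: for phase $=1,2,3$: $(status,view)\gets Lattice(r)$; if $status=true$, return $view$; if phase $<3$, set $r\gets maxTag$. After a failed phase 3: wait until $(\text{goodLA},r)$ has been received from some node $j$; return $D[j]$. * $readTag()$: send $(\text{readTag})$ to all, wait for at least $n-f$ acknowledgements of this request, return the largest tag in the acknowledgements received. $writeTag(t)$: send $(\text{writeTag},t)$ to all, wait for at least $n-f$ acknowledgements of this request. * Upon receiving from $j$: * $(\text{value},u)$: add $u$ to $V[j]$ and $V[i]$, and if $u$ was not in $V[i]$ before, send $(\text{value},u)$ to all; * $(\text{writeTag},t)$: $maxTag\gets\max\{maxTag,t\}$, send $(\text{echoTag},t)$ to all, then acknowledge to $j$; * $(\text{echoTag},t)$: $maxTag\gets\max\{maxTag,t\}$; * $(\text{readTag})$: acknowledge to $j$ with $maxTag$; * $(\text{goodLA},r)$: $D[j]\gets V[j]^{\le r}$. -/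

import Mathlib

/-! # Linearizable atomic snapshot objects -/

namespace Snapshot

/-- The operations of a snapshot object with segments of type `α`. -/
inductive Op (α : Type*) where
  | update (v : α)
  | scan

/-- The responses of a snapshot object with `n` segments of type `α`. -/
inductive Resp (n : ℕ) (α : Type*) where
  | ack
  | snap (s : Fin n → α)

/-- Events visible at the interface of the object; `internal` is everything else. -/
inductive Event (n : ℕ) (α : Type*) where
  | invoke (i : Fin n) (o : Op α)
  | respond (i : Fin n) (r : Resp n α)
  | internal

/-- A history: the (infinite) sequence of events of an execution.  A finite execution is one
whose events are `internal` from some time on. -/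
abbrev History (n : ℕ) (α : Type*) := ℕ → Event n α

namespace History

variable {n : ℕ} {α : Type*}

/-- An operation of a history is identified by the time `k` of its invocation event:
at time `k`, node `i` invokes `o`. -/
def IsOp (H : History n α) (k : ℕ) (i : Fin n) (o : Op α) : Prop :=
  H k = .invoke i o

/-- The operation invoked at time `k` completes at time `m` with response `r`: `m` is the time of
the first response event of the invoking node after time `k`. -/
def CompletesAt (H : History n α) (k m : ℕ) (r : Resp n α) : Prop :=
  ∃ i o, H.IsOp k i o ∧ k < m ∧ H m = .respond i r ∧
    ∀ m', k < m' → m' < m → ∀ r', H m' ≠ .respond i r'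

/-- The operation invoked at time `k` completes. -/
def Completes (H : History n α) (k : ℕ) : Prop :=
  ∃ m r, H.CompletesAt k m r

/-- Real-time order: the operation invoked at time `k` completes before the operation invoked
at time `k'` starts. -/
def Precedes (H : History n α) (k k' : ℕ) : Prop :=
  ∃ m r, H.CompletesAt k m r ∧ m < k'

/-- `H` is a linearizable history of a single-writer snapshot object whose `i`-th segment
initially holds `v₀ i`.

The linearization is a finite or infinite sequence of operations; it is given by the set `S` of
operations that occur in it and by the position `pos k` of each operation `k ∈ S`.  It contains
every completed operation, and possibly some operations that were invoked and never completed
(these have no response, hence cannot all be required to take effect). -/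
def Linearizable (v₀ : Fin n → α) (H : History n α) : Prop :=
  ∃ (S : Set ℕ) (pos : ℕ → ℕ),
    (∀ k ∈ S, ∃ i o, H.IsOp k i o) ∧
    (∀ k, H.Completes k → k ∈ S) ∧
    Set.InjOn pos S ∧
    -- real-time order
    (∀ k ∈ S, ∀ k' ∈ S, H.Precedes k k' → pos k < pos k') ∧
    -- sequential specification: an update is acknowledged
    (∀ k i v m r, H.IsOp k i (.update v) → H.CompletesAt k m r → r = .ack) ∧
    -- sequential specification: a scan returns, for each segment `j`, the value of the last
    -- update by node `j` that precedes it, or the initial value if there is none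
    (∀ k i m r, H.IsOp k i .scan → H.CompletesAt k m r →
      ∃ s, r = .snap s ∧ ∀ j,
        (∃ k' ∈ S, ∃ v, H.IsOp k' j (.update v) ∧ pos k' < pos k ∧ s j = v ∧
          ∀ k'' ∈ S, ∀ w, H.IsOp k'' j (.update w) → pos k'' < pos k → pos k'' ≤ pos k') ∨
        ((∀ k' ∈ S, ∀ v, H.IsOp k' j (.update v) → ¬ pos k' < pos k) ∧ s j = v₀ j))

end History

end Snapshot

/-! # The algorithm AC-ASO in an asynchronous crash-prone message-passing system -/

namespace ACASO

open Snapshot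

/-- A value-timestamp pair `⟨val, ⟨tag, writer⟩⟩`. -/
structure TVal (n : ℕ) (α : Type*) where
  val : α
  tag : ℕ
  writer : Fin n

/-- `H^{≤ r}`: the values in `H` with tag at most `r`. -/
def leTag {n : ℕ} {α : Type*} (r : ℕ) (H : Set (TVal n α)) : Set (TVal n α) :=
  {u ∈ H | u.tag ≤ r}

/-- Messages.  The number `q` in a request and in its acknowledgement identifies the request
(among the requests of its sender) that is being acknowledged. -/
inductive Msg (n : ℕ) (α : Type*) where
  | value (u : TVal n α)
  | readTag (q : ℕ)
  | readAck (q tag : ℕ)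
  | writeTag (q tag : ℕ)
  | writeAck (q tag : ℕ)
  | echoTag (tag : ℕ)
  | goodLA (tag : ℕ)

/-- Control state of the client thread of a node.

Here `o` is the pending operation and `ph` says which call of `Lattice` is meant: `ph = 0` is the
phase 0 call of an update, `ph = 1, 2, 3` are the phases of `LatticeRenewal`. -/
inductive PC (n : ℕ) (α : Type*) where
  /-- no pending operation -/
  | idle
  /-- at the start of the operation, about to send `readTag` -/
  | readStart (o : Op α)
  /-- waiting for acknowledgements of the `readTag` request `q` -/
  | readWait (o : Op α) (q : ℕ)
  /-- in `update v`, `readTag` has returned `r`; about to send the value -/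
  | sendValue (v : α) (r : ℕ)
  /-- at the start of `Lattice r`, about to send `writeTag` -/
  | latStart (o : Op α) (ph r : ℕ)
  /-- in `Lattice r`, waiting for acknowledgements of the `writeTag` request `q` -/
  | latWrite (o : Op α) (ph r q : ℕ)
  /-- in `Lattice r`, waiting for the equivalence quorum -/
  | latWait (o : Op α) (ph r : ℕ)
  /-- `Lattice r` has returned `(true, view)` if `res = some view`, `(false, ∅)` if `res = none` -/
  | latDone (o : Op α) (ph r : ℕ) (res : Option (Set (TVal n α)))
  /-- in `LatticeRenewal`, waiting to receive `(goodLA, r)` -/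
  | borrow (o : Op α) (r : ℕ)
  /-- `LatticeRenewal` has returned `view`; about to return from the operation -/
  | renewed (o : Op α) (view : Set (TVal n α))

/-- Local state of a node: the variables `V`, `D`, `maxTag` of the algorithm, the messages received
so far from each node, the number of requests made so far, and the control state of the client
thread. -/
structure Local (n : ℕ) (α : Type*) where
  V : Fin n → Set (TVal n α)
  D : Fin n → Set (TVal n α)
  maxTag : ℕ
  rcvd : Fin n → Set (Msg n α)
  reqs : ℕ
  pc : PC n α

/-- A send command: send `msg` to all nodes in `dest`. -/
structure Cmd (n : ℕ) (α : Type*) where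
  dest : Finset (Fin n)
  msg : Msg n α

section Algorithm

variable {n : ℕ} {α : Type*}

/-- "Send `m` to all" (the sender included). -/
def Cmd.toAll (m : Msg n α) : Cmd n α := ⟨Finset.univ, m⟩

/-- "Send `m` to `j`". -/
def Cmd.to (j : Fin n) (m : Msg n α) : Cmd n α := ⟨{j}, m⟩

/-- The predicate `EQ(V, i)`: there is an equivalence quorum. -/
def EQ (f : ℕ) {β : Type*} (V : Fin n → β) (i : Fin n) : Prop :=
  ∃ Q : Finset (Fin n), n - f ≤ Q.card ∧ ∀ j ∈ Q, V j = V i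

/-- At least `n - f` nodes `j` satisfy `P`. -/
def Quorum (f : ℕ) (P : Fin n → Prop) : Prop :=
  ∃ Q : Finset (Fin n), n - f ≤ Q.card ∧ ∀ j ∈ Q, P j

/-- `snap` is a result of `extract(S)`: `snap j` is the value of node `j` in `S` with the largest
tag, or the initial value `v₀ j` if `S` contains no value of node `j`. -/
def Extract (v₀ : Fin n → α) (S : Set (TVal n α)) (snap : Fin n → α) : Prop :=
  ∀ j, (∃ u ∈ S, u.writer = j ∧ (∀ w ∈ S, w.writer = j → w.tag ≤ u.tag) ∧ snap j = u.val) ∨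
    ((∀ u ∈ S, u.writer ≠ j) ∧ snap j = v₀ j)

/-- State of node `s` after recording that `m` has been received from `j`. -/
def Local.record (s : Local n α) (j : Fin n) (m : Msg n α) : Local n α :=
  { s with rcvd := Function.update s.rcvd j (insert m (s.rcvd j)) }

/-- `V` after adding `u` into `V[j]` and `V[i]`. -/
def addValue (V : Fin n → Set (TVal n α)) (i j : Fin n) (u : TVal n α) :
    Fin n → Set (TVal n α) :=
  fun k => {w | w ∈ V k ∨ ((k = j ∨ k = i) ∧ w = u)}

open Classical in
/-- The event handlers of node `i`: new local state and send commands (in order) upon receiving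
a message from node `j` in local state `s`.  A value has been seen before iff it is in `V[i]`. -/
noncomputable def handle (i j : Fin n) (s : Local n α) : Msg n α → Local n α × List (Cmd n α)
  | .value u =>
      ({ s.record j (.value u) with V := addValue s.V i j u },
        if u ∈ s.V i then [] else [.toAll (.value u)])
  | .writeTag q tag =>
      ({ s.record j (.writeTag q tag) with maxTag := max s.maxTag tag },
        [.toAll (.echoTag tag), .to j (.writeAck q tag)])
  | .echoTag tag =>
      ({ s.record j (.echoTag tag) with maxTag := max s.maxTag tag }, [])
  | .readTag q =>
      (s.record j (.readTag q), [.to j (.readAck q s.maxTag)])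
  | .goodLA r =>
      ({ s.record j (.goodLA r) with D := Function.update s.D j (leTag r (s.V j)) }, [])
  | .readAck q tag => (s.record j (.readAck q tag), [])
  | .writeAck q tag => (s.record j (.writeAck q tag), [])

/-- The steps of the client thread of node `i` other than invocations and responses:
`ClientStep f i s s' cmds` means that in local state `s` the thread can do one atomic step that
leads to local state `s'` and executes the send commands `cmds`. -/
inductive ClientStep (f : ℕ) (i : Fin n) :
    Local n α → Local n α → List (Cmd n α) → Prop
  /-- `readTag()`: send the request. -/
  | sendReadTag (s : Local n α) (o : Op α) (h : s.pc = .readStart o) :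
      ClientStep f i s { s with pc := .readWait o s.reqs, reqs := s.reqs + 1 }
        [.toAll (.readTag s.reqs)]
  /-- In an update, `readTag()` returns the largest tag in the acknowledgements. -/
  | readUpdate (s : Local n α) (v : α) (q r : ℕ) (h : s.pc = .readWait (.update v) q)
      (hq : Quorum f fun j => ∃ t, Msg.readAck q t ∈ s.rcvd j)
      (hr : IsGreatest {t | ∃ j, Msg.readAck q t ∈ s.rcvd j} r) :
      ClientStep f i s { s with pc := .sendValue v r } []
  /-- In a scan, `readTag()` returns the largest tag in the acknowledgements, and
  `LatticeRenewal(r)` is called. -/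
  | readScan (s : Local n α) (q r : ℕ) (h : s.pc = .readWait .scan q)
      (hq : Quorum f fun j => ∃ t, Msg.readAck q t ∈ s.rcvd j)
      (hr : IsGreatest {t | ∃ j, Msg.readAck q t ∈ s.rcvd j} r) :
      ClientStep f i s { s with pc := .latStart .scan 1 r } []
  /-- In an update, send the value with timestamp `⟨r + 1, i⟩`, and call `Lattice(r)`
  (phase 0). -/
  | sendValue (s : Local n α) (v : α) (r : ℕ) (h : s.pc = .sendValue v r) :
      ClientStep f i s { s with pc := .latStart (.update v) 0 r }
        [.toAll (.value ⟨v, r + 1, i⟩)]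
  /-- `writeTag(r)`: send the request. -/
  | sendWriteTag (s : Local n α) (o : Op α) (ph r : ℕ) (h : s.pc = .latStart o ph r) :
      ClientStep f i s { s with pc := .latWrite o ph r s.reqs, reqs := s.reqs + 1 }
        [.toAll (.writeTag s.reqs r)]
  /-- `writeTag(r)` returns. -/
  | writeDone (s : Local n α) (o : Op α) (ph r q : ℕ) (h : s.pc = .latWrite o ph r q)
      (hq : Quorum f fun j => Msg.writeAck q r ∈ s.rcvd j) :
      ClientStep f i s { s with pc := .latWait o ph r } []
  /-- `EQ(V^{≤ r}, i)` holds and no larger tag is known: the lattice operation is good. -/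
  | good (s : Local n α) (o : Op α) (ph r : ℕ) (h : s.pc = .latWait o ph r)
      (hEQ : EQ f (fun j => leTag r (s.V j)) i) (htag : s.maxTag ≤ r) :
      ClientStep f i s { s with pc := .latDone o ph r (some (leTag r (s.V i))) }
        [.toAll (.goodLA r)]
  /-- `EQ(V^{≤ r}, i)` holds and a larger tag is known: the lattice operation fails. -/
  | bad (s : Local n α) (o : Op α) (ph r : ℕ) (h : s.pc = .latWait o ph r)
      (hEQ : EQ f (fun j => leTag r (s.V j)) i) (htag : r < s.maxTag) :
      ClientStep f i s { s with pc := .latDone o ph r none } []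
  /-- After phase 0, `LatticeRenewal(max {r + 1, maxTag})` is called; the result of phase 0
  is not used. -/
  | afterPhase0 (s : Local n α) (o : Op α) (r : ℕ) (res : Option (Set (TVal n α)))
      (h : s.pc = .latDone o 0 r res) :
      ClientStep f i s { s with pc := .latStart o 1 (max (r + 1) s.maxTag) } []
  /-- `LatticeRenewal` returns a direct view. -/
  | direct (s : Local n α) (o : Op α) (ph r : ℕ) (view : Set (TVal n α)) (hph : 1 ≤ ph)
      (h : s.pc = .latDone o ph r (some view)) :
      ClientStep f i s { s with pc := .renewed o view } []
  /-- After a failed lattice operation in phase 1 or 2, the next phase uses tag `maxTag`. -/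
  | nextPhase (s : Local n α) (o : Op α) (ph r : ℕ) (hph : 1 ≤ ph) (hph3 : ph < 3)
      (h : s.pc = .latDone o ph r none) :
      ClientStep f i s { s with pc := .latStart o (ph + 1) s.maxTag } []
  /-- After a failed lattice operation in phase 3, the loop ends. -/
  | exitLoop (s : Local n α) (o : Op α) (r : ℕ) (h : s.pc = .latDone o 3 r none) :
      ClientStep f i s { s with pc := .borrow o r } []
  /-- `(goodLA, r)` has been received from `j`: `LatticeRenewal` returns an indirect view. -/
  | indirect (s : Local n α) (o : Op α) (r : ℕ) (j : Fin n) (h : s.pc = .borrow o r)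
      (hj : Msg.goodLA r ∈ s.rcvd j) :
      ClientStep f i s { s with pc := .renewed o (s.D j) } []

/-- In local state `s`, the client thread of node `i` can return response `r`. -/
inductive CanRespond (v₀ : Fin n → α) : Local n α → Resp n α → Prop
  | update (s : Local n α) (v : α) (view : Set (TVal n α)) (h : s.pc = .renewed (.update v) view) :
      CanRespond v₀ s .ack
  | scan (s : Local n α) (view : Set (TVal n α)) (snap : Fin n → α)
      (h : s.pc = .renewed .scan view) (hs : Extract v₀ view snap) :
      CanRespond v₀ s (.snap snap)

/-- The client thread of node `i` waits for the equivalence quorum of `Lattice(r)`, and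
`EQ(V^{≤ r}, i)` is true.  In this situation the thread proceeds before any further message is
handled at `i`, so that it uses the vector `V^{≤ r}` that satisfies the predicate for the first
time. -/
def LatticeReady (f : ℕ) (i : Fin n) (s : Local n α) : Prop :=
  ∃ o ph r, s.pc = .latWait o ph r ∧ EQ f (fun j => leTag r (s.V j)) i

end Algorithm

/-- Global state: local states, the FIFO channels (`chan i j` is the queue of messages in transit
from `i` to `j`, oldest first), and the set of crashed nodes. -/
structure Config (n : ℕ) (α : Type*) where
  loc : Fin n → Local n α
  chan : Fin n → Fin n → List (Msg n α)
  crashed : Set (Fin n)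

/-- Actions of the system.  `skip` is a stuttering step, so that finite executions can be
extended to infinite ones. -/
inductive Action (n : ℕ) (α : Type*) where
  | invoke (i : Fin n) (o : Op α)
  | respond (i : Fin n) (r : Resp n α)
  | client (i : Fin n)
  | deliver (j i : Fin n)
  | crash (i : Fin n)
  | skip

section System

variable {n : ℕ} {α : Type*}

/-- The initial state. -/
def Config.initial : Config n α where
  loc := fun _ =>
    { V := fun _ => ∅, D := fun _ => ∅, maxTag := 0, rcvd := fun _ => ∅, reqs := 0, pc := .idle }
  chan := fun _ _ => []
  crashed := ∅

/-- Replace the local state of node `i`. -/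
def Config.setLoc (c : Config n α) (i : Fin n) (s : Local n α) : Config n α :=
  { c with loc := Function.update c.loc i s }

/-- Node `i` executes the send commands `cmds`, in this order. -/
def Config.send (c : Config n α) (i : Fin n) (cmds : List (Cmd n α)) : Config n α :=
  { c with
    chan := fun k j =>
      if k = i then c.chan k j ++ (cmds.filter fun x => j ∈ x.dest).map Cmd.msg else c.chan k j }

/-- Replace the content of the channel from `j` to `i`. -/
def Config.setChan (c : Config n α) (j i : Fin n) (l : List (Msg n α)) : Config n α :=
  { c with chan := Function.update c.chan j (Function.update (c.chan j) i l) }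

/-- Node `i` crashes. -/
def Config.kill (c : Config n α) (i : Fin n) : Config n α :=
  { c with crashed := insert i c.crashed }

/-- A node that crashes while it executes `cmds` may execute only `cmds'`: some commands are
completed, then a command reaches only some of its destinations, and the rest is not executed. -/
def Interrupted (cmds cmds' : List (Cmd n α)) : Prop :=
  ∃ (pre post : List (Cmd n α)) (x : Cmd n α) (d : Finset (Fin n)),
    cmds = pre ++ x :: post ∧ d ⊆ x.dest ∧ cmds' = pre ++ [⟨d, x.msg⟩]

/-- The transitions of the system. -/
inductive Step (f : ℕ) (v₀ : Fin n → α) : Config n α → Action n α → Config n α → Prop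
  | invoke (c : Config n α) (i : Fin n) (o : Op α) (hi : i ∉ c.crashed)
      (h : (c.loc i).pc = .idle) :
      Step f v₀ c (.invoke i o) (c.setLoc i { c.loc i with pc := .readStart o })
  | respond (c : Config n α) (i : Fin n) (r : Resp n α) (hi : i ∉ c.crashed)
      (h : CanRespond v₀ (c.loc i) r) :
      Step f v₀ c (.respond i r) (c.setLoc i { c.loc i with pc := .idle })
  | client (c : Config n α) (i : Fin n) (s : Local n α) (cmds : List (Cmd n α))
      (hi : i ∉ c.crashed) (h : ClientStep f i (c.loc i) s cmds) :
      Step f v₀ c (.client i) ((c.setLoc i s).send i cmds)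
  | deliver (c : Config n α) (j i : Fin n) (m : Msg n α) (l : List (Msg n α))
      (hi : i ∉ c.crashed) (hready : ¬ LatticeReady f i (c.loc i)) (h : c.chan j i = m :: l) :
      Step f v₀ c (.deliver j i)
        (((c.setChan j i l).setLoc i (handle i j (c.loc i) m).1).send i
          (handle i j (c.loc i) m).2)
  /-- A node crashes between two of its steps. -/
  | crash (c : Config n α) (i : Fin n) (hi : i ∉ c.crashed) :
      Step f v₀ c (.crash i) (c.kill i)
  /-- A node crashes during a step of its client thread. -/
  | crashClient (c : Config n α) (i : Fin n) (s : Local n α) (cmds cmds' : List (Cmd n α))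
      (hi : i ∉ c.crashed) (h : ClientStep f i (c.loc i) s cmds) (hc : Interrupted cmds cmds') :
      Step f v₀ c (.crash i) (((c.setLoc i s).send i cmds').kill i)
  /-- A node crashes during the handling of a message. -/
  | crashDeliver (c : Config n α) (j i : Fin n) (m : Msg n α) (l : List (Msg n α))
      (cmds' : List (Cmd n α)) (hi : i ∉ c.crashed) (hready : ¬ LatticeReady f i (c.loc i))
      (h : c.chan j i = m :: l) (hc : Interrupted (handle i j (c.loc i) m).2 cmds') :
      Step f v₀ c (.crash i)
        ((((c.setChan j i l).setLoc i (handle i j (c.loc i) m).1).send i cmds').kill i)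
  | skip (c : Config n α) : Step f v₀ c .skip c

end System

/-- An execution of AC-ASO on `n` nodes, with resilience parameter `f` and initial segment
values `v₀`: the state at each time and the action between times `t` and `t + 1`.
(Neither a bound on the number of crashes nor fairness is part of this definition.) -/
structure Execution (n f : ℕ) {α : Type*} (v₀ : Fin n → α) where
  state : ℕ → Config n α
  action : ℕ → Action n α
  start : state 0 = Config.initial
  step : ∀ t, Step f v₀ (state t) (action t) (state (t + 1))

namespace Execution

variable {n f : ℕ} {α : Type*} {v₀ : Fin n → α}

/-- The set of nodes that crash in the execution. -/
def faulty (E : Execution n f v₀) : Set (Fin n) :=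
  {i | ∃ t, i ∈ (E.state t).crashed}

/-- The history of invocations and responses of the execution. -/
def history (E : Execution n f v₀) : History n α := fun t =>
  match E.action t with
  | .invoke i o => .invoke i o
  | .respond i r => .respond i r
  | _ => .internal

/-- The client thread of node `i` can take a step in configuration `c`. -/
def ClientEnabled (f : ℕ) (v₀ : Fin n → α) (c : Config n α) (i : Fin n) : Prop :=
  (∃ s cmds, ClientStep f i (c.loc i) s cmds) ∨ ∃ r, CanRespond v₀ (c.loc i) r

/-- The execution is fair: channels are reliable, that is, a message in transit to a node that
does not crash is eventually received; and at a node that does not crash the client thread does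
not stay enabled for ever without taking a step. -/
structure Fair (E : Execution n f v₀) : Prop where
  channels : ∀ j i t, i ∉ E.faulty → (E.state t).chan j i ≠ [] →
    ∃ t' ≥ t, E.action t' = .deliver j i
  clients : ∀ i t, i ∉ E.faulty → (∀ t' ≥ t, ClientEnabled f v₀ (E.state t') i) →
    ∃ t' ≥ t, E.action t' = .client i ∨ ∃ r, E.action t' = .respond i r

end Execution

end ACASO

/-! Call a value stored when a quorum of at least n - f nodes has sent it, and a tag stored when a
quorum has a `maxTag` at least that large. Since 2f < n, two quorums share a node. Almost every
argument takes a common node and uses FIFO there: whoever has received its later message has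
received its earlier one.

Completed updates (`ownStage`, `tag_correct`). Phase 0 is acknowledged only by nodes that have
already forwarded the value, so the value is stored; phase 1 of `LatticeRenewal` stores a tag at
least r + 1, the tag of the value. A later operation therefore reads a tag at least as large and has
received the value when `readTag` returns, so each of its successful `Lattice` calls contains the
value. It also follows that a node writes with increasing tags, and that writer and tag determine a
value.

Views form a chain (`GoodAt.view_total`). For equal tags, a common node of the two equivalence
quorums sent its values to both callers in the same order. For tags r < r', let y be in the
equivalence quorum of the first call and in the quorum acknowledging tag r' to the second. Node y
sends its echo of r' before its acknowledgement, and the first caller has not seen r'; so the values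
it got from y were sent before the acknowledgement and reach the second caller first.

Borrowed views (`view_of_D`, `renewalStage`). By FIFO, `D[j]` is exactly the view of a successful
call of j. After three failures the borrowed tag exceeds the `maxTag` that the borrower had when it
knew, in phase 1, that all values it must return were stored; the argument for r < r' then puts them
into the borrowed view.

Linearization (`ViewAssignment.linearizable`). Sort scans by inclusion of views and put each update
before the scans that see it. Real-time order holds because a view that contains a value also
contains everything stored when the update writing it was invoked (`mem_view_of_required`).

Termination (`eventually_EQ`, `goodLA_of_tagSeen`). Only finitely many values have tag at most r,
and they are flooded, so the equivalence quorum appears. The wait for `goodLA r` ends because a tag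
above r can enter the system only after a successful phase 0 call of `Lattice(r)`, which announced
it. -/

namespace ACASO

open Snapshot

/-! ### Transitions as seen by a single node -/

section Steps

variable {n f : ℕ} {α : Type*} {v₀ : Fin n → α}

/-- The messages that reach `j` when the commands `cmds` are executed. -/
def outbox (cmds : List (Cmd n α)) (j : Fin n) : List (Msg n α) :=
  (cmds.filter fun x => j ∈ x.dest).map Cmd.msg

theorem mem_outbox {cmds : List (Cmd n α)} {j : Fin n} {m : Msg n α} :
    m ∈ outbox cmds j ↔ ∃ c ∈ cmds, j ∈ c.dest ∧ c.msg = m := by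
  simp [outbox, and_assoc]

theorem Interrupted.mem_outbox {cmds cmds' : List (Cmd n α)} (h : Interrupted cmds cmds')
    {j : Fin n} {m : Msg n α} (hm : m ∈ outbox cmds' j) : m ∈ outbox cmds j := by
  obtain ⟨pre, post, x, d, rfl, hd, rfl⟩ := h
  rw [ACASO.mem_outbox] at hm ⊢
  obtain ⟨c, hc, hj, rfl⟩ := hm
  rcases List.mem_append.1 hc with hc | hc
  · exact ⟨c, by simp [hc], hj, rfl⟩
  · obtain rfl : c = ⟨d, x.msg⟩ := by simpa using hc
    exact ⟨x, by simp, hd hj, rfl⟩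

/-- The steps of the client thread of node `i`, including invocations and responses. -/
inductive OwnStep (f : ℕ) (v₀ : Fin n → α) (i : Fin n) :
    Action n α → Local n α → Local n α → List (Cmd n α) → Prop
  | invoke (s : Local n α) (o : Op α) (h : s.pc = .idle) :
      OwnStep f v₀ i (.invoke i o) s { s with pc := .readStart o } []
  | respond (s : Local n α) (r : Resp n α) (h : CanRespond v₀ s r) :
      OwnStep f v₀ i (.respond i r) s { s with pc := .idle } []
  | client (a : Action n α) (s s' : Local n α) (cmds : List (Cmd n α))
      (h : ClientStep f i s s' cmds) (ha : a = .client i ∨ a = .crash i) :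
      OwnStep f v₀ i a s s' cmds

/-- The commands `cmds'` are what is executed of `cmds`; this is everything unless there is a
crash. -/
def Executed (cmds cmds' : List (Cmd n α)) (crash : Prop) : Prop :=
  cmds' = cmds ∨ (Interrupted cmds cmds' ∧ crash)

theorem Executed.mem_outbox {cmds cmds' : List (Cmd n α)} {p : Prop} (h : Executed cmds cmds' p)
    {j : Fin n} {m : Msg n α} (hm : m ∈ outbox cmds' j) : m ∈ outbox cmds j := by
  rcases h with rfl | h
  · exact hm
  · exact h.1.mem_outbox hm

theorem Executed.eq {cmds cmds' : List (Cmd n α)} {p : Prop} (h : Executed cmds cmds' p)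
    (hp : ¬ p) : cmds' = cmds := by
  rcases h with rfl | h
  · rfl
  · exact absurd h.2 hp

/-- Node `i` takes a step of its client thread with commands `cmds`, of which `cmds'` are
executed. -/
def OwnMove (f : ℕ) (v₀ : Fin n → α) (c : Config n α) (a : Action n α) (c' : Config n α)
    (i : Fin n) (s : Local n α) (cmds cmds' : List (Cmd n α)) : Prop :=
  i ∉ c.crashed ∧ OwnStep f v₀ i a (c.loc i) s cmds ∧ Executed cmds cmds' (i ∈ c'.crashed) ∧
    c'.loc = Function.update c.loc i s ∧
    ∀ k b, c'.chan k b = c.chan k b ++ if k = i then outbox cmds' b else []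

/-- Node `i` receives the message `m` from `j`; `l` is what remains in the channel, and `cmds'` are
the commands that are executed. -/
def Receives (f : ℕ) (c : Config n α) (a : Action n α) (c' : Config n α)
    (i j : Fin n) (m : Msg n α) (l : List (Msg n α)) (cmds' : List (Cmd n α)) : Prop :=
  i ∉ c.crashed ∧ (a = .deliver j i ∨ a = .crash i) ∧ ¬ LatticeReady f i (c.loc i) ∧
    c.chan j i = m :: l ∧ Executed (handle i j (c.loc i) m).2 cmds' (i ∈ c'.crashed) ∧
    c'.loc = Function.update c.loc i (handle i j (c.loc i) m).1 ∧
    ∀ k b, c'.chan k b = (if k = j ∧ b = i then l else c.chan k b) ++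
      if k = i then outbox cmds' b else []

theorem setChan_apply (c : Config n α) (j i : Fin n) (l : List (Msg n α)) (k b : Fin n) :
    (c.setChan j i l).chan k b = if k = j ∧ b = i then l else c.chan k b := by
  by_cases hk : k = j
  · subst hk
    by_cases hb : b = i
    · subst hb; simp [Config.setChan]
    · simp [Config.setChan, hb]
  · simp [Config.setChan, hk]

theorem send_chan_apply (c : Config n α) (i : Fin n) (cmds : List (Cmd n α)) (k b : Fin n) :
    (c.send i cmds).chan k b = c.chan k b ++ if k = i then outbox cmds b else [] := by
  by_cases hk : k = i <;> simp [Config.send, outbox, hk]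

theorem Step.cases {c c' : Config n α} {a : Action n α} (h : Step f v₀ c a c') :
    c.crashed ⊆ c'.crashed ∧
    (((a = .skip ∨ ∃ i, a = .crash i) ∧ c'.loc = c.loc ∧ c'.chan = c.chan) ∨
      (∃ i s cmds cmds', OwnMove f v₀ c a c' i s cmds cmds') ∨
      (∃ i j m l cmds', Receives f c a c' i j m l cmds')) := by
  cases h with
  | invoke i o hi h =>
    exact ⟨subset_rfl, .inr (.inl ⟨i, _, [], [], hi, .invoke _ _ h, .inl rfl, rfl,
      fun k b => by simp [Config.setLoc, outbox]⟩)⟩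
  | respond i r hi h =>
    exact ⟨subset_rfl, .inr (.inl ⟨i, _, [], [], hi, .respond _ _ h, .inl rfl, rfl,
      fun k b => by simp [Config.setLoc, outbox]⟩)⟩
  | client i s cmds hi h =>
    exact ⟨subset_rfl, .inr (.inl ⟨i, _, _, _, hi, .client _ _ _ _ h (.inl rfl), .inl rfl, rfl,
      fun k b => send_chan_apply _ _ _ _ _⟩)⟩
  | deliver j i m l hi hr h =>
    exact ⟨subset_rfl, .inr (.inr ⟨i, j, m, l, _, hi, .inl rfl, hr, h, .inl rfl, rfl,
      fun k b => by
        rw [send_chan_apply]; congr 1; exact setChan_apply _ _ _ _ _ _⟩)⟩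
  | crash i hi =>
    exact ⟨Set.subset_insert _ _, .inl ⟨.inr ⟨i, rfl⟩, rfl, rfl⟩⟩
  | crashClient i s cmds cmds' hi h hc =>
    exact ⟨Set.subset_insert _ _, .inr (.inl ⟨i, _, _, cmds', hi, .client _ _ _ _ h (.inr rfl),
      .inr ⟨hc, Set.mem_insert _ _⟩, rfl, fun k b => send_chan_apply _ _ _ _ _⟩)⟩
  | crashDeliver j i m l cmds' hi hr h hc =>
    exact ⟨Set.subset_insert _ _, .inr (.inr ⟨i, j, m, l, cmds', hi, .inr rfl, hr, h,
      .inr ⟨hc, Set.mem_insert _ _⟩, rfl, fun k b => by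
        change (Config.send _ _ _).chan k b = _
        rw [send_chan_apply]; congr 1; exact setChan_apply _ _ _ _ _ _⟩)⟩
  | skip => exact ⟨subset_rfl, .inl ⟨.inl rfl, rfl, rfl⟩⟩

/-! ### What a local step changes -/

theorem OwnStep.unchanged {i : Fin n} {a : Action n α} {s s' : Local n α}
    {cmds : List (Cmd n α)} (h : OwnStep f v₀ i a s s' cmds) :
    s'.V = s.V ∧ s'.D = s.D ∧ s'.maxTag = s.maxTag ∧ s'.rcvd = s.rcvd ∧ s.reqs ≤ s'.reqs := by
  cases h with
  | invoke | respond => simp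
  | client _ _ _ _ h => cases h <;> simp

theorem OwnStep.client_of_mem {i : Fin n} {a : Action n α} {s s' : Local n α}
    {cmds : List (Cmd n α)} (h : OwnStep f v₀ i a s s' cmds) {c : Cmd n α} (hc : c ∈ cmds) :
    ClientStep f i s s' cmds := by
  cases h with
  | invoke | respond => simp at hc
  | client _ _ _ _ h => exact h

theorem ClientStep.dest_eq_univ {i : Fin n} {s s' : Local n α} {cmds : List (Cmd n α)}
    (h : ClientStep f i s s' cmds) {c : Cmd n α} (hc : c ∈ cmds) : c.dest = Finset.univ := by
  cases h <;> simp_all [Cmd.toAll]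

/-- Commands are executed in order, so a trace of the second one shows that the first was completed.
It is needed for the handler of `writeTag`, where the echo precedes the acknowledgement. -/
theorem Interrupted.mem_of_second {c₁ c₂ : Cmd n α} {cmds' : List (Cmd n α)}
    (h : Interrupted [c₁, c₂] cmds') {i j : Fin n} {m : Msg n α} (hm : m ∈ outbox cmds' i)
    (hne : c₁.msg ≠ m) (hj : j ∈ c₁.dest) : c₁.msg ∈ outbox cmds' j := by
  obtain ⟨pre, post, x, d, h, hd, rfl⟩ := h
  rcases pre with _ | ⟨a, pre⟩
  · simp only [List.nil_append, List.cons.injEq] at h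
    obtain ⟨rfl, -⟩ := h
    simp only [List.nil_append, ACASO.mem_outbox, List.mem_singleton, exists_eq_left] at hm
    exact absurd hm.2 hne
  · simp only [List.cons_append, List.cons.injEq] at h
    obtain ⟨rfl, -⟩ := h
    exact ACASO.mem_outbox.2 ⟨c₁, by simp, hj, rfl⟩

theorem ClientStep.unchanged {s s' : Local n α} {i : Fin n} {cmds : List (Cmd n α)}
    (h : ClientStep f i s s' cmds) :
    s'.V = s.V ∧ s'.D = s.D ∧ s'.maxTag = s.maxTag ∧ s'.rcvd = s.rcvd := by
  cases h <;> simp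

theorem CanRespond.pc_eq {s : Local n α} {r : Resp n α} (h : CanRespond v₀ s r) :
    ∃ o view, s.pc = .renewed o view := by
  cases h with
  | update v view h => exact ⟨_, _, h⟩
  | scan view snap h => exact ⟨_, _, h⟩

theorem handle_pc (i j : Fin n) (s : Local n α) (m : Msg n α) : (handle i j s m).1.pc = s.pc := by
  cases m <;> rfl

theorem handle_reqs (i j : Fin n) (s : Local n α) (m : Msg n α) :
    (handle i j s m).1.reqs = s.reqs := by
  cases m <;> rfl

theorem handle_rcvd (i j : Fin n) (s : Local n α) (m : Msg n α) :
    (handle i j s m).1.rcvd = Function.update s.rcvd j (insert m (s.rcvd j)) := by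
  cases m <;> rfl

theorem handle_maxTag_le (i j : Fin n) (s : Local n α) (m : Msg n α) :
    s.maxTag ≤ (handle i j s m).1.maxTag := by
  cases m <;> simp [handle, Local.record]

theorem handle_V_subset (i j k : Fin n) (s : Local n α) (m : Msg n α) :
    s.V k ⊆ (handle i j s m).1.V k := by
  intro u hu
  cases m <;> simp [handle, Local.record, addValue, hu]

end Steps

/-! ### One step of an execution: local states and FIFO channels -/

namespace Execution

variable {n f : ℕ} {α : Type*} {v₀ : Fin n → α} (E : Execution n f v₀)

/-- The local state of node `i` at time `t`. -/
abbrev loc (t : ℕ) (i : Fin n) : Local n α := (E.state t).loc i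

/-- Node `i` has not crashed by time `t`. -/
def Alive (t : ℕ) (i : Fin n) : Prop := i ∉ (E.state t).crashed

/-- The messages that have been sent from `j` to `i` by time `t`. -/
def Sent (t : ℕ) (j i : Fin n) : Set (Msg n α) :=
  {m | m ∈ (E.loc t i).rcvd j ∨ m ∈ (E.state t).chan j i}

theorem Alive.of_succ {E : Execution n f v₀} {t : ℕ} {i : Fin n} (h : E.Alive (t + 1) i) :
    E.Alive t i := fun h' => h ((E.step t).cases.1 h')

theorem Alive.of_le {E : Execution n f v₀} {t t' : ℕ} {i : Fin n} (h : E.Alive t' i)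
    (htt : t ≤ t') : E.Alive t i := by
  induction t', htt using Nat.le_induction with
  | base => exact h
  | succ t' _ ih => exact ih h.of_succ

/-- How the local state of a node changes in a step. -/
theorem loc_step (t : ℕ) (i : Fin n) :
    (E.loc (t + 1) i = E.loc t i ∧
      (∀ o, E.action t ≠ .invoke i o) ∧ (∀ r, E.action t ≠ .respond i r) ∧
        E.action t ≠ .client i ∧ ∀ j, E.action t ≠ .deliver j i) ∨
    (E.Alive t i ∧ ∃ cmds, OwnStep f v₀ i (E.action t) (E.loc t i) (E.loc (t + 1) i) cmds ∧
      (E.Alive (t + 1) i → ∀ c ∈ cmds, ∀ b ∈ c.dest, c.msg ∈ E.Sent (t + 1) i b)) ∨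
    (E.Alive t i ∧ ∃ j m l, (E.action t = .deliver j i ∨ E.action t = .crash i) ∧
      ¬ LatticeReady f i (E.loc t i) ∧ (E.state t).chan j i = m :: l ∧
      E.loc (t + 1) i = (handle i j (E.loc t i) m).1) := by
  rcases (E.step t).cases.2 with ⟨ha, hl, -⟩ | ⟨k, s, cmds, cmds', hk, ho, he, hl, hc⟩ |
    ⟨k, j, m, l, cmds', hk, ha, hr, hc, -, hl, -⟩
  · refine .inl ⟨congrFun hl i, ?_⟩
    rcases ha with ha | ⟨j, ha⟩ <;> simp [ha]
  · by_cases hik : i = k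
    · subst hik
      refine .inr (.inl ⟨hk, cmds, ?_, fun hi c hcm b hb => .inr ?_⟩)
      · have : E.loc (t + 1) i = s := by simp [loc, hl]
        rwa [this]
      · rw [hc, if_pos rfl, he.eq hi]
        exact List.mem_append_right _ (mem_outbox.2 ⟨c, hcm, hb, rfl⟩)
    · refine .inl ⟨by simp [loc, hl, hik], ?_⟩
      have hki : ¬ k = i := fun h => hik h.symm
      generalize E.action t = a at ho
      cases ho with
      | invoke | respond => simp [hki]
      | client _ _ _ _ _ ha => rcases ha with rfl | rfl <;> simp [hki]
  · by_cases hik : i = k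
    · subst hik
      exact .inr (.inr ⟨hk, j, m, l, ha, hr, hc, by simp [loc, hl]⟩)
    · have hki : ¬ k = i := fun h => hik h.symm
      refine .inl ⟨by simp [loc, hl, hik], ?_⟩
      rcases ha with ha | ha <;> simp [ha, hki]

/-- `out` is what `j` sends to `i` in the step at time `t`. -/
def Output (t : ℕ) (j i : Fin n) (out : List (Msg n α)) : Prop :=
  out = [] ∨ ∃ (cmds cmds' : List (Cmd n α)) (p : Prop), Executed cmds cmds' p ∧
    out = outbox cmds' i ∧ E.Alive t j ∧
      (OwnStep f v₀ j (E.action t) (E.loc t j) (E.loc (t + 1) j) cmds ∨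
        ∃ k s m, cmds = (handle j k s m).2)

/-- How a channel and the set of messages received through it change in a step. -/
theorem chan_step (t : ℕ) (j i : Fin n) : ∃ out, E.Output t j i out ∧ (
    ((E.state (t + 1)).chan j i = (E.state t).chan j i ++ out ∧
      (E.loc (t + 1) i).rcvd j = (E.loc t i).rcvd j ∧ E.action t ≠ .deliver j i) ∨
    (∃ m l, (E.state t).chan j i = m :: l ∧ (E.state (t + 1)).chan j i = l ++ out ∧
      (E.loc (t + 1) i).rcvd j = insert m ((E.loc t i).rcvd j) ∧ E.Alive t i ∧
      E.loc (t + 1) i = (handle i j (E.loc t i) m).1)) := by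
  rcases (E.step t).cases.2 with ⟨ha, hl, hc⟩ | ⟨k, s, cmds, cmds', hk, ho, he, hl, hc⟩ |
    ⟨k, j', m, l, cmds', hk, ha, hr, hc, he, hl, hc'⟩
  · exact ⟨[], .inl rfl, .inl ⟨by simp [hc], by simp [loc, hl],
      by rcases ha with ha | ⟨_, ha⟩ <;> simp [ha]⟩⟩
  · refine ⟨_, ?_, .inl ⟨hc _ _, ?_, ?_⟩⟩
    · by_cases hjk : j = k
      · subst hjk
        have : E.loc (t + 1) j = s := by simp [loc, hl]
        exact .inr ⟨cmds, cmds', _, he, if_pos rfl, hk, .inl (this ▸ ho)⟩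
      · exact .inl (if_neg hjk)
    · by_cases hik : i = k
      · subst hik
        simp [loc, hl, ho.unchanged.2.2.2.1]
      · simp [loc, hl, hik]
    · generalize E.action t = a at ho
      cases ho with
      | invoke | respond => simp
      | client _ _ _ _ _ ha => rcases ha with rfl | rfl <;> simp
  · refine ⟨if j = k then outbox cmds' i else [], ?_, ?_⟩
    · by_cases hjk : j = k
      · subst hjk
        exact .inr ⟨_, cmds', _, he, if_pos rfl, hk, .inr ⟨_, _, _, rfl⟩⟩
      · exact .inl (if_neg hjk)
    by_cases hji : j = j' ∧ i = k
    · obtain ⟨rfl, rfl⟩ := hji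
      exact .inr ⟨m, l, hc, by simpa using hc' j i, by simp [loc, hl, handle_rcvd], hk,
        by simp [loc, hl]⟩
    · refine .inl ⟨by simpa only [if_neg hji] using hc' j i, ?_, ?_⟩
      · by_cases hik : i = k
        · subst hik
          have : j ≠ j' := fun h => hji ⟨h, rfl⟩
          simp [loc, hl, handle_rcvd, this]
        · simp [loc, hl, hik]
      · rintro ha'
        rcases ha with ha | ha
        · rw [ha] at ha'
          simp only [Action.deliver.injEq] at ha'
          exact hji ⟨ha'.1.symm, ha'.2.symm⟩
        · rw [ha] at ha'; cases ha'

/-- What a node sends in a step. -/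
theorem sends (t : ℕ) (j : Fin n) : ∃ cmds cmds' : List (Cmd n α),
    Executed cmds cmds' (¬ E.Alive (t + 1) j) ∧
    (∀ i m, m ∈ E.Sent (t + 1) j i ↔ m ∈ E.Sent t j i ∨ m ∈ outbox cmds' i) ∧
    ((cmds = [] ∧ E.loc (t + 1) j = E.loc t j) ∨ E.Alive t j ∧
      (OwnStep f v₀ j (E.action t) (E.loc t j) (E.loc (t + 1) j) cmds ∨
      ∃ k m, m ∈ (E.state t).chan k j ∧ E.loc (t + 1) j = (handle j k (E.loc t j) m).1 ∧
        (E.loc (t + 1) j).rcvd k = insert m ((E.loc t j).rcvd k) ∧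
        cmds = (handle j k (E.loc t j) m).2)) := by
  rcases (E.step t).cases.2 with ⟨ha, hl, hc⟩ | ⟨k, s, cmds, cmds', hk, ho, he, hl, hc⟩ |
    ⟨k, j', m, l, cmds', hk, ha, hr, hc, he, hl, hc'⟩
  · exact ⟨[], [], .inl rfl, by simp [Sent, loc, hl, hc, outbox], .inl ⟨rfl, by simp [loc, hl]⟩⟩
  · have hrc : ∀ i, (E.loc (t + 1) i).rcvd = (E.loc t i).rcvd := by
      intro i
      by_cases hik : i = k
      · subst hik
        simp [loc, hl, ho.unchanged.2.2.2.1]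
      · simp [loc, hl, hik]
    by_cases hjk : j = k
    · subst hjk
      refine ⟨cmds, cmds', by simpa [Alive] using he, ?_, .inr ⟨hk, .inl ?_⟩⟩
      · intro i m
        simp [Sent, hrc, hc, or_assoc]
      · have : E.loc (t + 1) j = s := by simp [loc, hl]
        rwa [this]
    · refine ⟨[], [], .inl rfl, ?_, .inl ⟨rfl, by simp [loc, hl, hjk]⟩⟩
      simp [Sent, hrc, hc, hjk, outbox]
  · have hS : ∀ i m', m' ∈ E.Sent (t + 1) j i ↔
        m' ∈ E.Sent t j i ∨ m' ∈ (if j = k then outbox cmds' i else []) := by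
      intro i m'
      by_cases hji : j = j' ∧ i = k
      · obtain ⟨rfl, rfl⟩ := hji
        simp only [Sent, Set.mem_ofPred_eq, hc', and_self, if_true, List.mem_append]
        simp only [loc, hl, Function.update_self, handle_rcvd, hc, Set.mem_insert_iff,
          List.mem_cons]
        tauto
      · have h1 : (E.loc (t + 1) i).rcvd j = (E.loc t i).rcvd j := by
          by_cases hik : i = k
          · subst hik
            have : j ≠ j' := fun h => hji ⟨h, rfl⟩
            simp [loc, hl, handle_rcvd, this]
          · simp [loc, hl, hik]
        simp only [Sent, Set.mem_ofPred_eq, hc', if_neg hji, List.mem_append, h1, or_assoc]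
    by_cases hjk : j = k
    · subst hjk
      refine ⟨_, cmds', by simpa [Alive] using he, by simpa using hS, .inr ⟨hk, .inr
        ⟨j', m, by simp [hc], by simp [loc, hl], by simp [loc, hl, handle_rcvd], rfl⟩⟩⟩
    · exact ⟨[], [], .inl rfl, by simpa [hjk, outbox] using hS, .inl ⟨rfl, by simp [loc, hl, hjk]⟩⟩

/-! ### Monotonicity -/

theorem sent_mono {t t' : ℕ} (h : t ≤ t') (j i : Fin n) : E.Sent t j i ⊆ E.Sent t' j i := by
  induction t', h using Nat.le_induction with
  | base => exact subset_rfl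
  | succ t' _ ih =>
    obtain ⟨_, _, _, h, _⟩ := E.sends t' j
    exact fun m hm => (h i m).2 (.inl (ih hm))

theorem rcvd_mono {t t' : ℕ} (h : t ≤ t') (j i : Fin n) :
    (E.loc t i).rcvd j ⊆ (E.loc t' i).rcvd j := by
  induction t', h using Nat.le_induction with
  | base => exact subset_rfl
  | succ t' _ ih =>
    obtain ⟨_, -, ⟨_, h, _⟩ | ⟨m, _, _, _, h, _⟩⟩ := E.chan_step t' j i
    · rwa [h]
    · rw [h]; exact ih.trans (Set.subset_insert _ _)

theorem rcvd_subset_sent (t : ℕ) (j i : Fin n) : (E.loc t i).rcvd j ⊆ E.Sent t j i :=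
  fun _ h => .inl h

theorem V_mono {t t' : ℕ} (h : t ≤ t') (j i : Fin n) :
    (E.loc t i).V j ⊆ (E.loc t' i).V j := by
  induction t', h using Nat.le_induction with
  | base => exact subset_rfl
  | succ t' _ ih =>
    rcases E.loc_step t' i with ⟨h, _⟩ | ⟨_, _, h, _⟩ | ⟨_, _, _, _, _, _, _, h⟩
    · rwa [h]
    · rwa [h.unchanged.1]
    · rw [h]; exact ih.trans (handle_V_subset _ _ _ _ _)

theorem maxTag_mono {t t' : ℕ} (h : t ≤ t') (i : Fin n) :
    (E.loc t i).maxTag ≤ (E.loc t' i).maxTag := by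
  induction t', h using Nat.le_induction with
  | base => exact le_rfl
  | succ t' _ ih =>
    rcases E.loc_step t' i with ⟨h, _⟩ | ⟨_, _, h, _⟩ | ⟨_, _, _, _, _, _, _, h⟩
    · rwa [h]
    · rwa [h.unchanged.2.2.1]
    · rw [h]; exact ih.trans (handle_maxTag_le _ _ _ _)

theorem reqs_mono {t t' : ℕ} (h : t ≤ t') (i : Fin n) :
    (E.loc t i).reqs ≤ (E.loc t' i).reqs := by
  induction t', h using Nat.le_induction with
  | base => exact le_rfl
  | succ t' _ ih =>
    rcases E.loc_step t' i with ⟨h, _⟩ | ⟨_, _, h, _⟩ | ⟨_, _, _, _, _, _, _, h⟩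
    · rwa [h]
    · exact ih.trans h.unchanged.2.2.2.2
    · rwa [h, handle_reqs]

theorem sent_zero (j i : Fin n) : E.Sent 0 j i = ∅ := by
  ext m
  simp [Sent, E.start, loc, Config.initial]

/-- A monotone property that holds at some time and not at time `0` starts to hold at some time. -/
theorem exists_first {P : ℕ → Prop} {a t : ℕ} (ha : ¬ P a) (hat : a ≤ t) (ht : P t) :
    ∃ s, a ≤ s ∧ s < t ∧ ¬ P s ∧ P (s + 1) := by
  induction t, hat using Nat.le_induction with
  | base => exact absurd ht ha
  | succ t hat ih =>
    by_cases h : P t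
    · obtain ⟨s, h1, h2, h3⟩ := ih h
      exact ⟨s, h1, by omega, h3⟩
    · exact ⟨t, hat, by omega, h, ht⟩

/-- The channel is FIFO: whatever was sent by time `t₀` is received before what is sent later. -/
theorem fifo (t t₀ : ℕ) (j i : Fin n) :
    (E.loc t i).rcvd j ⊆ E.Sent t₀ j i ∨ E.Sent t₀ j i ⊆ (E.loc t i).rcvd j := by
  rcases le_total t t₀ with h | h
  · exact .inl ((E.rcvd_mono h j i).trans (E.rcvd_subset_sent _ _ _))
  -- `l` is the part of the channel at time `t₀` that is still in transit. While it is nonempty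
  -- nothing newer has been received; once it is empty all of `Sent t₀` has been.
  · suffices ∃ l l', (E.state t).chan j i = l ++ l' ∧
        (∀ m ∈ E.Sent t₀ j i, m ∈ (E.loc t i).rcvd j ∨ m ∈ l) ∧ (∀ m ∈ l, m ∈ E.Sent t₀ j i) ∧
        (l = [] ∨ (E.loc t i).rcvd j ⊆ E.Sent t₀ j i) by
      obtain ⟨l, l', -, h1, -, rfl | h2⟩ := this
      · exact .inr fun m hm => by simpa using h1 m hm
      · exact .inl h2
    induction t, h using Nat.le_induction with
    | base => exact ⟨_, [], by simp, fun m hm => hm, fun m hm => .inr hm, .inr fun m hm => .inl hm⟩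
    | succ t _ ih =>
      obtain ⟨l, l', hc, h1, h2, h3⟩ := ih
      obtain ⟨out, -, ⟨hc', hr, -⟩ | ⟨m, q, hc1, hc', hr, -⟩⟩ := E.chan_step t j i
      · exact ⟨l, l' ++ out, by simp [hc', hc], by simpa [hr] using h1, h2, by simpa [hr] using h3⟩
      · cases l with
        | nil =>
          refine ⟨[], q ++ out, by simp [hc'], fun x hx => ?_, by simp, .inl rfl⟩
          rw [hr]
          exact .inl (.inr (by simpa using h1 x hx))
        | cons m' l =>
          rw [hc1] at hc
          obtain ⟨rfl, rfl⟩ : m = m' ∧ q = l ++ l' := by simpa using hc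
          refine ⟨l, l' ++ out, by simp [hc'], fun x hx => ?_, fun x hx => h2 x (by simp [hx]), ?_⟩
          · rw [hr]
            rcases h1 x hx with h | h
            · exact .inl (.inr h)
            · rcases List.mem_cons.1 h with rfl | h
              · exact .inl (.inl rfl)
              · exact .inr h
          · right
            rw [hr]
            rcases h3 with h3 | h3
            · simp at h3
            · rintro x (rfl | hx)
              · exact h2 _ (by simp)
              · exact h3 hx

/-- If `j` sends `m'` to `i` only after time `t₀`, then `i` receives it after everything that `j`
has sent by time `t₀`. -/
theorem rcvd_of_sent_of_not_sent {t t₀ : ℕ} {j i : Fin n} {m m' : Msg n α}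
    (hm : m ∈ E.Sent t₀ j i) (hm' : m' ∉ E.Sent t₀ j i) (h : m' ∈ (E.loc t i).rcvd j) :
    m ∈ (E.loc t i).rcvd j := by
  rcases E.fifo t t₀ j i with h' | h'
  · exact absurd (h' h) hm'
  · exact h' hm

/-! ### The vectors `V` and the received values -/

/-- The vector `V` is a function of the received messages, so that FIFO statements about `rcvd`
become statements about `V`. -/
theorem mem_V {t : ℕ} {i y : Fin n} {u : TVal n α} : u ∈ (E.loc t i).V y ↔
    Msg.value u ∈ (E.loc t i).rcvd y ∨ (y = i ∧ ∃ z, Msg.value u ∈ (E.loc t i).rcvd z) := by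
  induction t generalizing y with
  | zero => simp [loc, E.start, Config.initial]
  | succ t ih =>
    rcases E.loc_step t i with ⟨h, -⟩ | ⟨-, _, h, -⟩ | ⟨-, j, m, _, -, -, -, h⟩
    · rw [h, ih]
    · rw [h.unchanged.1, h.unchanged.2.2.2.1, ih]
    · rw [h, handle_rcvd]
      have hex : ∀ m : Msg n α, (∃ z, Msg.value u ∈
          Function.update (E.loc t i).rcvd j (insert m ((E.loc t i).rcvd j)) z) ↔
          Msg.value u = m ∨ ∃ z, Msg.value u ∈ (E.loc t i).rcvd z := by
        intro m
        constructor
        · rintro ⟨z, hz⟩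
          by_cases hzj : z = j
          · subst hzj
            rw [Function.update_self] at hz
            exact hz.imp id fun h => ⟨z, h⟩
          · exact .inr ⟨z, by simpa [hzj] using hz⟩
        · rintro (h | ⟨z, hz⟩)
          · exact ⟨j, by simp [h]⟩
          · by_cases hzj : z = j
            · subst hzj
              exact ⟨z, by simp [hz]⟩
            · exact ⟨z, by simp [hzj, hz]⟩
      have hat : ∀ m : Msg n α, Msg.value u ∈
          Function.update (E.loc t i).rcvd j (insert m ((E.loc t i).rcvd j)) y ↔
          (y = j ∧ Msg.value u = m) ∨ Msg.value u ∈ (E.loc t i).rcvd y := by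
        intro m
        by_cases hyj : y = j
        · subst hyj; simp
        · simp [hyj]
      rw [hex, hat]
      cases m with
      | value w =>
        simp only [handle, addValue, Set.mem_ofPred_eq, ih, Msg.value.injEq]
        tauto
      | _ => simpa [handle, Local.record] using ih

theorem mem_V_of_rcvd {t : ℕ} {i y : Fin n} {u : TVal n α}
    (h : Msg.value u ∈ (E.loc t i).rcvd y) : u ∈ (E.loc t i).V y :=
  E.mem_V.2 (.inl h)

theorem mem_V_self_of_rcvd {t : ℕ} {i y : Fin n} {u : TVal n α}
    (h : Msg.value u ∈ (E.loc t i).rcvd y) : u ∈ (E.loc t i).V i :=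
  E.mem_V.2 (.inr ⟨rfl, y, h⟩)

theorem rcvd_of_mem_V {t : ℕ} {i y : Fin n} {u : TVal n α} (hy : y ≠ i)
    (h : u ∈ (E.loc t i).V y) : Msg.value u ∈ (E.loc t i).rcvd y :=
  (E.mem_V.1 h).resolve_right fun h => hy h.1

theorem exists_rcvd_of_mem_V {t : ℕ} {i y : Fin n} {u : TVal n α}
    (h : u ∈ (E.loc t i).V y) : ∃ z, Msg.value u ∈ (E.loc t i).rcvd z :=
  (E.mem_V.1 h).elim (fun h => ⟨_, h⟩) fun h => h.2

theorem V_subset_self (t : ℕ) (i y : Fin n) : (E.loc t i).V y ⊆ (E.loc t i).V i := by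
  intro u hu
  obtain ⟨z, hz⟩ := E.exists_rcvd_of_mem_V hu
  exact E.mem_V_self_of_rcvd hz

theorem finite_rcvd (t : ℕ) (j i : Fin n) : ((E.loc t i).rcvd j).Finite := by
  induction t with
  | zero => simp [loc, E.start, Config.initial]
  | succ t ih =>
    obtain ⟨_, -, ⟨_, h, _⟩ | ⟨m, _, _, _, h, _⟩⟩ := E.chan_step t j i
    · rwa [h]
    · rw [h]; exact ih.insert m

/-! ### Sending of values -/

/-- A value is forwarded to all in the very step in which it enters `V[j]`. Only a crash could cut
this broadcast short, hence the hypothesis `Alive`. -/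
theorem sent_of_mem_V {t : ℕ} {j : Fin n} (hj : E.Alive t j) {u : TVal n α}
    (hu : u ∈ (E.loc t j).V j) (i : Fin n) : Msg.value u ∈ E.Sent t j i := by
  induction t with
  | zero => simp [loc, E.start, Config.initial] at hu
  | succ t ih =>
    obtain ⟨cmds, cmds', he, hS, h⟩ := E.sends t j
    obtain rfl := he.eq (not_not.2 hj)
    rw [hS]
    by_cases hut : u ∈ (E.loc t j).V j
    · exact .inl (ih hj.of_succ hut)
    · right
      rcases h with ⟨-, h⟩ | ⟨-, h | ⟨k, m, -, h, -, rfl⟩⟩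
      · rw [h] at hu; exact absurd hu hut
      · rw [h.unchanged.1] at hu; exact absurd hu hut
      · rw [h] at hu
        cases m with
        | value w =>
          obtain rfl : u = w := by
            simpa [handle, addValue, hut] using hu
          simp [handle, hut, outbox, Cmd.toAll]
        | _ => exact absurd hu hut

/-- Values are only ever broadcast, and a broadcast that misses a recipient kills its sender. -/
theorem sent_value_all {t : ℕ} {j : Fin n} (hj : E.Alive t j) {u : TVal n α} {i : Fin n}
    (hu : Msg.value u ∈ E.Sent t j i) (k : Fin n) : Msg.value u ∈ E.Sent t j k := by
  induction t with
  | zero => simp [sent_zero] at hu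
  | succ t ih =>
    obtain ⟨cmds, cmds', he, hS, h⟩ := E.sends t j
    obtain rfl := he.eq (not_not.2 hj)
    rw [hS] at hu ⊢
    refine hu.imp (ih hj.of_succ) fun hu => ?_
    rw [mem_outbox] at hu ⊢
    obtain ⟨c, hc, hi, hcu⟩ := hu
    refine ⟨c, hc, ?_, hcu⟩
    rcases h with ⟨rfl, -⟩ | ⟨-, h | ⟨l, m, -, -, -, rfl⟩⟩
    · simp at hc
    · simp [(h.client_of_mem hc).dest_eq_univ hc]
    · cases m with
      | value w =>
        by_cases hw : w ∈ (E.loc t j).V j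
        · simp [handle, hw] at hc
        · obtain rfl : c = .toAll (.value w) := by simpa [handle, hw] using hc
          simp [Cmd.toAll]
      | _ => simp [handle] at hc <;> grind [Cmd.toAll, Cmd.to]

/-- A value is sent for the first time by an update or after its first reception. -/
theorem value_new {t : ℕ} {j i : Fin n} {u : TVal n α} (h : Msg.value u ∈ E.Sent (t + 1) j i)
    (h' : Msg.value u ∉ E.Sent t j i) : E.Alive t j ∧
      ((∃ v r, (E.loc t j).pc = .sendValue v r ∧ u = ⟨v, r + 1, j⟩ ∧
          (E.loc (t + 1) j).pc = .latStart (.update v) 0 r) ∨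
        (u ∉ (E.loc t j).V j ∧ u ∈ (E.loc (t + 1) j).V j ∧
          ∃ k, Msg.value u ∈ (E.state t).chan k j)) := by
  obtain ⟨cmds, cmds', he, hS, hd⟩ := E.sends t j
  rw [hS] at h
  have h := he.mem_outbox (h.resolve_left h')
  rw [mem_outbox] at h
  obtain ⟨c, hc, hi, hcu⟩ := h
  rcases hd with ⟨rfl, -⟩ | ⟨ha, hd | ⟨l, m, hm, hl, -, rfl⟩⟩
  · simp at hc
  · refine ⟨ha, .inl ?_⟩
    generalize E.loc (t + 1) j = s' at *
    cases hd.client_of_mem hc <;> simp [Cmd.toAll] at hc <;> subst hc <;> simp at hcu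
    next v r h => exact ⟨v, r, h, hcu.symm, rfl⟩
  · refine ⟨ha, .inr ?_⟩
    cases m with
    | value w =>
      by_cases hw : w ∈ (E.loc t j).V j
      · simp [handle, hw] at hc
      · obtain rfl : c = .toAll (.value w) := by simpa [handle, hw] using hc
        obtain rfl : w = u := by simpa [Cmd.toAll] using hcu
        exact ⟨hw, by simp [hl, handle, addValue], l, hm⟩
    | _ => simp [handle] at hc <;> grind [Cmd.toAll, Cmd.to]

/-- At most one value is sent in a step. -/
theorem value_new_unique {t : ℕ} {j i i' : Fin n} {u u' : TVal n α}
    (h : Msg.value u ∈ E.Sent (t + 1) j i) (h0 : Msg.value u ∉ E.Sent t j i)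
    (h' : Msg.value u' ∈ E.Sent (t + 1) j i') (h0' : Msg.value u' ∉ E.Sent t j i') : u = u' := by
  obtain ⟨cmds, cmds', he, hS, hd⟩ := E.sends t j
  rw [hS] at h h'
  have h := he.mem_outbox (h.resolve_left h0)
  have h' := he.mem_outbox (h'.resolve_left h0')
  rw [mem_outbox] at h h'
  obtain ⟨c, hc, hi, hcu⟩ := h
  obtain ⟨c', hc', hi', hcu'⟩ := h'
  rcases hd with ⟨rfl, -⟩ | ⟨ha, hd | ⟨l, m, hm, hl, -, rfl⟩⟩
  · simp at hc
  · generalize E.loc (t + 1) j = s' at *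
    cases hd.client_of_mem hc <;> simp_all [Cmd.toAll]
  · cases m with
    | value w =>
      by_cases hw : w ∈ (E.loc t j).V j
      · simp [handle, hw] at hc
      · simp_all [handle, Cmd.toAll]
    | _ => simp [handle] at hc <;> grind [Cmd.toAll, Cmd.to]

/-! ### Requests and acknowledgements -/

theorem readAck_new {t q g : ℕ} {y i : Fin n} (h : Msg.readAck q g ∈ E.Sent (t + 1) y i)
    (h' : Msg.readAck q g ∉ E.Sent t y i) :
    E.Alive t y ∧ Msg.readTag q ∈ E.Sent t i y ∧ g = (E.loc t y).maxTag := by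
  obtain ⟨cmds, cmds', he, hS, hd⟩ := E.sends t y
  rw [hS] at h
  have h := he.mem_outbox (h.resolve_left h')
  rw [mem_outbox] at h
  obtain ⟨c, hc, hi, hcu⟩ := h
  rcases hd with ⟨rfl, -⟩ | ⟨ha, hd | ⟨l, m, hm, hl, -, rfl⟩⟩
  · simp at hc
  · generalize E.loc (t + 1) y = s' at *
    cases hd.client_of_mem hc <;> simp_all [Cmd.toAll]
  · refine ⟨ha, ?_⟩
    cases m with
    | value w =>
      by_cases hw : w ∈ (E.loc t y).V y <;> simp [handle, hw] at hc
      subst hc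
      simp [Cmd.toAll] at hcu
    | readTag q' =>
      simp only [handle, List.mem_singleton] at hc
      subst hc
      simp only [Cmd.to, Msg.readAck.injEq, Finset.mem_singleton] at hcu hi
      obtain ⟨rfl, rfl⟩ := hcu
      subst hi
      exact ⟨.inr hm, rfl⟩
    | _ => simp [handle] at hc <;> grind [Cmd.toAll, Cmd.to]

/-- An acknowledgement comes from the handler of the request. The echo has then reached every
channel even if the handler is interrupted by a crash, because it precedes the acknowledgement. No
value is sent in this step, so a value sent by the end of it was sent before both. -/
theorem writeAck_new {t q g : ℕ} {y i : Fin n} (h : Msg.writeAck q g ∈ E.Sent (t + 1) y i)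
    (h' : Msg.writeAck q g ∉ E.Sent t y i) :
    E.Alive t y ∧ Msg.writeTag q g ∈ E.Sent t i y ∧ g ≤ (E.loc (t + 1) y).maxTag ∧
      (∀ k, Msg.echoTag g ∈ E.Sent (t + 1) y k) ∧
      (E.loc (t + 1) y).rcvd i = insert (.writeTag q g) ((E.loc t y).rcvd i) ∧
      ∀ u k, Msg.value u ∈ E.Sent (t + 1) y k → Msg.value u ∈ E.Sent t y k := by
  obtain ⟨cmds, cmds', he, hS, hd⟩ := E.sends t y
  rw [hS] at h
  have h1 := h.resolve_left h'
  have h := he.mem_outbox h1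
  rw [mem_outbox] at h
  obtain ⟨c, hc, hi, hcu⟩ := h
  rcases hd with ⟨rfl, -⟩ | ⟨ha, hd | ⟨l, m, hm, hl, hr, rfl⟩⟩
  · simp at hc
  · generalize E.loc (t + 1) y = s' at *
    cases hd.client_of_mem hc <;> simp_all [Cmd.toAll]
  · refine ⟨ha, ?_⟩
    cases m with
    | value w =>
      by_cases hw : w ∈ (E.loc t y).V y <;> simp [handle, hw] at hc
      subst hc
      simp [Cmd.toAll] at hcu
    | writeTag q' g' =>
      simp only [handle, List.mem_cons, List.not_mem_nil, or_false] at hc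
      rcases hc with rfl | rfl
      · simp [Cmd.toAll] at hcu
      simp only [Cmd.to, Msg.writeAck.injEq, Finset.mem_singleton] at hcu hi
      obtain ⟨rfl, rfl⟩ := hcu
      subst hi
      refine ⟨.inr hm, by simp [hl, handle], fun k => (hS _ _).2 (.inr ?_), hr,
        fun u k hu => ((hS _ _).1 hu).resolve_right fun hu => ?_⟩
      · rcases he with rfl | ⟨he, -⟩
        · simp [handle, mem_outbox, Cmd.toAll]
        · exact he.mem_of_second h1 (by simp [Cmd.toAll]) (by simp [Cmd.toAll])
      · have := he.mem_outbox hu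
        simp [handle, mem_outbox, Cmd.toAll, Cmd.to] at this
    | _ => simp [handle] at hc <;> grind [Cmd.toAll, Cmd.to]

theorem readTag_lt_reqs {t q : ℕ} {j i : Fin n} (h : Msg.readTag q ∈ E.Sent t j i) :
    q < (E.loc t j).reqs := by
  induction t with
  | zero => simp [sent_zero] at h
  | succ t ih =>
    by_cases h' : Msg.readTag q ∈ E.Sent t j i
    · exact (ih h').trans_le (E.reqs_mono (Nat.le_succ t) j)
    obtain ⟨cmds, cmds', he, hS, hd⟩ := E.sends t j
    rw [hS] at h
    have h := he.mem_outbox (h.resolve_left h')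
    rw [mem_outbox] at h
    obtain ⟨c, hc, hi, hcu⟩ := h
    rcases hd with ⟨rfl, -⟩ | ⟨ha, hd | ⟨l, m, hm, hl, -, rfl⟩⟩
    · simp at hc
    · generalize E.loc (t + 1) j = s' at *
      cases hd.client_of_mem hc <;> simp [Cmd.toAll] at hc <;> subst hc <;> simp at hcu
      simp [hcu]
    · cases m with
      | value w =>
        by_cases hw : w ∈ (E.loc t j).V j <;> simp [handle, hw] at hc
        subst hc
        simp [Cmd.toAll] at hcu
      | _ => simp [handle] at hc <;> grind [Cmd.toAll, Cmd.to]

theorem writeTag_lt_reqs {t q g : ℕ} {j i : Fin n} (h : Msg.writeTag q g ∈ E.Sent t j i) :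
    q < (E.loc t j).reqs := by
  induction t with
  | zero => simp [sent_zero] at h
  | succ t ih =>
    by_cases h' : Msg.writeTag q g ∈ E.Sent t j i
    · exact (ih h').trans_le (E.reqs_mono (Nat.le_succ t) j)
    obtain ⟨cmds, cmds', he, hS, hd⟩ := E.sends t j
    rw [hS] at h
    have h := he.mem_outbox (h.resolve_left h')
    rw [mem_outbox] at h
    obtain ⟨c, hc, hi, hcu⟩ := h
    rcases hd with ⟨rfl, -⟩ | ⟨ha, hd | ⟨l, m, hm, hl, -, rfl⟩⟩
    · simp at hc
    · generalize E.loc (t + 1) j = s' at *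
      cases hd.client_of_mem hc <;> simp [Cmd.toAll] at hc <;> subst hc <;> simp at hcu
      simp [hcu]
    · cases m with
      | value w =>
        by_cases hw : w ∈ (E.loc t j).V j <;> simp [handle, hw] at hc
        subst hc
        simp [Cmd.toAll] at hcu
      | _ => simp [handle] at hc <;> grind [Cmd.toAll, Cmd.to]

theorem goodLA_new {t g : ℕ} {j i : Fin n} (h : Msg.goodLA g ∈ E.Sent (t + 1) j i)
    (h' : Msg.goodLA g ∉ E.Sent t j i) :
    E.Alive t j ∧ ∃ o ph, (E.loc t j).pc = .latWait o ph g ∧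
      EQ f (fun k => leTag g ((E.loc t j).V k)) j ∧ (E.loc t j).maxTag ≤ g ∧
      (E.loc (t + 1) j).pc = .latDone o ph g (some (leTag g ((E.loc t j).V j))) := by
  obtain ⟨cmds, cmds', he, hS, hd⟩ := E.sends t j
  rw [hS] at h
  have h := he.mem_outbox (h.resolve_left h')
  rw [mem_outbox] at h
  obtain ⟨c, hc, hi, hcu⟩ := h
  rcases hd with ⟨rfl, -⟩ | ⟨ha, hd | ⟨l, m, hm, hl, -, rfl⟩⟩
  · simp at hc
  · refine ⟨ha, ?_⟩
    generalize E.loc (t + 1) j = s' at *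
    cases hd.client_of_mem hc <;> simp [Cmd.toAll] at hc <;> subst hc <;> simp at hcu
    next o ph r hpc hEQ htag =>
      subst hcu
      exact ⟨o, ph, hpc, hEQ, htag, rfl⟩
  · cases m with
    | value w =>
      by_cases hw : w ∈ (E.loc t j).V j <;> simp [handle, hw] at hc
      subst hc
      simp [Cmd.toAll] at hcu
    | _ => simp [handle] at hc <;> grind [Cmd.toAll, Cmd.to]

theorem le_maxTag_of_rcvd_echoTag {t g : ℕ} {j i : Fin n}
    (h : Msg.echoTag g ∈ (E.loc t i).rcvd j) : g ≤ (E.loc t i).maxTag := by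
  induction t with
  | zero => simp [loc, E.start, Config.initial] at h
  | succ t ih =>
    obtain ⟨_, -, ⟨_, h', _⟩ | ⟨m, _, _, _, h', -, hl⟩⟩ := E.chan_step t j i
    · rw [h'] at h
      exact (ih h).trans (E.maxTag_mono t.le_succ i)
    · rw [h'] at h
      rcases h with rfl | h
      · simp [hl, handle]
      · exact (ih h).trans (E.maxTag_mono t.le_succ i)

end Execution

/-! ### Quorum intersection and the data carried by control states -/

section

variable {n f : ℕ} {α : Type*} {v₀ : Fin n → α}

/-- Two disjoint quorums would need 2(n - f) > n nodes; this is where 2f < n enters. -/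
theorem Quorum.inter (hf : 2 * f < n) {P Q : Fin n → Prop} (hP : Quorum f P)
    (hQ : Quorum f Q) : ∃ y, P y ∧ Q y := by
  obtain ⟨A, hA, hAP⟩ := hP
  obtain ⟨B, hB, hBQ⟩ := hQ
  by_contra! h
  have hd : Disjoint A B := Finset.disjoint_left.2 fun y hy hy' => h y (hAP y hy) (hBQ y hy')
  have h1 := Finset.card_union_of_disjoint hd
  have h2 := Finset.card_le_univ (A ∪ B)
  rw [Fintype.card_fin] at h2
  omega

theorem Quorum.imp {P Q : Fin n → Prop} (hP : Quorum f P) (h : ∀ y, P y → Q y) :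
    Quorum f Q := by
  obtain ⟨A, hA, hAP⟩ := hP
  exact ⟨A, hA, fun y hy => h y (hAP y hy)⟩

theorem Quorum.exists (hf : 2 * f < n) {P : Fin n → Prop} (hP : Quorum f P) : ∃ y, P y :=
  (hP.inter hf hP).imp fun _ h => h.1

/-- The pending operation. -/
def PC.op : PC n α → Option (Op α)
  | .idle => none
  | .readStart o | .readWait o _ | .latStart o _ _ | .latWrite o _ _ _ | .latWait o _ _
  | .latDone o _ _ _ | .borrow o _ | .renewed o _ => some o
  | .sendValue v _ => some (.update v)

/-- The tag that the pending operation uses at present. -/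
def PC.tag : PC n α → Option ℕ
  | .sendValue _ r | .latStart _ _ r | .latWrite _ _ r _ | .latWait _ _ r
  | .latDone _ _ r _ | .borrow _ r => some r
  | _ => none

/-- An update has sent its value, and a scan has finished `readTag`. -/
def PC.Late : PC n α → Prop
  | .idle | .readStart _ | .readWait _ _ | .sendValue _ _ => False
  | _ => True

end

/-! ### What quorums have stored, and the pending operation of a node -/

namespace Execution

variable {n f : ℕ} {α : Type*} {v₀ : Fin n → α} (E : Execution n f v₀)

/-- A quorum has stored a tag that is at least `g`. -/
def TagStored (t g : ℕ) : Prop := Quorum f fun y => g ≤ (E.loc t y).maxTag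

/-- A quorum has sent the value `x`. -/
def ValueStored (t : ℕ) (x : TVal n α) : Prop :=
  Quorum f fun y => ∃ k, Msg.value x ∈ E.Sent t y k

/-- Node `i` knows of a quorum that has stored the value `x`. -/
def ValueKnown (t : ℕ) (i : Fin n) (x : TVal n α) : Prop := Quorum f fun y => x ∈ (E.loc t i).V y

variable {E}

theorem TagStored.mono {t t' g g' : ℕ} (h : E.TagStored t g) (ht : t ≤ t') (hg : g' ≤ g) :
    E.TagStored t' g' :=
  h.imp fun y hy => hg.trans (hy.trans (E.maxTag_mono ht y))

theorem ValueStored.mono {t t' : ℕ} {x : TVal n α} (h : E.ValueStored t x) (ht : t ≤ t') :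
    E.ValueStored t' x :=
  h.imp fun y ⟨k, hk⟩ => ⟨k, E.sent_mono ht y k hk⟩

theorem ValueKnown.mono {t t' : ℕ} {i : Fin n} {x : TVal n α} (h : E.ValueKnown t i x)
    (ht : t ≤ t') : E.ValueKnown t' i x :=
  h.imp fun y hy => E.V_mono ht y i hy

variable (E)

open Classical in
/-- The time of the last invocation by node `i` before time `t` (`0` if there is none). -/
noncomputable def cur (i : Fin n) : ℕ → ℕ
  | 0 => 0
  | t + 1 => if ∃ o, E.action t = .invoke i o then t else cur i t

theorem cur_succ_of_invoke {i : Fin n} {t : ℕ} {o : Op α} (h : E.action t = .invoke i o) :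
    E.cur i (t + 1) = t := if_pos ⟨o, h⟩

theorem cur_succ {i : Fin n} {t : ℕ} (h : ∀ o, E.action t ≠ .invoke i o) :
    E.cur i (t + 1) = E.cur i t := if_neg fun ⟨o, h'⟩ => h o h'

theorem cur_le (i : Fin n) (t : ℕ) : E.cur i t ≤ t := by
  induction t with
  | zero => exact le_rfl
  | succ t ih =>
    rw [cur]
    split_ifs <;> omega

/-- How the control state of a node changes in a step. -/
theorem pc_step (t : ℕ) (i : Fin n) :
    ((E.loc (t + 1) i).pc = (E.loc t i).pc ∧ (∀ o, E.action t ≠ .invoke i o) ∧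
      (∀ r, E.action t ≠ .respond i r)) ∨
    (E.Alive t i ∧ ∃ o, E.action t = .invoke i o ∧ (E.loc t i).pc = .idle ∧
      (E.loc (t + 1) i).pc = .readStart o) ∨
    (E.Alive t i ∧ ∃ r, E.action t = .respond i r ∧ CanRespond v₀ (E.loc t i) r ∧
      (E.loc (t + 1) i).pc = .idle) ∨
    (E.Alive t i ∧ (∀ o, E.action t ≠ .invoke i o) ∧ (∀ r, E.action t ≠ .respond i r) ∧
      ∃ cmds, ClientStep f i (E.loc t i) (E.loc (t + 1) i) cmds ∧
        (E.Alive (t + 1) i → ∀ c ∈ cmds, ∀ j, c.msg ∈ E.Sent (t + 1) i j)) := by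
  rcases E.loc_step t i with ⟨h, h1, h2, -⟩ | ⟨ha, cmds, h, hs⟩ | ⟨-, j, m, l, ha, -, -, h⟩
  · exact .inl ⟨by rw [h], h1, h2⟩
  · generalize E.loc (t + 1) i = s' at *
    generalize E.action t = a at *
    cases h with
    | invoke _ o h => exact .inr (.inl ⟨ha, o, rfl, h, rfl⟩)
    | respond _ r h => exact .inr (.inr (.inl ⟨ha, r, rfl, h, rfl⟩))
    | client _ _ _ _ h hact =>
      refine .inr (.inr (.inr ⟨ha, ?_, ?_, cmds, h, fun hi c hc j => hs hi c hc j ?_⟩))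
      · rcases hact with rfl | rfl <;> simp
      · rcases hact with rfl | rfl <;> simp
      · simp [h.dest_eq_univ hc]
  · refine .inl ⟨by rw [h, handle_pc], ?_⟩
    rcases ha with ha | ha <;> simp [ha]

theorem op_cur {t : ℕ} {i : Fin n} {o : Op α} (h : (E.loc t i).pc.op = some o) :
    E.cur i t < t ∧ E.action (E.cur i t) = .invoke i o ∧
      ∀ m, E.cur i t < m → m < t → ∀ r, E.action m ≠ .respond i r := by
  induction t generalizing o with
  | zero => simp [loc, E.start, Config.initial, PC.op] at h
  | succ t ih =>
    have key : (E.loc t i).pc.op = some o → (∀ o, E.action t ≠ .invoke i o) →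
        (∀ r, E.action t ≠ .respond i r) → E.cur i (t + 1) < t + 1 ∧
          E.action (E.cur i (t + 1)) = .invoke i o ∧
          ∀ m, E.cur i (t + 1) < m → m < t + 1 → ∀ r, E.action m ≠ .respond i r := by
      intro h h1 h2
      obtain ⟨h3, h4, h5⟩ := ih h
      rw [E.cur_succ h1]
      refine ⟨h3.trans t.lt_succ_self, h4, fun m hm hmt => ?_⟩
      rcases Nat.lt_succ_iff_lt_or_eq.1 hmt with h | rfl
      · exact h5 m hm h
      · exact h2
    rcases E.pc_step t i with ⟨hpc, h1, h2⟩ | ⟨-, o', ha, -, hpc⟩ | ⟨-, r, -, -, hpc⟩ |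
      ⟨-, h1, h2, cmds, hc, -⟩
    · exact key (hpc ▸ h) h1 h2
    · rw [E.cur_succ_of_invoke ha]
      rw [hpc] at h
      obtain rfl : o' = o := by simpa [PC.op] using h
      exact ⟨t.lt_succ_self, ha, fun m hm hmt => by omega⟩
    · simp [hpc, PC.op] at h
    · refine key ?_ h1 h2
      rw [← h]
      generalize E.loc (t + 1) i = s' at *
      cases hc <;> simp_all [PC.op]

/-! ### The `readTag` and `writeTag` procedures -/

/-- The request number is the counter `reqs` at the time of sending, which exceeds every number used
before. So acknowledgements of `q` cannot be older than the operation. -/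
theorem readTag_not_sent {t q : ℕ} {i : Fin n} {o : Op α} (h : (E.loc t i).pc = .readWait o q)
    (y : Fin n) : Msg.readTag q ∉ E.Sent (E.cur i t) i y := by
  induction t with
  | zero => simp [loc, E.start, Config.initial] at h
  | succ t ih =>
    rcases E.pc_step t i with ⟨hpc, h1, h2⟩ | ⟨-, o', ha, -, hpc⟩ | ⟨-, r, -, -, hpc⟩ |
      ⟨-, h1, h2, cmds, hc, -⟩
    · rw [E.cur_succ h1]
      exact ih (hpc ▸ h)
    · simp [hpc] at h
    · simp [hpc] at h
    · rw [E.cur_succ h1]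
      generalize E.loc (t + 1) i = s' at *
      cases hc <;> simp at h
      intro hs
      have h4 := E.readTag_lt_reqs hs
      have h5 := E.reqs_mono (E.cur_le i t) i
      omega

/-- `readTag` returns at least every tag, and makes known every value, that a quorum had stored
when the operation was invoked. -/
theorem read_correct (hf : 2 * f < n) {t q r : ℕ} {i : Fin n} {o : Op α}
    (h : (E.loc t i).pc = .readWait o q)
    (hq : Quorum f fun j => ∃ t', Msg.readAck q t' ∈ (E.loc t i).rcvd j)
    (hr : IsGreatest {t' | ∃ j, Msg.readAck q t' ∈ (E.loc t i).rcvd j} r) :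
    (∀ g, E.TagStored (E.cur i t) g → g ≤ r) ∧
      ∀ x, E.ValueStored (E.cur i t) x → x ∈ (E.loc t i).V i := by
  have key : ∀ y g, Msg.readAck q g ∈ (E.loc t i).rcvd y → ∃ s, E.cur i t ≤ s ∧
      g = (E.loc s y).maxTag ∧ E.Alive s y ∧ Msg.readAck q g ∉ E.Sent s y i := by
    intro y g hg
    obtain ⟨s, -, -, hs1, hs2⟩ := exists_first (P := fun s => Msg.readAck q g ∈ E.Sent s y i)
      (a := 0) (t := t) (by simp [sent_zero]) t.zero_le (E.rcvd_subset_sent _ _ _ hg)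
    obtain ⟨hy, hs3, hs4⟩ := E.readAck_new hs2 hs1
    refine ⟨s, ?_, hs4, hy, hs1⟩
    -- An acknowledgement older than the invocation would answer a request sent before it, but `q`
    -- was still unused then.
    by_contra! hlt
    exact E.readTag_not_sent h y (E.sent_mono hlt.le _ _ hs3)
  constructor
  · intro g hg
    obtain ⟨y, ⟨g', hg'⟩, hy⟩ := hq.inter hf hg
    obtain ⟨s, hs, rfl, -⟩ := key y g' hg'
    exact (hy.trans (E.maxTag_mono hs y)).trans (hr.2 ⟨y, hg'⟩)
  · intro x hx
    obtain ⟨y, ⟨g', hg'⟩, l, hy⟩ := hq.inter hf hx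
    obtain ⟨s, hs, -, ha, hn⟩ := key y g' hg'
    exact E.mem_V_self_of_rcvd
      (E.rcvd_of_sent_of_not_sent (E.sent_value_all ha (E.sent_mono hs y l hy) i) hn hg')

/-- The time `τ` is just before the request is sent: whatever the node has sent by `τ` precedes the
request in every channel. -/
theorem latWrite_start {t ph r q : ℕ} {i : Fin n} {o : Op α}
    (h : (E.loc t i).pc = .latWrite o ph r q) :
    ∃ τ < t, E.Alive τ i ∧ (E.loc τ i).pc = .latStart o ph r ∧ E.cur i τ = E.cur i t ∧
      ∀ y, Msg.writeTag q r ∉ E.Sent τ i y := by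
  induction t with
  | zero => simp [loc, E.start, Config.initial] at h
  | succ t ih =>
    rcases E.pc_step t i with ⟨hpc, h1, h2⟩ | ⟨-, o', ha, -, hpc⟩ | ⟨-, r, -, -, hpc⟩ |
      ⟨hal, h1, h2, cmds, hc, -⟩
    · rw [E.cur_succ h1]
      obtain ⟨τ, hτ, h⟩ := ih (hpc ▸ h)
      exact ⟨τ, hτ.trans t.lt_succ_self, h⟩
    · simp [hpc] at h
    · simp [hpc] at h
    · rw [E.cur_succ h1]
      generalize E.loc (t + 1) i = s' at *
      cases hc <;> simp at h
      next hpc =>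
      obtain ⟨rfl, rfl, rfl, rfl⟩ := h
      exact ⟨t, t.lt_succ_self, hal, hpc, rfl, fun y hs => (E.writeTag_lt_reqs hs).ne rfl⟩

/-- While a node waits for the equivalence quorum, its `writeTag` request has been acknowledged by
a quorum. -/
theorem latWait_start {t ph r : ℕ} {i : Fin n} {o : Op α}
    (h : (E.loc t i).pc = .latWait o ph r) :
    ∃ τ < t, E.Alive τ i ∧ (E.loc τ i).pc = .latStart o ph r ∧ E.cur i τ = E.cur i t ∧
      ∃ q, (∀ y, Msg.writeTag q r ∉ E.Sent τ i y) ∧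
        Quorum f fun y => Msg.writeAck q r ∈ (E.loc t i).rcvd y := by
  induction t with
  | zero => simp [loc, E.start, Config.initial] at h
  | succ t ih =>
    rcases E.pc_step t i with ⟨hpc, h1, h2⟩ | ⟨-, o', ha, -, hpc⟩ | ⟨-, r, -, -, hpc⟩ |
      ⟨hal, h1, h2, cmds, hc, -⟩
    · rw [E.cur_succ h1]
      obtain ⟨τ, hτ, h3, h4, h5, q, h6, h7⟩ := ih (hpc ▸ h)
      exact ⟨τ, hτ.trans t.lt_succ_self, h3, h4, h5, q, h6,
        h7.imp fun y hy => E.rcvd_mono t.le_succ _ _ hy⟩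
    · simp [hpc] at h
    · simp [hpc] at h
    · rw [E.cur_succ h1]
      have hrc : (E.loc t i).rcvd = (E.loc (t + 1) i).rcvd := by
        generalize E.loc (t + 1) i = s' at *
        cases hc <;> rfl
      rw [← hrc]
      generalize E.loc (t + 1) i = s' at *
      cases hc <;> simp at h
      next q hpc hq =>
      obtain ⟨rfl, rfl, rfl⟩ := h
      obtain ⟨τ, hτ, h3, h4, h5, h6⟩ := E.latWrite_start hpc
      exact ⟨τ, hτ.trans t.lt_succ_self, h3, h4, h5, q, h6, hq⟩

theorem writeAck_first {t q g : ℕ} {y i : Fin n} (h : Msg.writeAck q g ∈ (E.loc t i).rcvd y) :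
    ∃ s < t, Msg.writeAck q g ∉ E.Sent s y i ∧ Msg.writeAck q g ∈ E.Sent (s + 1) y i := by
  obtain ⟨s, -, hst, h⟩ := exists_first (P := fun s => Msg.writeAck q g ∈ E.Sent s y i)
      (a := 0) (t := t) (by simp [sent_zero]) t.zero_le (E.rcvd_subset_sent _ _ _ h)
  exact ⟨s, hst, h⟩

/-- The tag of a `Lattice` call is stored by a quorum. -/
theorem tagStored_of_latWait {t ph r : ℕ} {i : Fin n} {o : Op α}
    (h : (E.loc t i).pc = .latWait o ph r) : E.TagStored t r := by
  obtain ⟨τ, -, -, -, -, q, -, hq⟩ := E.latWait_start h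
  refine hq.imp fun y hy => ?_
  obtain ⟨s, hst, hs, hs'⟩ := E.writeAck_first hy
  exact (E.writeAck_new hs' hs).2.2.1.trans (E.maxTag_mono hst y)

/-- A value sent before a `Lattice` call is known when the `writeTag` request is acknowledged. -/
theorem value_of_writeAck {t τ q r : ℕ} {i y : Fin n} {x : TVal n α}
    (hx : Msg.value x ∈ E.Sent τ i y) (hτ : Msg.writeTag q r ∉ E.Sent τ i y)
    (h : Msg.writeAck q r ∈ (E.loc t i).rcvd y) :
    x ∈ (E.loc t i).V y ∧ Msg.value x ∈ E.Sent t y i := by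
  obtain ⟨s, hst, hs, hs'⟩ := E.writeAck_first h
  obtain ⟨ha, -, -, -, hr, -⟩ := E.writeAck_new hs' hs
  -- FIFO in both directions: `x` reaches `y` before the request does, so `y` has forwarded `x`
  -- before it acknowledges, and the forwarded copy reaches `i` before the acknowledgement.
  have h1 := E.rcvd_of_sent_of_not_sent hx hτ (t := s + 1) (by simp [hr])
  rw [hr] at h1
  have h2 : x ∈ (E.loc s y).V y := E.mem_V_self_of_rcvd (h1.resolve_left (by simp))
  exact ⟨E.mem_V_of_rcvd (E.rcvd_of_sent_of_not_sent (E.sent_of_mem_V ha h2 i) hs h),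
    E.sent_mono hst.le _ _ (E.sent_of_mem_V ha h2 i)⟩

theorem lt_maxTag_of_failed {t ph r : ℕ} {i : Fin n} {o : Op α}
    (h : (E.loc t i).pc = .latDone o ph r none) : r < (E.loc t i).maxTag := by
  induction t with
  | zero => simp [loc, E.start, Config.initial] at h
  | succ t ih =>
    rcases E.pc_step t i with ⟨hpc, h1, h2⟩ | ⟨-, o', ha, -, hpc⟩ | ⟨-, r, -, -, hpc⟩ |
      ⟨hal, h1, h2, cmds, hc, -⟩
    · exact (ih (hpc ▸ h)).trans_le (E.maxTag_mono t.le_succ i)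
    · simp [hpc] at h
    · simp [hpc] at h
    · generalize E.loc (t + 1) i = s' at *
      cases hc <;> simp at h
      next htag =>
      obtain ⟨rfl, rfl, rfl⟩ := h
      exact htag

/-- After `readTag`, the tag in use is at least every tag, and every value is known, that a quorum
had stored when the operation was invoked. -/
theorem tag_correct (hf : 2 * f < n) {t r : ℕ} {i : Fin n} (h : (E.loc t i).pc.tag = some r) :
    (∀ g, E.TagStored (E.cur i t) g → g ≤ r) ∧
      ∀ x, E.ValueStored (E.cur i t) x → x ∈ (E.loc t i).V i := by
  induction t generalizing r with
  | zero => simp [loc, E.start, Config.initial, PC.tag] at h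
  | succ t ih =>
    rcases E.pc_step t i with ⟨hpc, h1, h2⟩ | ⟨-, o', ha, -, hpc⟩ | ⟨-, r, -, -, hpc⟩ |
      ⟨hal, h1, h2, cmds, hc, -⟩
    · rw [E.cur_succ h1]
      obtain ⟨h3, h4⟩ := ih (hpc ▸ h)
      exact ⟨h3, fun x hx => E.V_mono t.le_succ i i (h4 x hx)⟩
    · simp [hpc, PC.tag] at h
    · simp [hpc, PC.tag] at h
    · rw [E.cur_succ h1]
      suffices h : (∀ g, E.TagStored (E.cur i t) g → g ≤ r) ∧
          ∀ x, E.ValueStored (E.cur i t) x → x ∈ (E.loc t i).V i from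
        ⟨h.1, fun x hx => E.V_mono t.le_succ i i (h.2 x hx)⟩
      have hstep : ∀ r', (E.loc t i).pc.tag = some r' → r' ≤ r →
          (∀ g, E.TagStored (E.cur i t) g → g ≤ r) ∧
          ∀ x, E.ValueStored (E.cur i t) x → x ∈ (E.loc t i).V i := fun r' h hr =>
        ⟨fun g hg => ((ih h).1 g hg).trans hr, (ih h).2⟩
      -- Within an operation the tag never decreases: `afterPhase0` takes a maximum, and `nextPhase`
      -- follows a failure, which means that `maxTag` is larger than the tag in use.
      have hfail := @lt_maxTag_of_failed _ _ _ _ E t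
      generalize E.loc (t + 1) i = s' at *
      cases hc <;> simp [PC.tag] at h
      case readUpdate v q r' hpc hq hr => subst h; exact E.read_correct hf hpc hq hr
      case readScan q r' hpc hq hr => subst h; exact E.read_correct hf hpc hq hr
      case nextPhase o ph r' hph hph3 hpc => 
        exact hstep r' (by simp [PC.tag, hpc]) (by rw [← h]; exact (hfail hpc).le)
      case afterPhase0 o r' res hpc => 
        exact hstep r' (by simp [PC.tag, hpc]) (by omega)
      all_goals exact hstep _ (by grind [PC.tag]) h.le

/-! ### The values written by the operations -/

/-- By time `T`, the operation invoked by node `i` at time `k` has chosen to write the value `x`. -/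
def Chose (T : ℕ) (i : Fin n) (k : ℕ) (x : TVal n α) : Prop :=
  ∃ τ ≤ T, ∃ v r, E.Alive τ i ∧ (E.loc τ i).pc = .sendValue v r ∧ x = ⟨v, r + 1, i⟩ ∧
    E.cur i τ = k

/-- What is known at time `t` about the value `x` written by the pending operation of node `i`
or, if there is none, by its last operation. -/
def OwnStage (t : ℕ) (i : Fin n) (x : TVal n α) : PC n α → Prop
  | .readStart _ | .readWait _ _ => False
  | .sendValue v r => x = ⟨v, r + 1, i⟩
  | .latStart _ ph r => (ph = 0 → (∀ y, Msg.value x ∈ E.Sent t i y) ∧ x.tag = r + 1) ∧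
      (1 ≤ ph → x.tag ≤ r ∧ E.ValueStored t x) ∧ (2 ≤ ph → E.TagStored t x.tag)
  | .latWrite _ ph r q => (ph = 0 → (∀ y, ∃ τ, Msg.value x ∈ E.Sent τ i y ∧
        Msg.writeTag q r ∉ E.Sent τ i y) ∧ x.tag = r + 1) ∧
      (1 ≤ ph → x.tag ≤ r ∧ E.ValueStored t x) ∧ (2 ≤ ph → E.TagStored t x.tag)
  | .latWait _ ph r | .latDone _ ph r _ => E.ValueStored t x ∧ (ph = 0 → x.tag = r + 1) ∧
      (1 ≤ ph → x.tag ≤ r ∧ E.TagStored t x.tag)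
  | .borrow _ _ | .renewed _ _ | .idle => E.ValueStored t x ∧ E.TagStored t x.tag

variable {E}

theorem OwnStage.mono {t t' : ℕ} {i : Fin n} {x : TVal n α} {p : PC n α}
    (h : E.OwnStage t i x p) (ht : t ≤ t') : E.OwnStage t' i x p := by
  have h1 : E.ValueStored t x → E.ValueStored t' x := fun h => h.mono ht
  have h2 : E.TagStored t x.tag → E.TagStored t' x.tag := fun h => h.mono ht le_rfl
  have h3 : ∀ y, Msg.value x ∈ E.Sent t i y → Msg.value x ∈ E.Sent t' i y :=
    fun y h => E.sent_mono ht i y h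
  cases p <;> simp only [OwnStage] at h ⊢ <;> grind

theorem Chose.of_succ {T k : ℕ} {i : Fin n} {x : TVal n α} (h : E.Chose (T + 1) i k x) :
    E.Chose T i k x ∨ ∃ v r, (E.loc (T + 1) i).pc = .sendValue v r ∧ x = ⟨v, r + 1, i⟩ := by
  obtain ⟨τ, hτ, v, r, ha, hpc, hx, hk⟩ := h
  rcases Nat.le_succ_iff.1 hτ with h | rfl
  · exact .inl ⟨τ, h, v, r, ha, hpc, hx, hk⟩
  · exact .inr ⟨v, r, hpc, hx⟩

theorem Chose.mono {T T' k : ℕ} {i : Fin n} {x : TVal n α} (h : E.Chose T i k x) (hT : T ≤ T') :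
    E.Chose T' i k x := by
  obtain ⟨τ, hτ, h⟩ := h
  exact ⟨τ, hτ.trans hT, h⟩

theorem Chose.lt {T k : ℕ} {i : Fin n} {x : TVal n α} (h : E.Chose T i k x) : k < T := by
  obtain ⟨τ, hτ, v, r, ha, hpc, hx, rfl⟩ := h
  exact (E.op_cur (o := .update v) (by rw [hpc]; rfl)).1.trans_le hτ

theorem Chose.writer {T k : ℕ} {i : Fin n} {x : TVal n α} (h : E.Chose T i k x) :
    x.writer = i := by
  obtain ⟨τ, hτ, v, r, ha, hpc, rfl, rfl⟩ := h
  rfl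

theorem Chose.isOp {T k : ℕ} {i : Fin n} {x : TVal n α} (h : E.Chose T i k x) :
    E.action k = .invoke i (.update x.val) := by
  obtain ⟨τ, hτ, v, r, ha, hpc, rfl, rfl⟩ := h
  exact (E.op_cur (o := .update v) (by rw [hpc]; rfl)).2.1

variable (E)

theorem exists_chose {t : ℕ} {i : Fin n} {v : α} (h : (E.loc t i).pc.Late)
    (ho : (E.loc t i).pc.op = some (.update v)) :
    ∃ x, E.Chose t i (E.cur i t) x ∧ x.val = v := by
  induction t with
  | zero => simp [loc, E.start, Config.initial, PC.Late] at h
  | succ t ih =>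
    suffices h : ∃ x, E.Chose t i (E.cur i (t + 1)) x ∧ x.val = v by
      obtain ⟨x, hx, hv⟩ := h
      exact ⟨x, hx.mono t.le_succ, hv⟩
    rcases E.pc_step t i with ⟨hpc, h1, h2⟩ | ⟨-, o', ha, -, hpc⟩ | ⟨-, r, -, -, hpc⟩ |
      ⟨hal, h1, h2, cmds, hc, -⟩
    · rw [hpc] at h ho
      rw [E.cur_succ h1]
      exact ih h ho
    · simp [hpc, PC.Late] at h
    · simp [hpc, PC.Late] at h
    · rw [E.cur_succ h1]
      generalize E.loc (t + 1) i = s' at *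
      cases hc <;> simp [PC.op] at ho <;> simp only [PC.Late] at h
      case sendValue w r hpc =>
        subst ho
        exact ⟨_, ⟨t, le_rfl, _, _, hal, hpc, rfl, rfl⟩, rfl⟩
      all_goals first
        | cases ho; done
        | (subst ho; exact ih (by simp [PC.Late, *]) (by simp [PC.op, *]))

/-- The two halves of an update do two jobs. Phase 0 stores the value: it is sent before the
`writeTag` request, so every acknowledging node has forwarded it. `LatticeRenewal` starts with a tag
at least r + 1, and its first `writeTag` stores the tag of the value. -/
theorem ownStage {t : ℕ} {i : Fin n} {x : TVal n α} (hi : E.Alive t i)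
    (hx : E.Chose t i (E.cur i t) x) : E.OwnStage t i x (E.loc t i).pc := by
  induction t with
  | zero => exact absurd hx.lt (Nat.not_lt_zero _)
  | succ t ih =>
    rcases hx.of_succ with hx' | ⟨v, r, hpc, rfl⟩
    swap
    · rw [hpc]; rfl
    have ih := ih hi.of_succ
    rcases E.pc_step t i with ⟨hpc, h1, h2⟩ | ⟨-, o', ha, -, hpc⟩ | ⟨-, r, hr, hcr, hpc⟩ |
      ⟨hal, h1, h2, cmds, hc, hs⟩
    · rw [E.cur_succ h1] at hx'
      rw [hpc]
      exact (ih hx').mono t.le_succ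
    · rw [E.cur_succ_of_invoke ha] at hx'
      exact absurd hx'.lt (lt_irrefl _)
    · rw [E.cur_succ (by simp [hr])] at hx'
      rw [hpc]
      have h3 := (ih hx').mono t.le_succ
      obtain ⟨o, w, h⟩ := hcr.pc_eq
      rwa [h] at h3
    · rw [E.cur_succ h1] at hx'
      have h3 := ih hx'
      have hs := hs hi
      have hmono := fun p (h : E.OwnStage t i x p) => h.mono t.le_succ
      have htag := fun o ph r => @tagStored_of_latWait _ _ _ _ E (t + 1) ph r i o
      generalize E.loc (t + 1) i = s' at *
      cases hc
      case sendReadTag o hpc hs => rw [hpc] at h3; exact h3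
      case readUpdate v q r hpc _ _ hs => rw [hpc] at h3; exact absurd h3 id
      case readScan q r hpc _ _ hs => rw [hpc] at h3; exact absurd h3 id
      case sendValue v r hpc hs =>
        rw [hpc] at h3
        simp only [OwnStage] at h3
        subst h3
        exact ⟨fun _ => ⟨fun y => hs _ (List.mem_singleton_self _) y, rfl⟩, by simp⟩
      case sendWriteTag o ph r hpc hs =>
        rw [hpc] at h3
        refine ⟨fun hph => ⟨fun y => ⟨t, (h3.1 hph).1 y,
          fun hs => (E.writeTag_lt_reqs hs).ne rfl⟩, (h3.1 hph).2⟩, ((hmono _ h3).2)⟩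
      case writeDone o ph r q hpc hq hs =>
        rw [hpc] at h3
        have h4 := (hmono _ h3).2
        refine ⟨?_, fun hph => (h3.1 hph).2, fun hph => ⟨(h4.1 hph).1, ?_⟩⟩
        · rcases Nat.eq_zero_or_pos ph with rfl | hph
          · refine Quorum.imp hq fun y hy => ?_
            obtain ⟨τ, h5, h6⟩ := (h3.1 rfl).1 y
            exact ⟨i, E.sent_mono t.le_succ _ _ (E.value_of_writeAck h5 h6 hy).2⟩
          · exact (h4.1 hph).2
        -- From phase 1 on the tag in use is at least that of `x`, and a finished `writeTag` has
        -- stored it.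
        · exact (htag _ _ _ rfl).mono le_rfl (h4.1 hph).1
      case good o ph r hpc _ _ hs => rw [hpc] at h3; exact hmono _ h3
      case bad o ph r hpc _ _ hs => rw [hpc] at h3; exact hmono _ h3
      case afterPhase0 o r res hpc hs =>
        rw [hpc] at h3
        have h4 := hmono _ h3
        exact ⟨by simp, fun _ => ⟨by have := h4.2.1 rfl; omega, h4.1⟩, by simp⟩
      case direct o ph r view hph hpc hs =>
        rw [hpc] at h3
        have h4 := hmono _ h3
        exact ⟨h4.1, (h4.2.2 hph).2⟩
      case nextPhase o ph r hph hph3 hpc hs =>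
        have hlt := E.lt_maxTag_of_failed hpc
        rw [hpc] at h3
        have h4 := hmono _ h3
        exact ⟨by simp, fun _ => ⟨(h4.2.2 hph).1.trans hlt.le, h4.1⟩, fun _ => (h4.2.2 hph).2⟩
      case exitLoop o r hpc hs =>
        rw [hpc] at h3
        have h4 := hmono _ h3
        exact ⟨h4.1, (h4.2.2 (by norm_num)).2⟩
      case indirect o r j hpc hj hs =>
        rw [hpc] at h3
        exact hmono _ h3

/-- When an operation is invoked, the values written by the earlier operations of the same node
and their tags are stored. -/
theorem stored_of_chose {t k : ℕ} {i : Fin n} {x : TVal n α} (hi : E.Alive t i)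
    (hx : E.Chose t i k x) (hk : k ≠ E.cur i t ∨ (E.loc t i).pc = .idle) :
    E.ValueStored t x ∧ E.TagStored t x.tag := by
  induction t with
  | zero => exact absurd hx.lt (Nat.not_lt_zero _)
  | succ t ih =>
    suffices h : (E.ValueStored t x ∧ E.TagStored t x.tag) ∨
        k = E.cur i (t + 1) ∧ (E.loc (t + 1) i).pc = .idle by
      rcases h with h | ⟨rfl, h⟩
      · exact ⟨h.1.mono t.le_succ, h.2.mono t.le_succ le_rfl⟩
      · have := E.ownStage hi hx
        rwa [h] at this
    by_cases hk' : k = E.cur i (t + 1)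
    · exact .inr ⟨hk', hk.resolve_left (not_not.2 hk')⟩
    · left
      rcases hx.of_succ with hx' | ⟨v, r, hpc, rfl⟩
      · refine ih hi.of_succ hx' ?_
        by_cases hinv : ∃ o, E.action t = .invoke i o
        · obtain ⟨o, ho⟩ := hinv
          right
          rcases E.pc_step t i with ⟨hpc, h1, h2⟩ | ⟨-, o', ha, h, hpc⟩ | ⟨-, r, hr, hcr, hpc⟩ |
            ⟨hal, h1, h2, cmds, hc, hs⟩
          · exact absurd ho (h1 o)
          · exact h
          · rw [ho] at hr; cases hr
          · exact absurd ho (h1 o)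
        · rw [E.cur_succ (by simpa using hinv)] at hk'
          exact .inl hk'
      · obtain ⟨τ, hτ, v', r', ha, hpc', hx, hc⟩ := hx
        rcases Nat.le_succ_iff.1 hτ with h | rfl
        · refine ih hi.of_succ ⟨τ, h, v', r', ha, hpc', hx, hc⟩ (.inl ?_)
          rwa [E.cur_succ] at hk'
          intro o ho
          rcases E.pc_step t i with ⟨_, h1, h2⟩ | ⟨-, o', ha, h, h1⟩ | ⟨-, r, hr, hcr, h1⟩ |
            ⟨hal, h1, h2, cmds, hc, hs⟩
          · exact absurd ho (h1 o)
          · rw [hpc] at h1; cases h1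
          · rw [ho] at hr; cases hr
          · exact absurd ho (h1 o)
        · exact absurd hc.symm hk'

theorem invoke_spec {t : ℕ} {i : Fin n} {o : Op α} (h : E.action t = .invoke i o) :
    E.Alive t i ∧ (E.loc t i).pc = .idle ∧ (E.loc (t + 1) i).pc = .readStart o := by
  rcases E.pc_step t i with ⟨_, h1, h2⟩ | ⟨hi, o', ha, h3, h1⟩ | ⟨-, r, hr, hcr, h1⟩ |
    ⟨hal, h1, h2, cmds, hc, hs⟩
  · exact absurd h (h1 o)
  · obtain rfl : o' = o := by rw [h] at ha; cases ha; rfl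
    exact ⟨hi, h3, h1⟩
  · rw [h] at hr; cases hr
  · exact absurd h (h1 o)

theorem cur_mono (i : Fin n) {t t' : ℕ} (h : t ≤ t') : E.cur i t ≤ E.cur i t' := by
  induction t', h using Nat.le_induction with
  | base => exact le_rfl
  | succ t' _ ih =>
    refine ih.trans ?_
    rw [cur]
    split_ifs
    · exact E.cur_le i t'
    · exact le_rfl

variable {E} in
/-- An operation chooses the value that it writes before the next operation of the node starts. -/
theorem Chose.before {T k k' : ℕ} {i : Fin n} {x : TVal n α} {o : Op α} (hx : E.Chose T i k x)
    (hk : k < k') (h : E.action k' = .invoke i o) : E.Chose k' i k x := by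
  obtain ⟨τ, -, v, r, ha, hpc, hxv, hc⟩ := hx
  refine ⟨τ, ?_, v, r, ha, hpc, hxv, hc⟩
  by_contra! hlt
  have := E.cur_mono i (Nat.succ_le_of_lt hlt)
  rw [Nat.succ_eq_add_one, E.cur_succ_of_invoke h, hc] at this
  omega

variable {E} in
/-- An operation writes a value with a tag larger than every tag stored when it was invoked. -/
theorem TagStored.lt_tag (hf : 2 * f < n) {T k g : ℕ} {i : Fin n} {x : TVal n α}
    (h : E.TagStored k g) (hx : E.Chose T i k x) : g < x.tag := by
  obtain ⟨τ, -, v, r, ha, hpc, rfl, rfl⟩ := hx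
  exact Nat.lt_succ_of_le ((E.tag_correct hf (r := r) (by rw [hpc]; rfl)).1 _ h)

/-- Later operations of a node write values with larger tags. -/
theorem tag_lt_tag (hf : 2 * f < n) {T T' k k' : ℕ} {i : Fin n} {x x' : TVal n α}
    (hx : E.Chose T i k x) (hx' : E.Chose T' i k' x') (hk : k < k') : x.tag < x'.tag :=
  have hk' := E.invoke_spec hx'.isOp
  (E.stored_of_chose hk'.1 (hx.before hk hx'.isOp) (.inr hk'.2.1)).2.lt_tag hf hx'

/-- An operation writes only one value. -/
theorem chose_unique {T T' k : ℕ} {i : Fin n} {x x' : TVal n α}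
    (hx : E.Chose T i k x) (hx' : E.Chose T' i k x') : x = x' := by
  obtain ⟨τ, -, hx⟩ := hx
  obtain ⟨τ', -, hx'⟩ := hx'
  have key : ∀ {τ τ' : ℕ} {x x' : TVal n α}, τ ≤ τ' →
      (∃ v r, E.Alive τ i ∧ (E.loc τ i).pc = .sendValue v r ∧ x = ⟨v, r + 1, i⟩ ∧
        E.cur i τ = k) →
      (∃ v r, E.Alive τ' i ∧ (E.loc τ' i).pc = .sendValue v r ∧ x' = ⟨v, r + 1, i⟩ ∧
        E.cur i τ' = k) → x = x' := by
    rintro τ τ' x x' hle hx ⟨v', r', ha', hpc', rfl, rfl⟩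
    -- In state `sendValue` the stage invariant says that a value already chosen by this operation
    -- is the one about to be sent.
    have h := E.ownStage ha' ⟨τ, hle, hx⟩
    rwa [hpc'] at h
  rcases le_total τ τ' with h | h
  · exact key h hx hx'
  · exact (key h hx' hx).symm

/-- A value is determined by its writer and its tag. -/
theorem chose_injective (hf : 2 * f < n) {T T' k k' : ℕ} {i : Fin n} {x x' : TVal n α}
    (hx : E.Chose T i k x) (hx' : E.Chose T' i k' x') (h : x.tag = x'.tag) :
    k = k' ∧ x = x' := by
  rcases lt_trichotomy k k' with hk | rfl | hk
  · exact absurd h (E.tag_lt_tag hf hx hx' hk).ne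
  · exact ⟨rfl, E.chose_unique hx hx'⟩
  · exact absurd h (E.tag_lt_tag hf hx' hx hk).ne'

/-- Every value that is sent has been chosen before by an operation of its writer. -/
theorem chose_of_sent {t : ℕ} {j i : Fin n} {u : TVal n α} (h : Msg.value u ∈ E.Sent t j i) :
    ∃ k, E.Chose t u.writer k u := by
  induction t generalizing j i with
  | zero => simp [sent_zero] at h
  | succ t ih =>
    have step : (∃ j i, Msg.value u ∈ E.Sent t j i) → ∃ k, E.Chose (t + 1) u.writer k u :=
      fun ⟨j, i, h⟩ => (ih h).imp fun k hk => hk.mono t.le_succ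
    by_cases h' : Msg.value u ∈ E.Sent t j i
    · exact step ⟨_, _, h'⟩
    · obtain ⟨ha, ⟨v, r, hpc, rfl, -⟩ | ⟨-, -, k, hk⟩⟩ := E.value_new h h'
      · exact ⟨_, t, t.le_succ, v, r, ha, hpc, rfl, rfl⟩
      · exact step ⟨_, _, .inr hk⟩

theorem chose_of_mem_V {t : ℕ} {j i : Fin n} {u : TVal n α} (h : u ∈ (E.loc t i).V j) :
    ∃ k, E.Chose t u.writer k u := by
  obtain ⟨z, hz⟩ := E.exists_rcvd_of_mem_V h
  exact E.chose_of_sent (E.rcvd_subset_sent _ _ _ hz)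

/-! ### Good lattice operations -/

/-- A value that a node has sent and not yet received is the value of its pending update, and the
first `writeTag` procedure of this update is not finished. -/
theorem unreceived (hf : 2 * f < n) {t : ℕ} {i y : Fin n} {u : TVal n α} (hi : E.Alive t i)
    (hs : Msg.value u ∈ E.Sent t i y) (hu : u ∉ (E.loc t i).V i) :
    ∃ v r, (E.loc t i).pc = .latStart (.update v) 0 r ∨
      ∃ q, (E.loc t i).pc = .latWrite (.update v) 0 r q ∧
        ∀ y, ∃ τ, Msg.value u ∈ E.Sent τ i y ∧ Msg.writeTag q r ∉ E.Sent τ i y := by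
  induction t with
  | zero => simp [sent_zero] at hs
  | succ t ih =>
    have hut : u ∉ (E.loc t i).V i := fun h => hu (E.V_mono t.le_succ i i h)
    by_cases hs' : Msg.value u ∈ E.Sent t i y
    · obtain ⟨v, r, h⟩ := ih hi.of_succ hs' hut
      rcases E.pc_step t i with ⟨hpc, -⟩ | ⟨-, o, -, hpc, -⟩ | ⟨-, r', -, hcr, -⟩ |
        ⟨hal, h1, h2, cmds, hc, -⟩
      · rw [hpc]; exact ⟨v, r, h⟩
      · simp [hpc] at h
      · obtain ⟨_, _, hpc⟩ := hcr.pc_eq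
        simp [hpc] at h
      · generalize E.loc (t + 1) i = s' at *
        cases hc <;> simp_all
        case sendWriteTag o ph r' hpc =>
          refine fun y => ⟨t, ?_, ?_⟩
          · exact E.sent_value_all hal hs' y
          · exact fun hs => (E.writeTag_lt_reqs hs).ne rfl
        case writeDone o ph r' q hpc hq =>
          -- One acknowledging node suffices: its forwarded copy of `u` has come back to `i` before
          -- its acknowledgement.
          obtain ⟨y, hy⟩ := hq.exists hf
          obtain ⟨⟨rfl, rfl⟩, h⟩ := h
          obtain ⟨τ, h3, h4⟩ := h y
          exact absurd (E.V_subset_self t i y (E.value_of_writeAck h3 h4 hy).1) hu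
    · obtain ⟨-, ⟨v, r, -, -, hpc⟩ | ⟨-, h, -⟩⟩ := E.value_new hs hs'
      · exact ⟨v, r, .inl hpc⟩
      · exact absurd h hu

/-- A node's own new value is the only one it sends before receiving it, and that gap is closed by
the end of the first `writeTag`. Together with `sent_of_mem_V`, the values sent by a waiting node
are exactly those in `V[i]`. -/
theorem mem_V_of_latWait (hf : 2 * f < n) {t ph r : ℕ} {i y : Fin n} {o : Op α}
    {u : TVal n α} (hi : E.Alive t i) (h : (E.loc t i).pc = .latWait o ph r)
    (hs : Msg.value u ∈ E.Sent t i y) : u ∈ (E.loc t i).V i := by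
  by_contra hu
  obtain ⟨v, r, h' | ⟨q, h', -⟩⟩ := E.unreceived hf hi hs hu <;> simp [h'] at h

/-- At time `t`, node `i` can finish a `Lattice(r)` call successfully. -/
def GoodAt (t : ℕ) (i : Fin n) (r : ℕ) : Prop :=
  E.Alive t i ∧ (∃ o ph, (E.loc t i).pc = .latWait o ph r) ∧
    EQ f (fun k => leTag r ((E.loc t i).V k)) i ∧ (E.loc t i).maxTag ≤ r

/-- The result of a successful `Lattice(r)` call. -/
def view (t : ℕ) (i : Fin n) (r : ℕ) : Set (TVal n α) := leTag r ((E.loc t i).V i)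

variable {E}

theorem GoodAt.valueKnown {t r : ℕ} {i : Fin n} (h : E.GoodAt t i r) {x : TVal n α}
    (hx : x ∈ E.view t i r) : E.ValueKnown t i x := by
  obtain ⟨-, -, ⟨Q, hQ, hQ'⟩, -⟩ := h
  refine ⟨Q, hQ, fun y hy => ?_⟩
  have : x ∈ leTag r ((E.loc t i).V y) := (hQ' y hy).symm.subset hx
  exact this.1

theorem GoodAt.tagStored {t r : ℕ} {i : Fin n} (h : E.GoodAt t i r) : E.TagStored t r := by
  obtain ⟨-, ⟨o, ph, h⟩, -⟩ := h
  exact E.tagStored_of_latWait h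

/-- A `Lattice(g)` call at any node sees the values that are known to be stored at a time when
some node does not know a tag as large as `g`. -/
theorem ValueKnown.mem_of_latWait (hf : 2 * f < n) {t t' ph g : ℕ} {i j : Fin n} {o : Op α}
    {x : TVal n α} (hx : E.ValueKnown t i x) (hm : (E.loc t i).maxTag < g)
    (h : (E.loc t' j).pc = .latWait o ph g) : x ∈ (E.loc t' j).V j := by
  obtain ⟨-, -, -, -, -, q, -, hq⟩ := E.latWait_start h
  obtain ⟨y, hy, hq⟩ := Quorum.inter hf hx hq
  obtain ⟨s, hst, hs, hs'⟩ := E.writeAck_first hq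
  obtain ⟨ha, -, hmy, hecho, -, hval⟩ := E.writeAck_new hs' hs
  refine E.mem_V_self_of_rcvd (E.rcvd_of_sent_of_not_sent (m := .value x) ?_ hs hq)
  -- If `y` is `i` itself, it acknowledges `g` only after time `t`, since afterwards its `maxTag` is
  -- at least `g`. By then it has forwarded `x`.
  by_cases hyi : y = i
  · subst hyi
    refine E.sent_of_mem_V ha (E.V_mono ?_ _ _ hy) _
    by_contra! hlt
    have := E.maxTag_mono (Nat.succ_le_of_lt hlt) y
    simp only [Nat.succ_eq_add_one] at this
    omega
  · have hr := E.rcvd_of_mem_V hyi hy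
    -- Either what `i` has received from `y` by time `t` was all sent by the end of the
    -- acknowledging step, so that `x` was sent before it; or `i` has already received the echo of
    -- `g`, contradicting its small `maxTag`.
    rcases E.fifo t (s + 1) y i with h' | h'
    · exact E.sent_value_all ha (hval _ _ (h' hr)) j
    · have := E.le_maxTag_of_rcvd_echoTag (h' (hecho i))
      omega

/-- Success means `maxTag ≤ r < r'`, and the equivalence quorum makes each value of the view known
to be stored; so the call with tag `r'` cannot miss it. -/
theorem GoodAt.view_subset_of_lt (hf : 2 * f < n) {t t' r r' : ℕ} {i i' : Fin n}
    (h : E.GoodAt t i r) (h' : E.GoodAt t' i' r') (hr : r < r') :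
    E.view t i r ⊆ E.view t' i' r' := by
  intro x hx
  obtain ⟨-, ⟨o, ph, hpc⟩, -⟩ := h'
  exact ⟨(h.valueKnown hx).mem_of_latWait hf (h.2.2.2.trans_lt hr) hpc, hx.2.trans hr.le⟩

variable (E)

/-- Values are received from a node in the order in which they are sent for the first time. -/
theorem rcvd_value_comparable {t t' : ℕ} {y i i' : Fin n} {x z : TVal n α}
    (hx : Msg.value x ∈ (E.loc t i).rcvd y) (hz : Msg.value z ∉ (E.loc t i).rcvd y)
    (hz' : Msg.value z ∈ (E.loc t' i').rcvd y) : Msg.value x ∈ (E.loc t' i').rcvd y := by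
  have first : ∀ {u : TVal n α} {t : ℕ} {i : Fin n}, Msg.value u ∈ (E.loc t i).rcvd y →
      ∃ s, (¬ ∃ k, Msg.value u ∈ E.Sent s y k) ∧ ∃ k, Msg.value u ∈ E.Sent (s + 1) y k := by
    intro u t i h
    obtain ⟨s, -, -, h⟩ := exists_first (P := fun s => ∃ k, Msg.value u ∈ E.Sent s y k)
      (a := 0) (t := t) (by simp [sent_zero]) t.zero_le ⟨i, E.rcvd_subset_sent _ _ _ h⟩
    exact ⟨s, h⟩
  have key : ∀ {u w : TVal n α} {s s' t : ℕ} {i : Fin n},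
      (∃ k, Msg.value u ∈ E.Sent (s + 1) y k) → (¬ ∃ k, Msg.value w ∈ E.Sent s' y k) →
      (∃ k, Msg.value w ∈ E.Sent (s' + 1) y k) → s < s' →
      Msg.value w ∈ (E.loc t i).rcvd y → Msg.value u ∈ (E.loc t i).rcvd y := by
    rintro u w s s' t i ⟨k, hu⟩ hw ⟨l, hw'⟩ hlt hr
    have ha := (E.value_new hw' fun h => hw ⟨_, h⟩).1
    exact E.rcvd_of_sent_of_not_sent
      (E.sent_value_all ha (E.sent_mono (Nat.succ_le_of_lt hlt) _ _ hu) i)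
      (fun h => hw ⟨_, h⟩) hr
  obtain ⟨s, hs, hs1⟩ := first hx
  obtain ⟨s', hs', hs1'⟩ := first hz'
  rcases lt_trichotomy s s' with h | rfl | h
  · exact key hs1 hs' hs1' h hz'
  -- Both values are sent for the first time in the same step. A step sends at most one value, so
  -- they coincide.
  · obtain ⟨k, hk⟩ := hs1
    obtain ⟨k', hk'⟩ := hs1'
    obtain rfl := E.value_new_unique hk (fun h => hs ⟨_, h⟩) hk' (fun h => hs' ⟨_, h⟩)
    exact absurd hx hz
  · exact absurd (key hs1' hs hs1 h hx) hz

/-- While `i` waits for its quorum it has sent just the values in `V[i]`, so `z` leaves `i` after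
`x`. This replaces `rcvd_value_comparable` when the common node is one of the two callers, whose own
entry `V[i]` also collects values received from others. -/
theorem rcvd_value_of_latWait (hf : 2 * f < n) {t t' ph r : ℕ} {i i' : Fin n} {o : Op α}
    {x z : TVal n α} (hi : E.Alive t i) (h : (E.loc t i).pc = .latWait o ph r)
    (hx : x ∈ (E.loc t i).V i) (hz : z ∉ (E.loc t i).V i)
    (hz' : Msg.value z ∈ (E.loc t' i').rcvd i) : Msg.value x ∈ (E.loc t' i').rcvd i :=
  E.rcvd_of_sent_of_not_sent (E.sent_of_mem_V hi hx i')
    (fun hs => hz (E.mem_V_of_latWait hf hi h hs)) hz'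

variable {E}

/-- If neither view contains the other, pick `x` and `z` in the two differences. A node common to
both equivalence quorums would have to deliver `x` before `z` to one caller and `z` before `x` to
the other. -/
theorem GoodAt.view_total_of_eq (hf : 2 * f < n) {t t' r : ℕ} {i i' : Fin n}
    (h : E.GoodAt t i r) (h' : E.GoodAt t' i' r) :
    E.view t i r ⊆ E.view t' i' r ∨ E.view t' i' r ⊆ E.view t i r := by
  by_contra! hcon
  obtain ⟨x, hx, hx'⟩ := Set.not_subset.1 hcon.1
  obtain ⟨z, hz', hz⟩ := Set.not_subset.1 hcon.2
  have hii : i ≠ i' := by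
    rintro rfl
    rcases le_total t t' with hle | hle
    · exact hx' ⟨E.V_mono hle _ _ hx.1, hx.2⟩
    · exact hz ⟨E.V_mono hle _ _ hz'.1, hz'.2⟩
  obtain ⟨ha, ⟨o, ph, hpc⟩, hEQ, -⟩ := h
  obtain ⟨ha', ⟨o', ph', hpc'⟩, hEQ', -⟩ := h'
  obtain ⟨y, hy, hy'⟩ := Quorum.inter hf
    (P := fun y => leTag r ((E.loc t i).V y) = leTag r ((E.loc t i).V i))
    (Q := fun y => leTag r ((E.loc t' i').V y) = leTag r ((E.loc t' i').V i')) hEQ hEQ'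
  have hxy : x ∈ (E.loc t i).V y := (hy.symm ▸ hx : x ∈ leTag r _).1
  have hzy' : z ∈ (E.loc t' i').V y := (hy'.symm ▸ hz' : z ∈ leTag r _).1
  have hzi : z ∉ (E.loc t i).V i := fun h => hz ⟨h, hz'.2⟩
  have hxi' : x ∉ (E.loc t' i').V i' := fun h => hx' ⟨h, hx.2⟩
  have hzy : Msg.value z ∉ (E.loc t i).rcvd y := fun h => hzi (E.mem_V_self_of_rcvd h)
  have hxy' : Msg.value x ∉ (E.loc t' i').rcvd y := fun h => hxi' (E.mem_V_self_of_rcvd h)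
  by_cases hyi : y = i
  · subst hyi
    exact hxy' (E.rcvd_value_of_latWait hf ha hpc hxy hzi (E.rcvd_of_mem_V hii hzy'))
  by_cases hyi' : y = i'
  · subst hyi'
    exact hzy (E.rcvd_value_of_latWait hf ha' hpc' hzy' hxi' (E.rcvd_of_mem_V hyi hxy))
  exact hxy' (E.rcvd_value_comparable (E.rcvd_of_mem_V hyi hxy) hzy (E.rcvd_of_mem_V hyi' hzy'))

/-- The results of successful `Lattice` calls are comparable. -/
theorem GoodAt.view_total (hf : 2 * f < n) {t t' r r' : ℕ} {i i' : Fin n}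
    (h : E.GoodAt t i r) (h' : E.GoodAt t' i' r') :
    E.view t i r ⊆ E.view t' i' r' ∨ E.view t' i' r' ⊆ E.view t i r := by
  rcases lt_trichotomy r r' with hr | rfl | hr
  · exact .inl (h.view_subset_of_lt hf h' hr)
  · exact h.view_total_of_eq hf h'
  · exact .inr (h'.view_subset_of_lt hf h hr)

variable (E)

theorem goodAt_of_new {t g : ℕ} {j i : Fin n} (h : Msg.goodLA g ∈ E.Sent (t + 1) j i)
    (h' : Msg.goodLA g ∉ E.Sent t j i) : E.GoodAt t j g := by
  obtain ⟨ha, o, ph, hpc, hEQ, hm, -⟩ := E.goodLA_new h h'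
  exact ⟨ha, ⟨o, ph, hpc⟩, hEQ, hm⟩

theorem tagStored_of_goodLA {t g : ℕ} {j i : Fin n} (h : Msg.goodLA g ∈ E.Sent t j i) :
    E.TagStored t g := by
  induction t with
  | zero => simp [sent_zero] at h
  | succ t ih =>
    refine TagStored.mono ?_ t.le_succ le_rfl
    by_cases h' : Msg.goodLA g ∈ E.Sent t j i
    · exact ih h'
    · exact (E.goodAt_of_new h h').tagStored

/-- What is known at time `t` about the tag `g` of a successful `Lattice` call of node `i`. -/
def GoodStage (t : ℕ) (i : Fin n) (g : ℕ) : PC n α → Prop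
  | .readStart _ | .readWait _ _ => E.TagStored (E.cur i t) g
  | .sendValue _ r => g ≤ r
  | .latStart _ ph r | .latWrite _ ph r _ | .latWait _ ph r
  | .latDone _ ph r none => g ≤ r ∧ (2 ≤ ph → g < r)
  | .latDone _ ph r (some _) => ph = 0 → g ≤ r
  | .borrow _ r => g < r
  | .renewed _ _ | .idle => True

/-- A successful `Lattice(g)` has stored `g`, so the next operation reads at least `g`; within an
operation each failed phase from 1 on is followed by a strictly larger tag. Hence the tags announced
by one node never decrease, and a borrowing node has not announced the tag it waits for. -/
theorem goodStage (hf : 2 * f < n) {t g : ℕ} {i y : Fin n}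
    (hg : Msg.goodLA g ∈ E.Sent t i y) : E.GoodStage t i g (E.loc t i).pc := by
  induction t with
  | zero => simp [sent_zero] at hg
  | succ t ih =>
    by_cases h' : Msg.goodLA g ∈ E.Sent t i y
    swap
    · obtain ⟨-, o, ph, -, -, -, hpc⟩ := E.goodLA_new hg h'
      rw [hpc]
      exact fun _ => le_rfl
    have ih := ih h'
    rcases E.pc_step t i with ⟨hpc, h1, h2⟩ | ⟨-, o', ha, -, hpc⟩ | ⟨-, r, hr, hcr, hpc⟩ |
      ⟨hal, h1, h2, cmds, hc, hs⟩
    · rw [hpc]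
      revert ih
      cases (E.loc t i).pc <;> simp only [GoodStage, E.cur_succ h1] <;> exact id
    · rw [hpc, GoodStage, E.cur_succ_of_invoke ha]
      exact E.tagStored_of_goodLA h'
    · rw [hpc]; trivial
    · have hcur := E.cur_succ h1
      clear hs hg
      generalize E.loc (t + 1) i = s' at *
      cases hc
      case sendReadTag o hpc => rw [hpc] at ih; simpa only [GoodStage, hcur] using ih
      case readUpdate v q r hpc hq hr =>
        rw [hpc] at ih
        exact (E.read_correct hf hpc hq hr).1 g ih
      case readScan q r hpc hq hr =>
        rw [hpc] at ih
        exact ⟨(E.read_correct hf hpc hq hr).1 g ih, by simp⟩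
      case sendValue v r hpc => rw [hpc] at ih; exact ⟨ih, by simp⟩
      case sendWriteTag o ph r hpc => rw [hpc] at ih; exact ih
      case writeDone o ph r q hpc hq => rw [hpc] at ih; exact ih
      case good o ph r hpc _ _ => rw [hpc] at ih; exact fun _ => ih.1
      case bad o ph r hpc _ _ => rw [hpc] at ih; exact ih
      case afterPhase0 o r res hpc =>
        rw [hpc] at ih
        refine ⟨?_, by simp⟩
        have : g ≤ r := by
          cases res with
          | none => exact ih.1
          | some _ => exact ih rfl
        omega
      case direct => trivial
      case nextPhase o ph r hph hph3 hpc =>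
        have hlt := E.lt_maxTag_of_failed hpc
        rw [hpc] at ih
        exact ⟨ih.1.trans hlt.le, fun _ => ih.1.trans_lt hlt⟩
      case exitLoop o r hpc => rw [hpc] at ih; exact ih.2 (by norm_num)
      case indirect => trivial

end Execution

section

variable {n f : ℕ} {α : Type*} {v₀ : Fin n → α}

theorem Executed.outbox_singleton {c : Cmd n α} {cmds' : List (Cmd n α)} {p : Prop}
    (h : Executed [c] cmds' p) (i : Fin n) : outbox cmds' i = [] ∨ outbox cmds' i = [c.msg] := by
  rcases h with rfl | ⟨⟨pre, post, x, d, h, -, rfl⟩, -⟩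
  · by_cases hi : i ∈ c.dest <;> simp [outbox, hi]
  · rcases pre with _ | ⟨a, pre⟩
    · simp only [List.nil_append, List.cons.injEq] at h
      obtain ⟨rfl, -⟩ := h
      by_cases hi : i ∈ d <;> simp [outbox, hi]
    · simp at h

end

namespace Execution

variable {n f : ℕ} {α : Type*} {v₀ : Fin n → α} (E : Execution n f v₀)

/-! ### Borrowed views -/

variable {E} in
theorem Output.goodLA {t g : ℕ} {j i : Fin n} {out : List (Msg n α)} (h : E.Output t j i out)
    (hg : Msg.goodLA g ∈ out) : out = [.goodLA g] ∧ E.GoodAt t j g := by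
  rcases h with rfl | ⟨cmds, cmds', p, he, rfl, ha, h⟩
  · simp at hg
  have hg' := he.mem_outbox hg
  rw [mem_outbox] at hg'
  obtain ⟨c, hc, -, hcg⟩ := hg'
  rcases h with h | ⟨k, s, m, rfl⟩
  · have h := h.client_of_mem hc
    generalize E.loc (t + 1) j = s' at *
    cases h <;> simp [Cmd.toAll] at hc <;> subst hc <;> simp at hcg
    next o ph r hpc hEQ hm =>
      subst hcg
      refine ⟨(he.outbox_singleton i).resolve_left fun h => ?_, ha, ⟨o, ph, hpc⟩, hEQ, hm⟩
      simp [h] at hg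
  · cases m with
    | value w =>
      by_cases hw : w ∈ s.V j <;> simp [handle, hw] at hc
      subst hc
      simp [Cmd.toAll] at hcg
    | _ => simp [handle] at hc <;> grind [Cmd.toAll, Cmd.to]

/-- When `goodLA g` is received, exactly the values that the sender had in its view have been
received from it, and `g` is the largest tag announced so far. -/
theorem goodLA_in_transit (hf : 2 * f < n) {t : ℕ} {j k : Fin n} {l₁ l₂ : List (Msg n α)} {g : ℕ}
    (h : (E.state t).chan j k = l₁ ++ .goodLA g :: l₂) : ∃ t₀ < t, E.GoodAt t₀ j g ∧
      (∀ u, u ∈ (E.loc t₀ j).V j ↔ Msg.value u ∈ (E.loc t k).rcvd j ∨ Msg.value u ∈ l₁) ∧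
      ∀ g', Msg.goodLA g' ∈ (E.loc t k).rcvd j ∨ Msg.goodLA g' ∈ l₁ → g' ≤ g := by
  induction t generalizing l₁ l₂ g with
  | zero => simp [E.start, Config.initial] at h
  | succ t ih =>
    obtain ⟨out, hout, hstep⟩ := E.chan_step t j k
    have key : ∀ {l₁ l₂ : List (Msg n α)} {g : ℕ},
        (E.state t).chan j k ++ out = l₁ ++ .goodLA g :: l₂ → ∃ t₀ < t + 1, E.GoodAt t₀ j g ∧
          (∀ u, u ∈ (E.loc t₀ j).V j ↔ Msg.value u ∈ (E.loc t k).rcvd j ∨ Msg.value u ∈ l₁) ∧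
          ∀ g', Msg.goodLA g' ∈ (E.loc t k).rcvd j ∨ Msg.goodLA g' ∈ l₁ → g' ≤ g := by
      intro l₁ l₂ g h
      -- When the announcement is sent, the values sent to `k` so far are exactly those in `V[j]` of
      -- the sender.
      have hnew : l₁ = (E.state t).chan j k → Msg.goodLA g ∈ out → ∃ t₀ < t + 1, E.GoodAt t₀ j g ∧
          (∀ u, u ∈ (E.loc t₀ j).V j ↔ Msg.value u ∈ (E.loc t k).rcvd j ∨ Msg.value u ∈ l₁) ∧
          ∀ g', Msg.goodLA g' ∈ (E.loc t k).rcvd j ∨ Msg.goodLA g' ∈ l₁ → g' ≤ g := by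
        rintro rfl hg
        have hG := (hout.goodLA hg).2
        obtain ⟨ha, ⟨o, ph, hpc⟩, -⟩ := id hG
        refine ⟨t, t.lt_succ_self, hG, fun u => ⟨fun hu => E.sent_of_mem_V ha hu k, fun hu => ?_⟩,
          fun g' hg' => ?_⟩
        · exact E.mem_V_of_latWait hf ha hpc (y := k) hu
        · have h3 := E.goodStage hf (i := j) (y := k) hg'
          rw [hpc] at h3
          exact h3.1
      -- A step that sends `goodLA` to `k` sends it nothing else, so a new announcement has
      -- precisely the old channel in front of it.
      rcases List.append_eq_append_iff.1 h with ⟨a, h1, h2⟩ | ⟨a, h1, h2⟩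
      · have h3 := (hout.goodLA (by rw [h2]; simp : Msg.goodLA g ∈ out)).1
        have h4 : a = [] := by
          rcases a with _ | ⟨b, a⟩
          · rfl
          · rw [h3] at h2; simp at h2
        exact hnew (by rw [h1, h4, List.append_nil]) (by rw [h2]; simp)
      · rcases a with _ | ⟨b, a⟩
        · exact hnew (by rw [h1, List.append_nil]) (by rw [List.nil_append] at h2; simp [← h2])
        · simp only [List.cons_append, List.cons.injEq] at h2
          obtain ⟨rfl, -⟩ := h2
          obtain ⟨t₀, h3, h4⟩ := ih h1
          exact ⟨t₀, h3.trans t.lt_succ_self, h4⟩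
    rcases hstep with ⟨hc, hr, -⟩ | ⟨m, l, hc, hc', hr, -⟩
    · rw [hr]
      exact key (hc ▸ h)
    · obtain ⟨t₀, h1, h2, h3, h4⟩ := key (l₁ := m :: l₁) (l₂ := l₂) (g := g)
        (by rw [hc, List.cons_append, ← hc', h, List.cons_append])
      refine ⟨t₀, h1, h2, fun u => ?_, fun g' hg' => h4 g' ?_⟩
      · rw [h3, hr, List.mem_cons, Set.mem_insert_iff]
        tauto
      · rw [hr, Set.mem_insert_iff] at hg'
        rw [List.mem_cons]
        tauto

/-- By FIFO, `V[j]` at the receiver is the sender's `V[j]` at the moment of success, whence `D[j]`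
is a genuine view. A later announcement may have overwritten it, but only with a tag that is at
least as large. For `j = k` the entry also holds values received from others. -/
theorem view_of_D (hf : 2 * f < n) {t r : ℕ} {j k : Fin n} (hjk : j ≠ k)
    (h : Msg.goodLA r ∈ (E.loc t k).rcvd j) :
    ∃ t₀ < t, ∃ g, E.GoodAt t₀ j g ∧ r ≤ g ∧ (E.loc t k).D j = E.view t₀ j g := by
  induction t generalizing r with
  | zero => simp [loc, E.start, Config.initial] at h
  | succ t ih =>
    have lift : ∀ {S : Set (TVal n α)} {r : ℕ},
        (∃ t₀ < t, ∃ g, E.GoodAt t₀ j g ∧ r ≤ g ∧ S = E.view t₀ j g) →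
        ∃ t₀ < t + 1, ∃ g, E.GoodAt t₀ j g ∧ r ≤ g ∧ S = E.view t₀ j g :=
      fun ⟨t₀, h, h'⟩ => ⟨t₀, h.trans t.lt_succ_self, h'⟩
    rcases E.loc_step t k with ⟨hl, -⟩ | ⟨-, _, hl, -⟩ | ⟨-, j', m, l, -, -, hc, hl⟩
    · rw [hl] at h ⊢
      exact lift (ih h)
    · rw [hl.unchanged.2.2.2.1] at h
      rw [hl.unchanged.2.1]
      exact lift (ih h)
    · rw [hl, handle_rcvd] at h
      rw [hl]
      by_cases hj : j = j'
      · subst hj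
        rw [Function.update_self] at h
        cases m with
        | goodLA g =>
          obtain ⟨t₀, ht₀, hG, hV, hle⟩ := E.goodLA_in_transit hf (l₁ := []) hc
          refine ⟨t₀, ht₀.trans t.lt_succ_self, g, hG, ?_, ?_⟩
          · rcases h with h | h
            · cases h; exact le_rfl
            · exact hle r (.inl h)
          · have : (E.loc t k).V j = (E.loc t₀ j).V j := by
              ext u
              rw [hV, E.mem_V]
              simp [hjk]
            simp [handle, view, this]
        | _ => exact lift (ih (h.resolve_left (by simp)))
      · rw [Function.update_of_ne hj] at h
        have : (handle k j' (E.loc t k) m).1.D j = (E.loc t k).D j := by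
          cases m <;> simp [handle, Local.record, hj]
        rw [this]
        exact lift (ih h)

/-! ### The views returned by `LatticeRenewal` -/

/-- An operation invoked at time `k` has to see the value `x`. -/
def Required (k : ℕ) (x : TVal n α) : Prop := E.ValueStored k x ∧ E.TagStored k x.tag

/-- `S` is the result of a successful `Lattice` call before time `t`, and it contains every value
that an operation invoked at time `k` has to see. -/
def Captures (t k : ℕ) (S : Set (TVal n α)) : Prop :=
  ∃ t₀ < t, ∃ j g, E.GoodAt t₀ j g ∧ S = E.view t₀ j g ∧ ∀ x, E.Required k x → x ∈ S

/-- What is known at time `t` about an operation of node `i` invoked at time `k`. -/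
def RenewalStage (t : ℕ) (i : Fin n) (k : ℕ) : PC n α → Prop
  | .latStart _ ph r | .latWrite _ ph r _ => 2 ≤ ph → ∃ t₁ ≤ t,
      (∀ x, E.Required k x → E.ValueKnown t₁ i x) ∧ (E.loc t₁ i).maxTag ≤ r ∧
        (3 ≤ ph → (E.loc t₁ i).maxTag < r)
  | .latWait _ ph r | .latDone _ ph r none => 1 ≤ ph → ∃ t₁ ≤ t,
      (∀ x, E.Required k x → E.ValueKnown t₁ i x) ∧ (2 ≤ ph → (E.loc t₁ i).maxTag ≤ r) ∧
        (3 ≤ ph → (E.loc t₁ i).maxTag < r)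
  | .borrow _ r => ∃ t₁ ≤ t,
      (∀ x, E.Required k x → E.ValueKnown t₁ i x) ∧ (E.loc t₁ i).maxTag < r
  | .latDone _ _ _ (some S) | .renewed _ S => E.Captures t k S
  | _ => True

variable {E} in
theorem RenewalStage.succ {t k : ℕ} {i : Fin n} {p : PC n α} (h : E.RenewalStage t i k p) :
    E.RenewalStage (t + 1) i k p := by
  have hC : ∀ S, E.Captures t k S → E.Captures (t + 1) k S :=
    fun S ⟨t₀, h, h'⟩ => ⟨t₀, h.trans t.lt_succ_self, h'⟩
  have hE : ∀ {P : ℕ → Prop}, (∃ t₁ ≤ t, P t₁) → ∃ t₁ ≤ t + 1, P t₁ :=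
    fun ⟨t₁, h, h'⟩ => ⟨t₁, h.trans t.le_succ, h'⟩
  match p, h with
  | .latStart _ _ _, h | .latWrite _ _ _ _, h => exact fun hp => hE (h hp)
  | .latWait _ _ _, h | .latDone _ _ _ none, h => exact fun hp => hE (h hp)
  | .borrow _ _, h => exact hE h
  | .latDone _ _ _ (some _), h | .renewed _ _, h => exact hC _ h
  | .idle, _ | .readStart _, _ | .readWait _ _, _ | .sendValue _ _, _ => trivial

/-- Three phases are what borrowing needs. Let `t₁` be the end of `writeTag` in phase 1, when the
acknowledgements show that all required values are stored. The phase 2 tag is a `maxTag` read after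
`t₁`, and the failure of phase 2 makes the phase 3 tag strictly larger than `maxTag` at `t₁`. A call
with such a tag sees what was known at `t₁`, by `ValueKnown.mem_of_latWait`. -/
theorem renewalStage (hf : 2 * f < n) {t : ℕ} {i : Fin n} (hi : E.Alive t i) :
    E.RenewalStage t i (E.cur i t) (E.loc t i).pc := by
  induction t with
  | zero => simp [loc, E.start, Config.initial, RenewalStage]
  | succ t ih =>
    have ih := ih hi.of_succ
    rcases E.pc_step t i with ⟨hpc, h1, h2⟩ | ⟨-, o', ha, -, hpc⟩ | ⟨-, r, hr, hcr, hpc⟩ |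
      ⟨hal, h1, h2, cmds, hc, hs⟩
    · rw [hpc, E.cur_succ h1]
      exact ih.succ
    · rw [hpc]; trivial
    · rw [hpc]; trivial
    · rw [E.cur_succ h1]
      clear hs
      generalize E.loc (t + 1) i = s' at *
      cases hc
      case sendReadTag => trivial
      case readUpdate => trivial
      case readScan => exact fun h => absurd h (by norm_num)
      case sendValue => exact fun h => absurd h (by norm_num)
      case sendWriteTag o ph r hpc => rw [hpc] at ih; exact ih.succ
      case writeDone o ph r q hpc hq =>
        rw [hpc] at ih
        intro hph
        rcases hph.eq_or_lt with rfl | hph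
        · obtain ⟨τ, hτ, ha, hpcτ, hcur, hw⟩ := E.latWrite_start hpc
          refine ⟨t, t.le_succ, fun x hx => hq.imp fun y hy => ?_, by simp, by simp⟩
          have := (E.tag_correct hf (r := r) (by rw [hpcτ]; rfl)).2 x (hcur ▸ hx.1)
          exact (E.value_of_writeAck (E.sent_of_mem_V ha this y) (hw y) hy).1
        · obtain ⟨t₁, h3, h4, h5, h6⟩ := ih.succ hph
          exact ⟨t₁, h3, h4, fun _ => h5, h6⟩
      case good o ph r hpc hEQ hm =>
        have h3 := E.tag_correct hf (t := t) (i := i) (r := r) (by rw [hpc]; rfl)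
        exact ⟨t, t.lt_succ_self, i, r, ⟨hal, ⟨o, ph, hpc⟩, hEQ, hm⟩, rfl,
          fun x hx => ⟨h3.2 x hx.1, h3.1 _ hx.2⟩⟩
      case bad o ph r hpc _ _ => rw [hpc] at ih; exact ih.succ
      case afterPhase0 => exact fun h => absurd h (by norm_num)
      case direct o ph r S hph hpc => rw [hpc] at ih; exact ih.succ
      case nextPhase o ph r hph hph3 hpc =>
        have hlt := E.lt_maxTag_of_failed hpc
        rw [hpc] at ih
        intro _
        obtain ⟨t₁, h3, h4, h5, h6⟩ := ih hph
        exact ⟨t₁, h3.trans t.le_succ, h4, E.maxTag_mono h3 i,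
          fun h => (h5 (by omega)).trans_lt hlt⟩
      case exitLoop o r hpc =>
        rw [hpc] at ih
        obtain ⟨t₁, h3, h4, h5, h6⟩ := ih (by norm_num)
        exact ⟨t₁, h3.trans t.le_succ, h4, h6 (by norm_num)⟩
      case indirect o r j hpc hj =>
        have h3 := E.tag_correct hf (t := t) (i := i) (r := r) (by rw [hpc]; rfl)
        -- The node's own announcements all have tags below `r`.
        have hji : j ≠ i := by
          rintro rfl
          have := E.goodStage hf (E.rcvd_subset_sent _ _ _ hj)
          rw [hpc] at this
          exact lt_irrefl _ this
        rw [hpc] at ih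
        obtain ⟨t₁, -, h4, h5⟩ := ih
        obtain ⟨t₀, ht₀, g, hG, hrg, hD⟩ := E.view_of_D hf hji hj
        obtain ⟨-, ⟨o', ph, hpc'⟩, -⟩ := id hG
        exact ⟨t₀, ht₀.trans t.lt_succ_self, j, g, hG, hD, fun x hx => hD ▸
          ⟨(h4 x hx).mem_of_latWait hf (h5.trans_le hrg) hpc', (h3.1 _ hx.2).trans hrg⟩⟩

end Execution

end ACASO

/-! ### Linearizing a history by sorting its operations by views -/

namespace Snapshot

namespace History

variable {n : ℕ} {α : Type*}

/-- The operation invoked at time `k` is a completed scan. -/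
def CompletedScan (H : History n α) (k : ℕ) : Prop := (∃ i, H.IsOp k i .scan) ∧ H.Completes k

/-- `B` assigns to each completed scan the set of updates that it sees, in such a way that the
history can be linearized by sorting the scans by their views. -/
structure ViewAssignment (H : History n α) (v₀ : Fin n → α) (B : ℕ → Set ℕ) : Prop where
  isUpdate : ∀ k, H.CompletedScan k → ∀ u ∈ B k, ∃ j v, H.IsOp u j (.update v)
  lt_of_mem : ∀ k m r, H.CompletedScan k → H.CompletesAt k m r → ∀ u ∈ B k, u < m
  total : ∀ k k', H.CompletedScan k → H.CompletedScan k' → B k ⊆ B k' ∨ B k' ⊆ B k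
  mem_of_precedes : ∀ u j v k, H.IsOp u j (.update v) → H.CompletedScan k → H.Precedes u k → u ∈ B k
  mono : ∀ k k', H.CompletedScan k → H.CompletedScan k' → H.Precedes k k' → B k ⊆ B k'
  downward : ∀ u j v u' j' v' k, H.IsOp u j (.update v) → H.IsOp u' j' (.update v') →
    H.Precedes u u' → H.CompletedScan k → u' ∈ B k → u ∈ B k
  sequential : ∀ k k' i o o', H.IsOp k i o → H.IsOp k' i o' → k < k' → H.Precedes k k'
  ack : ∀ k i v m r, H.IsOp k i (.update v) → H.CompletesAt k m r → r = .ack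
  snap : ∀ k i m r, H.IsOp k i .scan → H.CompletesAt k m r → ∃ s, r = .snap s ∧ ∀ j,
    (∃ u ∈ B k, ∃ v, H.IsOp u j (.update v) ∧ s j = v ∧
      ∀ u' ∈ B k, ∀ w, H.IsOp u' j (.update w) → u' ≤ u) ∨
    ((∀ u ∈ B k, ∀ v, ¬ H.IsOp u j (.update v)) ∧ s j = v₀ j)

/-- The operations that are linearized. -/
def linearized (H : History n α) (B : ℕ → Set ℕ) : Set ℕ :=
  {x | H.Completes x ∨ ∃ k, H.CompletedScan k ∧ x ∈ B k}

/-- The completed scans that are not before `x`, up to the order of the scans with equal views. -/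
def upper (H : History n α) (B : ℕ → Set ℕ) (x : ℕ) : Set ℕ :=
  {k | H.CompletedScan k ∧ (x ∈ B k ∨ H.CompletedScan x ∧ B x ⊆ B k)}

/-- The linearization order: sort by `upper`, then updates before scans, then by the time of
invocation. -/
def linLT (H : History n α) (B : ℕ → Set ℕ) (x y : ℕ) : Prop :=
  H.upper B y ⊂ H.upper B x ∨ H.upper B x = H.upper B y ∧
    (¬ H.CompletedScan x ∧ H.CompletedScan y ∨ (H.CompletedScan x ↔ H.CompletedScan y) ∧ x < y)

theorem linLT_irrefl (H : History n α) (B : ℕ → Set ℕ) (x : ℕ) : ¬ H.linLT B x x := by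
  rintro (h | ⟨-, h⟩)
  · exact h.ne rfl
  · simp at h

theorem linLT_trans {H : History n α} {B : ℕ → Set ℕ} {x y z : ℕ} (h : H.linLT B x y)
    (h' : H.linLT B y z) : H.linLT B x z := by
  rcases h with h | ⟨h, hd⟩
  · rcases h' with h' | ⟨h', -⟩
    · exact .inl (h'.trans h)
    · exact .inl (h' ▸ h)
  · rcases h' with h' | ⟨h', hd'⟩
    · exact .inl (h ▸ h')
    · refine .inr ⟨h.trans h', ?_⟩
      have : x < y → y < z → x < z := lt_trans
      tauto

namespace ViewAssignment

variable {H : History n α} {v₀ : Fin n → α} {B : ℕ → Set ℕ}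

theorem not_completedScan_of_mem (hB : H.ViewAssignment v₀ B) {k u : ℕ} (hk : H.CompletedScan k)
    (hu : u ∈ B k) : ¬ H.CompletedScan u := by
  rintro ⟨⟨i, h⟩, -⟩
  obtain ⟨j, v, h'⟩ := hB.isUpdate k hk u hu
  simp [IsOp] at h h'
  simp [h'] at h

theorem upper_total (hB : H.ViewAssignment v₀ B) (x y : ℕ) :
    H.upper B x ⊆ H.upper B y ∨ H.upper B y ⊆ H.upper B x := by
  by_contra! h
  obtain ⟨a, ⟨ha, hax⟩, hay⟩ := Set.not_subset.1 h.1
  obtain ⟨b, ⟨hb, hby⟩, hbx⟩ := Set.not_subset.1 h.2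
  rcases hB.total a b ha hb with hab | hab
  · exact hbx ⟨hb, hax.imp (fun h => hab h) fun h => ⟨h.1, h.2.trans hab⟩⟩
  · exact hay ⟨ha, hby.imp (fun h => hab h) fun h => ⟨h.1, h.2.trans hab⟩⟩

theorem linLT_trichotomy (hB : H.ViewAssignment v₀ B) (x y : ℕ) :
    H.linLT B x y ∨ x = y ∨ H.linLT B y x := by
  by_cases heq : H.upper B x = H.upper B y
  · have := lt_trichotomy x y
    simp only [linLT, heq]
    tauto
  · rcases hB.upper_total x y with h | h
    · exact .inr (.inr (.inl (h.ssubset_of_ne heq)))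
    · exact .inl (.inl (h.ssubset_of_ne (Ne.symm heq)))

theorem mem_upper_self {k : ℕ} (hk : H.CompletedScan k) : k ∈ H.upper B k :=
  ⟨hk, .inr ⟨hk, subset_rfl⟩⟩

/-- This is the purpose of `upper`: the scan `k` belongs to its own upper set, and to that of an
update only by seeing it. Ties go to the update. -/
theorem linLT_scan_iff (hB : H.ViewAssignment v₀ B) {u k : ℕ} (hu : ¬ H.CompletedScan u)
    (hk : H.CompletedScan k) : H.linLT B u k ↔ u ∈ B k := by
  constructor
  · rintro h
    have : H.upper B k ⊆ H.upper B u := by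
      rcases h with h | h
      · exact h.subset
      · exact h.1.symm.subset
    exact (this (mem_upper_self hk)).2.resolve_right fun h => hu h.1
  · intro h
    have hsub : H.upper B k ⊆ H.upper B u := fun l hl => ⟨hl.1, .inl <|
      (hl.2.resolve_left fun hk' => hB.not_completedScan_of_mem hl.1 hk' hk).2 h⟩
    by_cases heq : H.upper B u = H.upper B k
    · exact .inr ⟨heq, .inl ⟨hu, hk⟩⟩
    · exact .inl (hsub.ssubset_of_ne (Ne.symm heq))

theorem isOp_of_mem_linearized (hB : H.ViewAssignment v₀ B) {x : ℕ} (hx : x ∈ H.linearized B) :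
    ∃ i o, H.IsOp x i o := by
  rcases hx with ⟨m, r, i, o, h, -⟩ | ⟨k, hk, hx⟩
  · exact ⟨i, o, h⟩
  · obtain ⟨j, v, h⟩ := hB.isUpdate k hk x hx
    exact ⟨j, _, h⟩

theorem update_or_scan (hB : H.ViewAssignment v₀ B) {x : ℕ} (hx : x ∈ H.linearized B) :
    (¬ H.CompletedScan x ∧ ∃ j v, H.IsOp x j (.update v)) ∨ H.CompletedScan x := by
  by_cases h : H.CompletedScan x
  · exact .inr h
  · refine .inl ⟨h, ?_⟩
    rcases hx with hx | ⟨k, hk, hx⟩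
    · obtain ⟨m, r, i, o, ho, -⟩ := id hx
      cases o with
      | update v => exact ⟨i, v, ho⟩
      | scan => exact absurd ⟨⟨i, ho⟩, hx⟩ h
    · exact hB.isUpdate k hk x hx

/-- Among updates `downward` gives inclusion of upper sets, among scans `mono` does, and invocation
times break ties. An update before a scan is seen by it. -/
theorem linLT_of_precedes (hB : H.ViewAssignment v₀ B) {x y : ℕ} (hx : x ∈ H.linearized B)
    (hy : y ∈ H.linearized B) (h : H.Precedes x y) : H.linLT B x y := by
  have hxy : x < y := by
    obtain ⟨m, r, ⟨_, _, _, hm, -⟩, hmy⟩ := h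
    exact hm.trans hmy
  have fin : H.upper B y ⊆ H.upper B x → (H.CompletedScan x → H.CompletedScan y) →
      H.linLT B x y := by
    intro hsub hty
    by_cases heq : H.upper B x = H.upper B y
    · refine .inr ⟨heq, ?_⟩
      tauto
    · exact .inl (hsub.ssubset_of_ne (Ne.symm heq))
  rcases hB.update_or_scan hx with ⟨hx', j, v, hxo⟩ | hx' <;>
    rcases hB.update_or_scan hy with ⟨hy', j', v', hyo⟩ | hy'
  · exact fin (fun k hk => ⟨hk.1, .inl (hB.downward x j v y j' v' k hxo hyo h hk.1
      (hk.2.resolve_right fun h => hy' h.1))⟩) (fun h => absurd h hx')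
  · exact (hB.linLT_scan_iff hx' hy').2 (hB.mem_of_precedes x j v y hxo hy' h)
  · obtain ⟨m, r, hm, hmy⟩ := id h
    -- The scan `x` cannot see an update invoked after its response. A scan that sees `y` therefore
    -- has a view not contained in that of `x`, hence containing it; and `x` itself makes the
    -- inclusion strict.
    have hyx : y ∉ B x := fun hyx => absurd (hB.lt_of_mem x m r hx' hm y hyx) (by omega)
    refine .inl ⟨fun k hk => ⟨hk.1, .inr ⟨hx', ?_⟩⟩, fun hsub =>
      hyx ((hsub (mem_upper_self hx')).2.resolve_right fun h => hy' h.1)⟩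
    exact (hB.total x k hx' hk.1).resolve_right fun hkx =>
      hyx (hkx (hk.2.resolve_right fun h => hy' h.1))
  · exact fin (fun k hk => ⟨hk.1, .inr ⟨hx', (hB.mono x y hx' hy' h).trans
      (hk.2.resolve_left fun h => hB.not_completedScan_of_mem hk.1 h hy').2⟩⟩) fun _ => hy'

theorem finite_linLT_scan (hB : H.ViewAssignment v₀ B) {k : ℕ} (hk : H.CompletedScan k) :
    {x ∈ H.linearized B | H.linLT B x k}.Finite := by
  obtain ⟨m, r, hm⟩ := hk.2
  have hkm : k < m := by
    obtain ⟨_, _, _, h, -⟩ := hm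
    exact h
  refine (Set.finite_Iic m).subset fun x hx => ?_
  by_contra hxm
  rw [Set.mem_Iic, not_le] at hxm
  rcases hB.update_or_scan hx.1 with ⟨hx', -⟩ | hx'
  · have := hB.lt_of_mem k m r hk hm x ((hB.linLT_scan_iff hx' hk).1 hx.2)
    omega
  · refine linLT_irrefl H B k (linLT_trans (hB.linLT_of_precedes ?_ hx.1 ⟨m, r, hm, hxm⟩) hx.2)
    exact .inl hk.2

theorem finite_linLT (hB : H.ViewAssignment v₀ B) {y : ℕ} (hy : y ∈ H.linearized B) :
    {x ∈ H.linearized B | H.linLT B x y}.Finite := by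
  rcases hB.update_or_scan hy with ⟨hy', j, v, hyo⟩ | hy'
  swap
  · exact hB.finite_linLT_scan hy'
  by_cases hmem : ∃ k, H.CompletedScan k ∧ y ∈ B k
  · obtain ⟨k, hk, hyk⟩ := hmem
    exact (hB.finite_linLT_scan hk).subset fun x hx =>
      ⟨hx.1, linLT_trans hx.2 ((hB.linLT_scan_iff hy' hk).2 hyk)⟩
  push Not at hmem
  obtain ⟨m, r, hm⟩ : H.Completes y := hy.resolve_right fun ⟨k, hk, h⟩ => hmem k hk h
  -- An update that no scan sees has completed, and any scan invoked after its response would see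
  -- it. So there are finitely many completed scans, each seeing finitely many updates.
  have hbound : ∀ k, H.CompletedScan k → k ≤ m := fun k hk => by
    by_contra! hlt
    exact hmem k hk (hB.mem_of_precedes y j v k hyo hk ⟨m, r, hm, hlt⟩)
  have hym : y < m := by
    obtain ⟨_, _, _, h, -⟩ := hm
    exact h
  have hfin : (⋃ k ∈ Set.Iic m, {u | H.CompletedScan k ∧ u ∈ B k}).Finite := by
    refine (Set.finite_Iic m).biUnion fun k _ => ?_
    by_cases hk : H.CompletedScan k
    · obtain ⟨m', r', hm'⟩ := hk.2
      exact (Set.finite_Iio m').subset fun u hu => hB.lt_of_mem k m' r' hk hm' u hu.2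
    · simp [hk]
  refine ((Set.finite_Iic m).union hfin).subset fun x hx => ?_
  rcases hx.2 with h | ⟨-, h | h⟩
  · obtain ⟨k, hk, -⟩ := Set.exists_of_ssubset h
    rcases hk.2 with h' | h'
    · exact .inr (Set.mem_biUnion (Set.mem_Iic.2 (hbound k hk.1)) ⟨hk.1, h'⟩)
    · exact .inl (hbound x h'.1)
  · exact absurd h.2 hy'
  · exact .inl (h.2.le.trans hym.le)

/-- A history with a view assignment is linearizable. -/
theorem linearizable (hB : H.ViewAssignment v₀ B) : H.Linearizable v₀ := by
  -- The position is the number of predecessors. Their finiteness matters, since `ncard` of an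
  -- infinite set is 0.
  let pos : ℕ → ℕ := fun y => {x ∈ H.linearized B | H.linLT B x y}.ncard
  have hlt : ∀ x ∈ H.linearized B, ∀ y ∈ H.linearized B, H.linLT B x y → pos x < pos y := by
    intro x hx y hy hxy
    refine Set.ncard_lt_ncard ⟨fun z hz => ⟨hz.1, linLT_trans hz.2 hxy⟩, fun h => ?_⟩
      (hB.finite_linLT hy)
    exact linLT_irrefl H B x (h ⟨hx, hxy⟩).2
  have hiff : ∀ x ∈ H.linearized B, ∀ y ∈ H.linearized B, pos x < pos y → H.linLT B x y := by
    intro x hx y hy hxy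
    rcases hB.linLT_trichotomy x y with h | rfl | h
    · exact h
    · exact absurd hxy (lt_irrefl _)
    · exact absurd (hlt y hy x hx h) hxy.asymm
  have hscan : ∀ {u j v k}, H.IsOp u j (.update v) → u ∈ H.linearized B → H.CompletedScan k →
      (pos u < pos k ↔ u ∈ B k) := by
    intro u j v k hu huS hk
    have hu' : ¬ H.CompletedScan u := by
      rintro ⟨⟨i, h⟩, -⟩
      simp [IsOp] at h hu
      simp [hu] at h
    rw [← hB.linLT_scan_iff hu' hk]
    exact ⟨hiff u huS k (.inl hk.2), hlt u huS k (.inl hk.2)⟩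
  refine ⟨H.linearized B, pos, fun k hk => hB.isOp_of_mem_linearized hk, fun k hk => .inl hk, ?_,
    fun x hx y hy h => hlt x hx y hy (hB.linLT_of_precedes hx hy h), hB.ack, ?_⟩
  · intro x hx y hy hxy
    rcases hB.linLT_trichotomy x y with h | h | h
    · exact absurd hxy (hlt x hx y hy h).ne
    · exact h
    · exact absurd hxy (hlt y hy x hx h).ne'
  · intro k i m r hk hm
    have hkc : H.CompletedScan k := ⟨⟨i, hk⟩, m, r, hm⟩
    obtain ⟨s, hr, hs⟩ := hB.snap k i m r hk hm
    refine ⟨s, hr, fun j => ?_⟩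
    rcases hs j with ⟨u, hu, v, huo, hsv, hmax⟩ | ⟨hno, hsv⟩
    · have huS : u ∈ H.linearized B := .inr ⟨k, hkc, hu⟩
      refine .inl ⟨u, huS, v, huo, (hscan huo huS hkc).2 hu, hsv, fun u' hu' w hu'o hpos => ?_⟩
      rcases (hmax u' ((hscan hu'o hu' hkc).1 hpos) w hu'o).eq_or_lt with rfl | h
      · exact le_rfl
      · exact (hlt u' hu' u huS (hB.linLT_of_precedes hu' huS
          (hB.sequential u' u j _ _ hu'o huo h))).le
    · exact .inr ⟨fun u hu v huo hpos => hno u ((hscan huo hu hkc).1 hpos) v huo, hsv⟩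

end ViewAssignment

end History

end Snapshot

namespace ACASO

open Snapshot

namespace Execution

variable {n f : ℕ} {α : Type*} {v₀ : Fin n → α} (E : Execution n f v₀)

/-! ### Linearizability -/

theorem history_eq_invoke {t : ℕ} {i : Fin n} {o : Op α} :
    E.history t = .invoke i o ↔ E.action t = .invoke i o := by
  unfold history
  cases E.action t <;> simp

theorem history_eq_respond {t : ℕ} {i : Fin n} {r : Resp n α} :
    E.history t = .respond i r ↔ E.action t = .respond i r := by
  unfold history
  cases E.action t <;> simp

theorem respond_spec {t : ℕ} {i : Fin n} {r : Resp n α} (h : E.action t = .respond i r) :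
    E.Alive t i ∧ CanRespond v₀ (E.loc t i) r := by
  rcases E.pc_step t i with ⟨_, h1, h2⟩ | ⟨hi, o', ha, h3, h1⟩ | ⟨hi, r', hr, hcr, h1⟩ |
    ⟨hal, h1, h2, cmds, hc, hs⟩
  · exact absurd h (h2 r)
  · rw [h] at ha; cases ha
  · rw [h] at hr; cases hr; exact ⟨hi, hcr⟩
  · exact absurd h (h2 r)

/-- An operation is pending until there is a response. -/
theorem pending {k t : ℕ} {i : Fin n} {o : Op α} (hk : E.action k = .invoke i o) (hkt : k < t)
    (hr : ∀ m, k < m → m < t → ∀ r, E.action m ≠ .respond i r) :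
    E.cur i t = k ∧ (E.loc t i).pc.op = some o := by
  induction t, hkt using Nat.le_induction with
  | base => exact ⟨E.cur_succ_of_invoke hk, by rw [(E.invoke_spec hk).2.2]; rfl⟩
  | succ t hkt ih =>
    obtain ⟨h3, h4⟩ := ih fun m h1 h2 => hr m h1 (h2.trans t.lt_succ_self)
    rcases E.pc_step t i with ⟨h, h1, h2⟩ | ⟨hi, o', ha, h, h1⟩ | ⟨hi, r', ha, -⟩ |
      ⟨hal, h1, h2, cmds, hc, hs⟩
    · exact ⟨(E.cur_succ h1).trans h3, h ▸ h4⟩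
    · simp [h, PC.op] at h4
    · exact absurd ha (hr t hkt t.lt_succ_self r')
    · refine ⟨(E.cur_succ h1).trans h3, ?_⟩
      rw [← h4]
      clear hs
      generalize E.loc (t + 1) i = s' at *
      cases hc <;> simp_all [PC.op]

theorem completesAt_spec {k m : ℕ} {i : Fin n} {o : Op α} {r : Resp n α}
    (hk : E.history.IsOp k i o) (hm : E.history.CompletesAt k m r) :
    E.Alive m i ∧ E.cur i m = k ∧ k < m ∧ CanRespond v₀ (E.loc m i) r ∧
      ∃ S, (E.loc m i).pc = .renewed o S := by
  obtain ⟨i', o', hk', hkm, hr, hfirst⟩ := hm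
  obtain ⟨rfl, rfl⟩ : i = i' ∧ o = o' := by
    rw [History.IsOp] at hk hk'
    rw [hk] at hk'
    cases hk'
    exact ⟨rfl, rfl⟩
  obtain ⟨h1, h2⟩ := E.pending (E.history_eq_invoke.1 hk) hkm
    fun m' h h' r' hr' => hfirst m' h h' r' (E.history_eq_respond.2 hr')
  obtain ⟨h3, h4⟩ := E.respond_spec (E.history_eq_respond.1 hr)
  obtain ⟨o', S, h5⟩ := h4.pc_eq
  refine ⟨h3, h1, hkm, h4, S, ?_⟩
  rw [h5] at h2 ⊢
  cases h2
  rfl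

theorem completes_of_respond {k t : ℕ} {i : Fin n} {o : Op α} {r : Resp n α}
    (hk : E.history.IsOp k i o) (hkt : k < t) (ht : E.action t = .respond i r) :
    ∃ m ≤ t, ∃ r, E.history.CompletesAt k m r := by
  classical
  have hex : ∃ m, k < m ∧ ∃ r, E.action m = .respond i r := ⟨t, hkt, r, ht⟩
  obtain ⟨h1, r', h2⟩ := Nat.find_spec hex
  refine ⟨Nat.find hex, Nat.find_min' hex ⟨hkt, r, ht⟩, r', i, o, hk, h1,
    E.history_eq_respond.2 h2, fun m' h h' r'' hr => ?_⟩
  exact Nat.find_min hex h' ⟨h, r'', E.history_eq_respond.1 hr⟩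

theorem precedes_of_lt {k k' : ℕ} {i : Fin n} {o o' : Op α} (hk : E.history.IsOp k i o)
    (hk' : E.history.IsOp k' i o') (hlt : k < k') : E.history.Precedes k k' := by
  have hk'' := E.history_eq_invoke.1 hk'
  by_cases h : ∃ m, k < m ∧ m < k' ∧ ∃ r, E.action m = .respond i r
  · obtain ⟨m, h1, h2, r, h3⟩ := h
    obtain ⟨m', h4, r', h5⟩ := E.completes_of_respond hk h1 h3
    exact ⟨m', r', h5, h4.trans_lt h2⟩
  · have := (E.pending (E.history_eq_invoke.1 hk) hlt fun m h1 h2 r h3 => h ⟨m, h1, h2, r, h3⟩).2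
    simp [(E.invoke_spec hk'').2.1, PC.op] at this

/-- The view on which the response of the scan invoked at time `k` is based. -/
def scanView (k : ℕ) : Set (TVal n α) :=
  {x | ∃ i m r S, E.history.IsOp k i .scan ∧ E.history.CompletesAt k m r ∧
    (E.loc m i).pc = .renewed .scan S ∧ x ∈ S}

/-- The updates that the scan invoked at time `k` sees. -/
def seen (k : ℕ) : Set ℕ := {u | ∃ x ∈ E.scanView k, ∃ T i, E.Chose T i u x}

theorem completesAt_unique {H : History n α} {k m m' : ℕ} {r r' : Resp n α}
    (h : H.CompletesAt k m r) (h' : H.CompletesAt k m' r') : m = m' := by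
  obtain ⟨i, o, hk, hkm, hr, hf⟩ := h
  obtain ⟨i', o', hk', hkm', hr', hf'⟩ := h'
  obtain ⟨rfl, rfl⟩ : i = i' ∧ o = o' := by
    rw [History.IsOp] at hk hk'
    rw [hk] at hk'
    cases hk'
    exact ⟨rfl, rfl⟩
  by_contra hne
  rcases lt_or_gt_of_ne hne with h | h
  · exact hf' m hkm h r hr
  · exact hf m' hkm' h r' hr'

theorem scanView_eq {k m : ℕ} {i : Fin n} {r : Resp n α} {S : Set (TVal n α)}
    (hk : E.history.IsOp k i .scan) (hm : E.history.CompletesAt k m r)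
    (hS : (E.loc m i).pc = .renewed .scan S) : E.scanView k = S := by
  ext x
  constructor
  · rintro ⟨i', m', r', S', hk', hm', hS', hx⟩
    obtain rfl := completesAt_unique hm hm'
    obtain rfl : i = i' := by
      rw [History.IsOp] at hk hk'
      rw [hk] at hk'
      cases hk'
      rfl
    rw [hS] at hS'
    cases hS'
    exact hx
  · exact fun hx => ⟨i, m, r, S, hk, hm, hS, hx⟩

theorem scanView_spec (hf : 2 * f < n) {k m : ℕ} {i : Fin n} {r : Resp n α}
    (hk : E.history.IsOp k i .scan) (hm : E.history.CompletesAt k m r) :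
    E.Captures m k (E.scanView k) := by
  obtain ⟨ha, hc, -, -, S, hS⟩ := E.completesAt_spec hk hm
  have := E.renewalStage hf ha
  rw [hS, hc] at this
  rwa [E.scanView_eq hk hm hS]

/-- A completed update has stored its value. -/
theorem required_of_precedes {u k : ℕ} {j : Fin n} {v : α} (hu : E.history.IsOp u j (.update v))
    (h : E.history.Precedes u k) : ∃ x T, E.Chose T j u x ∧ E.Required k x := by
  obtain ⟨m, r, hm, hmk⟩ := h
  obtain ⟨ha, hc, -, -, S, hS⟩ := E.completesAt_spec hu hm
  obtain ⟨x, hx, -⟩ := E.exists_chose (v := v) (t := m) (i := j) (by rw [hS]; trivial)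
    (by rw [hS]; rfl)
  have h := E.ownStage ha hx
  rw [hS] at h
  exact ⟨x, m, hc ▸ hx, h.1.mono hmk.le, h.2.mono hmk.le le_rfl⟩

-- The equivalence quorum stores the values of a view and `writeTag` stores their tags, so a scan
-- begun later must return them, even if their updates never complete.
variable {E} in
theorem GoodAt.required {t₀ g k : ℕ} {j : Fin n} (h : E.GoodAt t₀ j g) (hk : t₀ ≤ k)
    {x : TVal n α} (hx : x ∈ E.view t₀ j g) : E.Required k x := by
  refine ⟨ValueStored.mono ?_ hk, h.tagStored.mono hk hx.2⟩
  refine (h.valueKnown hx).imp fun y hy => ?_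
  by_cases hyj : y = j
  · subst hyj
    exact ⟨y, E.sent_of_mem_V h.1 hy y⟩
  · exact ⟨j, E.rcvd_subset_sent _ _ _ (E.rcvd_of_mem_V hyj hy)⟩

/-- A value in a view was chosen beforehand by some update of its writer; injectivity of tags
identifies that update with `u`. -/
theorem lt_of_mem_view (hf : 2 * f < n) {t₀ g T u : ℕ} {i j : Fin n} {x : TVal n α}
    (hx : x ∈ E.view t₀ j g) (hu : E.Chose T i u x) : u < t₀ := by
  obtain ⟨u', hu'⟩ := E.chose_of_mem_V hx.1
  rw [hu.writer] at hu'
  obtain rfl := (E.chose_injective hf hu hu' rfl).1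
  exact hu'.lt

/-- A view that contains the value of an update contains the values stored when this update was
invoked. -/
theorem mem_view_of_required (hf : 2 * f < n) {t₀ g T u : ℕ} {i j : Fin n} {x x' : TVal n α}
    (hG : E.GoodAt t₀ j g) (hx' : x' ∈ E.view t₀ j g) (hu : E.Chose T i u x')
    (hx : E.Required u x) : x ∈ E.view t₀ j g := by
  refine ⟨?_, (hx.2.lt_tag hf hu).le.trans hx'.2⟩
  have hut := E.lt_of_mem_view hf hx' hu
  obtain ⟨y, hy, l, hl⟩ := (hG.valueKnown hx').inter hf hx.1
  obtain ⟨ha, ⟨o, ph, hpc⟩, -⟩ := hG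
  by_cases hyj : y = j
  · subst hyj
    exact E.mem_V_of_latWait hf ha hpc (E.sent_mono hut.le _ _ hl)
  · have hr := E.rcvd_of_mem_V hyj hy
    -- The value `x'` does not exist yet when its update is invoked, so the common node `y` sends it
    -- after `x`.
    have hn : ∀ k, Msg.value x' ∉ E.Sent u y k := by
      intro k hk
      obtain ⟨u', hu'⟩ := E.chose_of_sent hk
      rw [hu.writer] at hu'
      obtain rfl := (E.chose_injective hf hu hu' rfl).1
      exact lt_irrefl _ hu'.lt
    obtain ⟨s, hs, -, hs1, hs2⟩ := exists_first (P := fun s => Msg.value x' ∈ E.Sent s y j)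
      (hn j) hut.le (E.rcvd_subset_sent _ _ _ hr)
    exact E.mem_V_self_of_rcvd (E.rcvd_of_sent_of_not_sent
      (E.sent_value_all ((E.value_new hs2 hs1).1.of_le hs) hl j) (hn j) hr)

theorem viewAssignment (hf : 2 * f < n) : E.history.ViewAssignment v₀ E.seen where
  isUpdate := by
    rintro k - u ⟨x, -, T, i, hu⟩
    exact ⟨i, x.val, E.history_eq_invoke.2 hu.isOp⟩
  lt_of_mem := by
    rintro k m r ⟨⟨i, hk⟩, -⟩ hm u ⟨x, hx, T, j, hu⟩
    obtain ⟨t₀, ht₀, j', g, hG, hS, -⟩ := E.scanView_spec hf hk hm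
    exact (E.lt_of_mem_view hf (hS ▸ hx) hu).trans ht₀
  total := by
    rintro k k' ⟨⟨i, hk⟩, m, r, hm⟩ ⟨⟨i', hk'⟩, m', r', hm'⟩
    obtain ⟨t₀, -, j, g, hG, hS, -⟩ := E.scanView_spec hf hk hm
    obtain ⟨t₀', -, j', g', hG', hS', -⟩ := E.scanView_spec hf hk' hm'
    refine (hG.view_total hf hG').imp ?_ ?_ <;> rw [← hS, ← hS'] <;>
      exact fun h u ⟨x, hx, hu⟩ => ⟨x, h hx, hu⟩
  mem_of_precedes := by
    rintro u j v k hu ⟨⟨i, hk⟩, m, r, hm⟩ h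
    obtain ⟨x, T, hx, hreq⟩ := E.required_of_precedes hu h
    obtain ⟨-, -, -, -, -, -, hcap⟩ := E.scanView_spec hf hk hm
    exact ⟨x, hcap x hreq, T, j, hx⟩
  mono := by
    rintro k k' ⟨⟨i, hk⟩, -⟩ ⟨⟨i', hk'⟩, m', r', hm'⟩ ⟨m, r, hm, hmk'⟩ u ⟨x, hx, hu⟩
    obtain ⟨t₀, ht₀, j, g, hG, hS, -⟩ := E.scanView_spec hf hk hm
    obtain ⟨-, -, -, -, -, -, hcap⟩ := E.scanView_spec hf hk' hm'
    exact ⟨x, hcap x (hG.required (ht₀.trans hmk').le (hS ▸ hx)), hu⟩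
  downward := by
    rintro u j v u' j' v' k hu hu' h ⟨⟨i, hk⟩, m, r, hm⟩ ⟨x', hx', T', i', hc'⟩
    obtain ⟨x, T, hx, hreq⟩ := E.required_of_precedes hu h
    obtain ⟨t₀, ht₀, l, g, hG, hS, -⟩ := E.scanView_spec hf hk hm
    rw [hS] at hx'
    exact ⟨x, hS ▸ E.mem_view_of_required hf hG hx' hc' hreq, T, j, hx⟩
  sequential k k' i o o' hk hk' hlt := E.precedes_of_lt hk hk' hlt
  ack := by
    intro k i v m r hk hm
    obtain ⟨-, -, -, hr, S, hS⟩ := E.completesAt_spec hk hm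
    cases hr with
    | update => rfl
    | scan _ _ h => rw [hS] at h; cases h
  snap := by
    intro k i m r hk hm
    obtain ⟨-, -, -, hr, S, hS⟩ := E.completesAt_spec hk hm
    cases hr with
    | update _ _ h => rw [hS] at h; cases h
    | scan S' s h hs =>
      refine ⟨s, rfl, fun j => ?_⟩
      rw [← E.scanView_eq hk hm h] at hs
      obtain ⟨t₀, ht₀, l, g, hG, hV, -⟩ := E.scanView_spec hf hk hm
      rcases hs j with ⟨x, hx, rfl, hmax, hsj⟩ | ⟨hno, hsj⟩
      · have hx' := hx
        rw [hV] at hx'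
        obtain ⟨u, hu⟩ := E.chose_of_mem_V hx'.1
        refine .inl ⟨u, ⟨x, hx, t₀, _, hu⟩, x.val, E.history_eq_invoke.2 hu.isOp, hsj, ?_⟩
        rintro u' ⟨x', hx', T', i', hu'⟩ w hw
        obtain rfl : i' = x.writer := by
          have h1 := hu'.isOp
          rw [E.history_eq_invoke.1 hw] at h1
          cases h1
          rfl
        by_contra! hlt
        exact absurd (hmax x' hx' hu'.writer) (not_le.2 (E.tag_lt_tag hf hu hu' hlt))
      · refine .inr ⟨?_, hsj⟩
        rintro u ⟨x, hx, T, i', hu⟩ w hw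
        have h1 := hu.isOp
        rw [E.history_eq_invoke.1 hw] at h1
        cases h1
        exact hno x hx hu.writer

end Execution

/-! ### Ranks of control states and existence of scan results -/

open Filter

section

variable {n f : ℕ} {α : Type*} {v₀ : Fin n → α}

/-- An upper bound on the number of steps that remain for an operation. -/
def PC.rank : PC n α → ℕ
  | .idle => 0
  | .renewed _ _ => 1
  | .borrow _ _ => 2
  | .latDone _ ph _ _ => 4 * (3 - ph) + 3
  | .latWait _ ph _ => 4 * (3 - ph) + 4
  | .latWrite _ ph _ _ => 4 * (3 - ph) + 5
  | .latStart _ ph _ => 4 * (3 - ph) + 6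
  | .sendValue _ _ => 20
  | .readWait _ _ => 21
  | .readStart _ => 22

/-- Each phase takes four control states, so going from `latDone` to `latStart` of the next phase
lowers 4(3 - ph) + 3 to 4(3 - ph) + 2. -/
theorem ClientStep.rank_lt {i : Fin n} {s s' : Local n α} {cmds : List (Cmd n α)}
    (h : ClientStep f i s s' cmds) : s'.pc.rank < s.pc.rank ∧ s'.pc ≠ .idle := by
  cases h <;> simp [PC.rank, *]
  omega

/-- The phase of the current `Lattice` call is at most `3`. -/
def PC.PhaseLE : PC n α → Prop
  | .latDone _ ph _ _ | .latWait _ ph _ | .latWrite _ ph _ _ | .latStart _ ph _ => ph ≤ 3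
  | _ => True

/-- The bound on the tags provides a largest one for each writer; finiteness of `S` is not required.
-/
theorem exists_extract {S : Set (TVal n α)} {g : ℕ} (hS : ∀ u ∈ S, u.tag ≤ g) (v₀ : Fin n → α) :
    ∃ s, Extract v₀ S s := by
  suffices ∀ j, ∃ a, (∃ u ∈ S, u.writer = j ∧ (∀ w ∈ S, w.writer = j → w.tag ≤ u.tag) ∧
      a = u.val) ∨ ((∀ u ∈ S, u.writer ≠ j) ∧ a = v₀ j) by
    choose s hs using this
    exact ⟨s, hs⟩
  intro j
  by_cases h : ∃ u ∈ S, u.writer = j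
  · obtain ⟨u, hu, hj⟩ := h
    have hne : {t | ∃ u ∈ S, u.writer = j ∧ u.tag = t}.Nonempty := ⟨u.tag, u, hu, hj, rfl⟩
    have hbdd : BddAbove {t | ∃ u ∈ S, u.writer = j ∧ u.tag = t} :=
      ⟨g, by rintro _ ⟨u, hu, -, rfl⟩; exact hS u hu⟩
    obtain ⟨w, hw, hwj, hwt⟩ := Nat.sSup_mem hne hbdd
    exact ⟨w.val, .inl ⟨w, hw, hwj, fun z hz hzj => hwt ▸ le_csSup hbdd ⟨z, hz, hzj, rfl⟩, rfl⟩⟩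
  · push Not at h
    exact ⟨v₀ j, .inr ⟨h, rfl⟩⟩

end

namespace Execution

variable {n f : ℕ} {α : Type*} {v₀ : Fin n → α} (E : Execution n f v₀)

/-! ### Termination -/

theorem alive_of_not_faulty {i : Fin n} (hi : i ∉ E.faulty) (t : ℕ) : E.Alive t i :=
  fun h => hi ⟨t, h⟩

theorem quorum_not_faulty (h : E.faulty.ncard ≤ f) : Quorum f fun y => y ∉ E.faulty := by
  classical
  refine ⟨Finset.univ.filter fun y => y ∉ E.faulty, ?_, by simp⟩
  have h1 : E.faulty.ncard = (Finset.univ.filter fun y => y ∈ E.faulty).card := by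
    rw [← Set.ncard_coe_finset]
    congr 1
    ext y
    simp
  have h2 := Finset.card_filter_add_card_filter_not (s := (Finset.univ : Finset (Fin n)))
    (fun y => y ∈ E.faulty)
  rw [Finset.card_univ, Fintype.card_fin] at h2
  omega

theorem eventually_rcvd (hE : E.Fair) {t : ℕ} {j i : Fin n} (hi : i ∉ E.faulty) {m : Msg n α}
    (hm : m ∈ E.Sent t j i) : ∀ᶠ t' in atTop, m ∈ (E.loc t' i).rcvd j := by
  suffices h : ∃ t', m ∈ (E.loc t' i).rcvd j by
    obtain ⟨t', h⟩ := h
    exact (eventually_ge_atTop t').mono fun s hs => E.rcvd_mono hs j i h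
  rcases hm with h | h
  · exact ⟨t, h⟩
  obtain ⟨l₁, l₂, hl⟩ := List.append_of_mem h
  clear h
  have hstep : ∀ {t : ℕ} {l₁ l₂ : List (Msg n α)}, (E.state t).chan j i = l₁ ++ m :: l₂ →
      m ∈ (E.loc (t + 1) i).rcvd j ∨ ∃ l₁' l₂', (E.state (t + 1)).chan j i = l₁' ++ m :: l₂' ∧
        l₁'.length ≤ l₁.length ∧ (E.action t = .deliver j i → l₁'.length < l₁.length) := by
    intro t l₁ l₂ hl
    obtain ⟨out, -, ⟨hc, -, ha⟩ | ⟨m', l, hc, hc', hr, -⟩⟩ := E.chan_step t j i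
    · exact .inr ⟨l₁, l₂ ++ out, by simp [hc, hl], le_rfl, fun h => absurd h ha⟩
    · rw [hl] at hc
      rcases l₁ with _ | ⟨b, l₁⟩
      · left
        rw [List.nil_append, List.cons.injEq] at hc
        rw [hr, hc.1]
        exact Set.mem_insert _ _
      · rw [List.cons_append, List.cons.injEq] at hc
        exact .inr ⟨l₁, l₂ ++ out, by simp [hc', ← hc.2], by simp, fun _ => by simp⟩
  have hkeep : ∀ {t t' : ℕ} {l₁ l₂ : List (Msg n α)}, t ≤ t' →
      (E.state t).chan j i = l₁ ++ m :: l₂ → m ∈ (E.loc t' i).rcvd j ∨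
        ∃ l₁' l₂', (E.state t').chan j i = l₁' ++ m :: l₂' ∧ l₁'.length ≤ l₁.length := by
    intro t t' l₁ l₂ htt hl
    induction t', htt using Nat.le_induction with
    | base => exact .inr ⟨l₁, l₂, hl, le_rfl⟩
    | succ t' _ ih =>
      rcases ih with h | ⟨l₁', l₂', h, hle⟩
      · exact .inl (E.rcvd_mono t'.le_succ j i h)
      · exact (hstep h).imp id fun ⟨a, b, h1, h2, _⟩ => ⟨a, b, h1, h2.trans hle⟩
  -- Induction on the number of messages ahead of `m`: fairness yields a delivery, which shortens
  -- the queue in front or delivers `m`.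
  induction hlen : l₁.length using Nat.strong_induction_on generalizing t l₁ l₂ with
  | _ N ih =>
    obtain ⟨t', ht', ha⟩ := hE.channels j i t hi (by rw [hl]; simp)
    rcases hkeep ht' hl with h | ⟨l₁', l₂', h, hle⟩
    · exact ⟨t', h⟩
    · rcases hstep h with h | ⟨a, b, h1, -, h2⟩
      · exact ⟨_, h⟩
      · exact ih a.length (by have := h2 ha; omega) a b h1 rfl

theorem readAck_sent {t q : ℕ} {i y : Fin n} (hy : E.Alive t y)
    (h : Msg.readTag q ∈ (E.loc t y).rcvd i) : ∃ g, Msg.readAck q g ∈ E.Sent t y i := by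
  induction t with
  | zero => simp [loc, E.start, Config.initial] at h
  | succ t ih =>
    by_cases h' : Msg.readTag q ∈ (E.loc t y).rcvd i
    · exact (ih hy.of_succ h').imp fun g hg => E.sent_mono t.le_succ _ _ hg
    obtain ⟨cmds, cmds', he, hS, ⟨-, hl⟩ | ⟨-, hd | ⟨k, m, -, hl, -, rfl⟩⟩⟩ := E.sends t y
    · rw [hl] at h; exact absurd h h'
    · rw [hd.unchanged.2.2.2.1] at h; exact absurd h h'
    · obtain rfl := he.eq (not_not.2 hy)
      rw [hl, handle_rcvd] at h
      by_cases hik : i = k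
      · subst hik
        rw [Function.update_self] at h
        rcases h with rfl | h
        · exact ⟨_, (hS _ _).2 (.inr (by simp [mem_outbox, handle, Cmd.to]; rfl))⟩
        · exact absurd h h'
      · rw [Function.update_of_ne hik] at h; exact absurd h h'

theorem writeAck_sent {t q g : ℕ} {i y : Fin n} (hy : E.Alive t y)
    (h : Msg.writeTag q g ∈ (E.loc t y).rcvd i) : Msg.writeAck q g ∈ E.Sent t y i := by
  induction t with
  | zero => simp [loc, E.start, Config.initial] at h
  | succ t ih =>
    by_cases h' : Msg.writeTag q g ∈ (E.loc t y).rcvd i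
    · exact E.sent_mono t.le_succ _ _ (ih hy.of_succ h')
    obtain ⟨cmds, cmds', he, hS, ⟨-, hl⟩ | ⟨-, hd | ⟨k, m, -, hl, -, rfl⟩⟩⟩ := E.sends t y
    · rw [hl] at h; exact absurd h h'
    · rw [hd.unchanged.2.2.2.1] at h; exact absurd h h'
    · obtain rfl := he.eq (not_not.2 hy)
      rw [hl, handle_rcvd] at h
      by_cases hik : i = k
      · subst hik
        rw [Function.update_self] at h
        rcases h with rfl | h
        · exact (hS _ _).2 (.inr (by simp [mem_outbox, handle, Cmd.to, Cmd.toAll]))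
        · exact absurd h h'
      · rw [Function.update_of_ne hik] at h; exact absurd h h'

/-- The messages that the client thread has sent to all nodes to reach its control state. -/
def Announced (t : ℕ) (i y : Fin n) : PC n α → Prop
  | .readWait _ q => Msg.readTag q ∈ E.Sent t i y
  | .latWrite _ _ r q => Msg.writeTag q r ∈ E.Sent t i y
  | .latDone _ _ r (some _) => Msg.goodLA r ∈ E.Sent t i y
  | _ => True

theorem announced {t : ℕ} {i : Fin n} (hi : E.Alive t i) (y : Fin n) :
    E.Announced t i y (E.loc t i).pc := by
  induction t with
  | zero => simp [loc, E.start, Config.initial, Announced]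
  | succ t ih =>
    rcases E.pc_step t i with ⟨hpc, h1, h2⟩ | ⟨-, o', ha, -, hpc⟩ | ⟨-, r, hr, hcr, hpc⟩ |
      ⟨hal, h1, h2, cmds, hc, hs⟩
    · rw [hpc]
      have hmono := E.sent_mono t.le_succ i y
      have ih := ih hi.of_succ
      revert ih
      rcases (E.loc t i).pc with _ | _ | _ | _ | _ | _ | _ | ⟨_, _, _, _ | _⟩ | _ | _ <;>
        first | exact fun h => hmono h | exact id
    · rw [hpc]; trivial
    · rw [hpc]; trivial
    · have hs := hs hi
      generalize E.loc (t + 1) i = s' at *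
      cases hc <;>
        first | trivial | exact hs _ (List.mem_singleton_self _) y

theorem phaseLE (t : ℕ) (i : Fin n) : (E.loc t i).pc.PhaseLE := by
  induction t with
  | zero => simp [loc, E.start, Config.initial, PC.PhaseLE]
  | succ t ih =>
    rcases E.pc_step t i with ⟨hpc, h1, h2⟩ | ⟨-, o', ha, -, hpc⟩ | ⟨-, r, hr, hcr, hpc⟩ |
      ⟨hal, h1, h2, cmds, hc, hs⟩
    · rwa [hpc]
    · rw [hpc]; trivial
    · rw [hpc]; trivial
    · clear hs
      generalize E.loc (t + 1) i = s' at *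
      cases hc <;> simp_all [PC.PhaseLE]

theorem lt_maxTag_of_borrow {t r : ℕ} {i : Fin n} {o : Op α}
    (h : (E.loc t i).pc = .borrow o r) : r < (E.loc t i).maxTag := by
  induction t with
  | zero => simp [loc, E.start, Config.initial] at h
  | succ t ih =>
    refine lt_of_lt_of_le ?_ (E.maxTag_mono t.le_succ i)
    rcases E.pc_step t i with ⟨hpc, -⟩ | ⟨-, o', ha, -, hpc⟩ | ⟨-, r, -, -, hpc⟩ |
      ⟨-, -, -, cmds, hc, -⟩
    · exact ih (hpc ▸ h)
    · simp [hpc] at h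
    · simp [hpc] at h
    · generalize E.loc (t + 1) i = s' at *
      cases hc <;> simp at h
      next hpc =>
      obtain ⟨rfl, rfl⟩ := h
      exact E.lt_maxTag_of_failed hpc

/-- A tag larger than `T` occurs somewhere in the system at time `t`. -/
def TagSeen (t T : ℕ) : Prop := ∃ g, T < g ∧ ((∃ y, g = (E.loc t y).maxTag) ∨
  (∃ j i, (∃ q, Msg.writeTag q g ∈ E.Sent t j i) ∨ Msg.echoTag g ∈ E.Sent t j i ∨
    ∃ q, Msg.readAck q g ∈ E.Sent t j i) ∨ ∃ y, (E.loc t y).pc.tag = some g)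

theorem tag_message_new {t g : ℕ} {j i : Fin n} {m : Msg n α}
    (hm : m = .echoTag g ∨ ∃ q, m = .writeTag q g) (h : m ∈ E.Sent (t + 1) j i)
    (h' : m ∉ E.Sent t j i) :
    (E.loc t j).pc.tag = some g ∨ ∃ k q, Msg.writeTag q g ∈ E.Sent t k j := by
  obtain ⟨cmds, cmds', he, hS, hd⟩ := E.sends t j
  rw [hS] at h
  have h := he.mem_outbox (h.resolve_left h')
  rw [mem_outbox] at h
  obtain ⟨c, hc, hi, hcu⟩ := h
  rcases hd with ⟨rfl, -⟩ | ⟨ha, hd | ⟨l, m', hm', hl, -, rfl⟩⟩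
  · simp at hc
  · left
    generalize E.loc (t + 1) j = s' at *
    cases hd.client_of_mem hc <;> simp [Cmd.toAll] at hc <;> subst hc <;> subst hcu <;>
      simp at hm
    simp [PC.tag, *]
  · right
    cases m' with
    | value w =>
      by_cases hw : w ∈ (E.loc t j).V j <;> simp [handle, hw] at hc
      subst hc
      simp [← hcu, Cmd.toAll] at hm
    | writeTag q' g' =>
      simp only [handle, List.mem_cons, List.not_mem_nil, or_false] at hc
      rcases hc with rfl | rfl <;> simp [← hcu, Cmd.toAll, Cmd.to] at hm
      subst hm
      exact ⟨l, q', .inr hm'⟩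
    | _ => simp [handle] at hc <;> grind [Cmd.toAll, Cmd.to]

/-- Tags are otherwise only copied, so the first tag above `T` arises as r + 1 with r = `T` after
phase 0 of an update. That phase did not fail, since failure would mean that a larger tag was
already known. So it succeeded and announced `goodLA T` to all. -/
theorem goodLA_of_tagSeen {t T : ℕ} (h : E.TagSeen t T) :
    ∃ x, ∀ y, Msg.goodLA T ∈ E.Sent t x y := by
  induction t with
  | zero =>
    obtain ⟨g, hT, ⟨y, rfl⟩ | ⟨j, i, h⟩ | ⟨y, h⟩⟩ := h
    · simp [loc, E.start, Config.initial] at hT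
    · simp [sent_zero] at h
    · simp [loc, E.start, Config.initial, PC.tag] at h
  | succ t ih =>
    suffices h : E.TagSeen t T ∨ ∃ x, ∀ y, Msg.goodLA T ∈ E.Sent t x y by
      obtain ⟨x, hx⟩ := h.elim ih id
      exact ⟨x, fun y => E.sent_mono t.le_succ _ _ (hx y)⟩
    have hmt : ∀ {y}, T < (E.loc t y).maxTag → E.TagSeen t T :=
      fun {y} h => ⟨_, h, .inl ⟨y, rfl⟩⟩
    obtain ⟨g, hT, ⟨y, rfl⟩ | ⟨j, i, h⟩ | ⟨y, h⟩⟩ := h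
    · left
      rcases E.loc_step t y with ⟨h, -⟩ | ⟨-, _, h, -⟩ | ⟨-, j, m, l, -, -, hc, h⟩
      · exact hmt (h ▸ hT)
      · exact hmt (h.unchanged.2.2.1 ▸ hT)
      · by_cases hT' : T < (E.loc t y).maxTag
        · exact hmt hT'
        · rw [h] at hT
          cases m with
          | writeTag q g =>
            exact ⟨g, by simpa [handle, hT'] using hT, .inr (.inl ⟨j, y, .inl ⟨q, .inr (by simp [hc])⟩⟩)⟩
          | echoTag g =>
            exact ⟨g, by simpa [handle, hT'] using hT, .inr (.inl ⟨j, y, .inr (.inl (.inr (by simp [hc])))⟩)⟩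
          | _ => exact absurd hT hT'
    · left
      have key : ∀ m : Msg n α, (m = .echoTag g ∨ ∃ q, m = .writeTag q g) →
          m ∈ E.Sent (t + 1) j i → E.TagSeen t T := by
        intro m hm h
        refine ⟨g, hT, .inr ?_⟩
        by_cases h' : m ∈ E.Sent t j i
        · left
          rcases hm with rfl | ⟨q, rfl⟩
          · exact ⟨j, i, .inr (.inl h')⟩
          · exact ⟨j, i, .inl ⟨q, h'⟩⟩
        · rcases E.tag_message_new hm h h' with h | ⟨k, q, h⟩
          · exact .inr ⟨j, h⟩
          · exact .inl ⟨k, j, .inl ⟨q, h⟩⟩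
      rcases h with ⟨q, h⟩ | h | ⟨q, h⟩
      · exact key _ (.inr ⟨q, rfl⟩) h
      · exact key _ (.inl rfl) h
      · by_cases h' : Msg.readAck q g ∈ E.Sent t j i
        · exact ⟨g, hT, .inr (.inl ⟨j, i, .inr (.inr ⟨q, h'⟩)⟩)⟩
        · exact ⟨g, hT, .inl ⟨j, (E.readAck_new h h').2.2⟩⟩
    · have hpt : ∀ {g'}, T < g' → (E.loc t y).pc.tag = some g' → E.TagSeen t T :=
        fun h h' => ⟨_, h, .inr (.inr ⟨y, h'⟩)⟩
      rcases E.pc_step t y with ⟨hpc, -⟩ | ⟨-, o', -, -, hpc⟩ | ⟨-, r, -, -, hpc⟩ |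
        ⟨hal, -, -, cmds, hc, -⟩
      · exact .inl (hpt hT (hpc ▸ h))
      · simp [hpc, PC.tag] at h
      · simp [hpc, PC.tag] at h
      · generalize E.loc (t + 1) y = s' at *
        cases hc <;> simp [PC.tag] at h
        case readUpdate v q r hpc hq hr =>
          obtain ⟨j, hj⟩ := hr.1
          exact .inl ⟨g, hT, .inr (.inl ⟨j, y, .inr (.inr ⟨q, .inl (h ▸ hj)⟩)⟩)⟩
        case readScan q r hpc hq hr =>
          obtain ⟨j, hj⟩ := hr.1
          exact .inl ⟨g, hT, .inr (.inl ⟨j, y, .inr (.inr ⟨q, .inl (h ▸ hj)⟩)⟩)⟩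
        case afterPhase0 o r res hpc =>
          by_cases h1 : T < (E.loc t y).maxTag
          · exact .inl (hmt h1)
          by_cases h2 : T < r
          · exact .inl (hpt h2 (by rw [hpc]; rfl))
          -- The maximum of r + 1 and `maxTag` exceeds `T` although neither r nor `maxTag` does.
          obtain rfl : T = r := by omega
          cases res with
          | none => exact absurd (E.lt_maxTag_of_failed hpc) h1
          | some S =>
            refine .inr ⟨y, fun z => ?_⟩
            have := E.announced hal z
            rwa [hpc] at this
        case nextPhase => exact .inl (hmt (h ▸ hT))
        all_goals exact .inl (hpt hT (by grind [PC.tag]))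

/-- Writer and tag determine a value, and there are finitely many writers and finitely many tags up
to `r`. -/
theorem finite_chose (hf : 2 * f < n) (r : ℕ) :
    {x : TVal n α | x.tag ≤ r ∧ ∃ T k, E.Chose T x.writer k x}.Finite := by
  refine Set.Finite.of_finite_image (f := fun x => (x.writer, x.tag))
    ((Set.toFinite ((Set.univ : Set (Fin n)) ×ˢ Set.Iic r)).subset ?_) ?_
  · rintro _ ⟨x, hx, rfl⟩
    exact ⟨trivial, hx.1⟩
  · rintro x ⟨-, T, k, hx⟩ x' ⟨-, T', k', hx'⟩ h
    simp only [Prod.mk.injEq] at h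
    rw [← h.1] at hx'
    exact (E.chose_injective hf hx hx' h.2).2

/-- The equivalence quorum is eventually reached. -/
theorem eventually_EQ (hE : E.Fair) (hf : 2 * f < n) (hc : E.faulty.ncard ≤ f) {i : Fin n}
    (hi : i ∉ E.faulty) (r : ℕ) :
    ∀ᶠ t in atTop, EQ f (fun k => leTag r ((E.loc t i).V k)) i := by
  -- These are all the values that matter to `EQ` at any time. Each is forwarded by `i` to every
  -- correct node and comes back from it; as `A` is finite, there is a common time after which this
  -- has happened.
  let A : Set (TVal n α) := {x | x.tag ≤ r ∧ ∃ t, x ∈ (E.loc t i).V i}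
  have hA : A.Finite := (E.finite_chose hf r).subset fun x ⟨hx, t, hxt⟩ =>
    ⟨hx, t, E.chose_of_mem_V hxt⟩
  have hall : ∀ᶠ t in atTop, ∀ x ∈ A, ∀ y, y ∉ E.faulty → x ∈ (E.loc t i).V y := by
    rw [eventually_all_finite hA]
    rintro x ⟨-, t, hx⟩
    rw [eventually_all]
    intro y
    by_cases hy : y ∈ E.faulty
    · exact .of_forall fun _ h => absurd hy h
    · obtain ⟨t', ht'⟩ := (E.eventually_rcvd hE hy
        (E.sent_of_mem_V (E.alive_of_not_faulty hi t) hx y)).exists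
      filter_upwards [E.eventually_rcvd hE hi (E.sent_of_mem_V (E.alive_of_not_faulty hy t')
        (E.mem_V_self_of_rcvd ht') i)] with s hs _
      exact E.mem_V_of_rcvd hs
  filter_upwards [hall] with t ht
  obtain ⟨Q, hQ, hQ'⟩ := E.quorum_not_faulty hc
  refine ⟨Q, hQ, fun y hy => Set.Subset.antisymm ?_ ?_⟩
  · exact fun x hx => ⟨E.V_subset_self t i y hx.1, hx.2⟩
  · exact fun x hx => ⟨ht x ⟨hx.2, t, hx.1⟩ y (hQ' y hy), hx.2⟩

/-- A client thread that stays in the same control state is eventually enabled. -/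
theorem eventually_enabled (hE : E.Fair) (hf : 2 * f < n) (hc : E.faulty.ncard ≤ f) {i : Fin n}
    (hi : i ∉ E.faulty) {p : PC n α} (hp : p ≠ .idle) {t₀ : ℕ}
    (hpc : ∀ t ≥ t₀, (E.loc t i).pc = p) :
    ∀ᶠ t in atTop, ClientEnabled f v₀ (E.state t) i := by
  have hge := (eventually_ge_atTop t₀).mono hpc
  have ha := E.alive_of_not_faulty hi
  have hpc₀ := hpc t₀ le_rfl
  obtain ⟨Q, hQ, hQ'⟩ := E.quorum_not_faulty hc
  rcases p with _ | o | ⟨o, q⟩ | ⟨v, r⟩ | ⟨o, ph, r⟩ | ⟨o, ph, r, q⟩ | ⟨o, ph, r⟩ |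
    ⟨o, ph, r, res⟩ | ⟨o, r⟩ | ⟨o, S⟩
  · exact absurd rfl hp
  · filter_upwards [hge] with t ht
    exact .inl ⟨_, _, .sendReadTag _ _ ht⟩
  · have hack : ∀ᶠ t in atTop, ∀ y, y ∉ E.faulty → ∃ g, Msg.readAck q g ∈ (E.loc t i).rcvd y := by
      rw [eventually_all]
      intro y
      by_cases hy : y ∈ E.faulty
      · exact .of_forall fun _ h => absurd hy h
      · have h1 := E.announced (ha t₀) y
        rw [hpc₀] at h1
        obtain ⟨s, hs⟩ := (E.eventually_rcvd hE hy h1).exists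
        obtain ⟨g, hg⟩ := E.readAck_sent (E.alive_of_not_faulty hy s) hs
        filter_upwards [E.eventually_rcvd hE hi hg] with t ht _
        exact ⟨g, ht⟩
    filter_upwards [hge, hack] with t ht hack
    have hq : Quorum f fun j => ∃ g, Msg.readAck q g ∈ (E.loc t i).rcvd j :=
      ⟨Q, hQ, fun y hy => hack y (hQ' y hy)⟩
    have hne : {g | ∃ j, Msg.readAck q g ∈ (E.loc t i).rcvd j}.Nonempty := by
      obtain ⟨y, g, hg⟩ := hq.exists hf
      exact ⟨g, y, hg⟩
    have hfin : {g | ∃ j, Msg.readAck q g ∈ (E.loc t i).rcvd j}.Finite := by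
      have : {g | ∃ j, Msg.readAck q g ∈ (E.loc t i).rcvd j} =
          ⋃ j, (Msg.readAck q) ⁻¹' (E.loc t i).rcvd j := by
        ext g
        simp
      rw [this]
      refine Set.finite_iUnion fun j => (E.finite_rcvd t j i).preimage ?_
      intro a _ b _ hab
      cases hab
      rfl
    obtain ⟨r, hr, hmax⟩ := hfin.exists_maximal hne
    have hgr : IsGreatest {g | ∃ j, Msg.readAck q g ∈ (E.loc t i).rcvd j} r :=
      ⟨hr, fun g hg => (le_total g r).elim id fun h => hmax hg h⟩
    cases o with
    | update v => exact .inl ⟨_, _, .readUpdate _ v q r ht hq hgr⟩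
    | scan => exact .inl ⟨_, _, .readScan _ q r ht hq hgr⟩
  · filter_upwards [hge] with t ht
    exact .inl ⟨_, _, .sendValue _ _ _ ht⟩
  · filter_upwards [hge] with t ht
    exact .inl ⟨_, _, .sendWriteTag _ _ _ _ ht⟩
  · have hack : ∀ᶠ t in atTop, ∀ y, y ∉ E.faulty → Msg.writeAck q r ∈ (E.loc t i).rcvd y := by
      rw [eventually_all]
      intro y
      by_cases hy : y ∈ E.faulty
      · exact .of_forall fun _ h => absurd hy h
      · have h1 := E.announced (ha t₀) y
        rw [hpc₀] at h1
        obtain ⟨s, hs⟩ := (E.eventually_rcvd hE hy h1).exists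
        filter_upwards [E.eventually_rcvd hE hi
          (E.writeAck_sent (E.alive_of_not_faulty hy s) hs)] with t ht _
        exact ht
    filter_upwards [hge, hack] with t ht hack
    exact .inl ⟨_, _, .writeDone _ _ _ _ _ ht ⟨Q, hQ, fun y hy => hack y (hQ' y hy)⟩⟩
  · filter_upwards [hge, E.eventually_EQ hE hf hc hi r] with t ht hEQ
    rcases le_or_gt (E.loc t i).maxTag r with h | h
    · exact .inl ⟨_, _, .good _ _ _ _ ht hEQ h⟩
    · exact .inl ⟨_, _, .bad _ _ _ _ ht hEQ h⟩
  · have hph : ph ≤ 3 := by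
      have := E.phaseLE t₀ i
      rwa [hpc₀] at this
    filter_upwards [hge] with t ht
    rcases Nat.eq_zero_or_pos ph with rfl | hpos
    · exact .inl ⟨_, _, .afterPhase0 _ _ _ _ ht⟩
    cases res with
    | some S => exact .inl ⟨_, _, .direct _ _ _ _ _ hpos ht⟩
    | none =>
      rcases hph.eq_or_lt with rfl | hlt
      · exact .inl ⟨_, _, .exitLoop _ _ _ ht⟩
      · exact .inl ⟨_, _, .nextPhase _ _ _ _ hpos hlt ht⟩
  -- Borrowing follows a failure, so the node itself has seen a tag above `r`; hence `goodLA r` has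
  -- been sent to it.
  · obtain ⟨x, hx⟩ := E.goodLA_of_tagSeen ⟨_, E.lt_maxTag_of_borrow hpc₀, .inl ⟨i, rfl⟩⟩
    filter_upwards [hge, E.eventually_rcvd hE hi (hx i)] with t ht hr
    exact .inl ⟨_, _, .indirect _ _ _ x ht hr⟩
  · filter_upwards [hge] with t ht
    right
    cases o with
    | update v => exact ⟨_, .update _ v S ht⟩
    | scan =>
      have h := E.renewalStage hf (ha t)
      rw [ht] at h
      obtain ⟨t₁, -, j, g, -, hS, -⟩ := h
      obtain ⟨s, hs⟩ := exists_extract (S := S) (g := g) (fun u hu => (hS.subset hu).2) v₀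
      exact ⟨_, .scan _ _ s ht hs⟩

/-- The client thread of a correct node with a pending operation eventually takes a step. -/
theorem exists_client_step (hE : E.Fair) (hf : 2 * f < n) (hc : E.faulty.ncard ≤ f) {i : Fin n}
    (hi : i ∉ E.faulty) {t₀ : ℕ} (h0 : (E.loc t₀ i).pc ≠ .idle) :
    ∃ t ≥ t₀, (∃ r, E.action t = .respond i r) ∨ (E.loc t i).pc = (E.loc t₀ i).pc ∧
      ∃ cmds, ClientStep f i (E.loc t i) (E.loc (t + 1) i) cmds := by
  by_contra! h
  have hpc : ∀ t ≥ t₀, (E.loc t i).pc = (E.loc t₀ i).pc := by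
    intro t ht
    induction t, ht using Nat.le_induction with
    | base => rfl
    | succ t ht ih =>
      rcases E.pc_step t i with ⟨hpc, -⟩ | ⟨-, o', -, hpc, -⟩ | ⟨-, r, hr, -⟩ |
        ⟨-, -, -, cmds, hcs, -⟩
      · exact hpc.trans ih
      · exact absurd (ih.symm.trans hpc) h0
      · exact absurd hr ((h t ht).1 r)
      · exact absurd hcs ((h t ht).2 ih cmds)
  obtain ⟨T, hT⟩ := eventually_atTop.1 (E.eventually_enabled hE hf hc hi h0 hpc)
  obtain ⟨t, ht, ha⟩ := hE.clients i (max T t₀) hi fun t h => hT t ((le_max_left _ _).trans h)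
  have ht₀ := (le_max_right T t₀).trans ht
  rcases ha with ha | ⟨r, ha⟩
  · rcases E.loc_step t i with ⟨-, -, -, h1, -⟩ | ⟨-, cmds, h1, -⟩ | ⟨-, j, m, l, h1, -⟩
    · exact h1 ha
    · generalize hs : E.loc (t + 1) i = s' at h1
      rw [ha] at h1
      cases h1 with
      | client _ _ _ _ h1 => exact (h t ht₀).2 (hpc t ht₀) cmds (hs ▸ h1)
    · rw [ha] at h1; simp at h1
  · exact (h t ht₀).1 r ha

/-- Each client step lowers the rank and never leads to `idle`, so a response must come. -/
theorem exists_respond (hE : E.Fair) (hf : 2 * f < n) (hc : E.faulty.ncard ≤ f) {i : Fin n}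
    (hi : i ∉ E.faulty) {t : ℕ} (h : (E.loc t i).pc ≠ .idle) :
    ∃ t' ≥ t, ∃ r, E.action t' = .respond i r := by
  induction hN : (E.loc t i).pc.rank using Nat.strong_induction_on generalizing t with
  | _ N ih =>
    obtain ⟨t', ht', hr | ⟨hpc, cmds, hcs⟩⟩ := E.exists_client_step hE hf hc hi h
    · exact ⟨t', ht', hr⟩
    · obtain ⟨h1, h2⟩ := hcs.rank_lt
      rw [hpc, hN] at h1
      obtain ⟨t'', h3, h4⟩ := ih _ h1 h2 rfl
      exact ⟨t'', by omega, h4⟩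

/-- Every operation of a correct node completes. -/
theorem completes_of_fair (hE : E.Fair) (hf : 2 * f < n) (hc : E.faulty.ncard ≤ f) {i : Fin n}
    (hi : i ∉ E.faulty) {k : ℕ} {o : Op α} (hk : E.history.IsOp k i o) :
    E.history.Completes k := by
  have hpc := (E.invoke_spec (E.history_eq_invoke.1 hk)).2.2
  obtain ⟨t, ht, r, hr⟩ := E.exists_respond hE hf hc hi (t := k + 1) (by simp [hpc])
  obtain ⟨m, -, r', hm⟩ := E.completes_of_respond hk ht hr
  exact ⟨m, r', hm⟩

end Execution

end ACASO

theorem mainTheorem1 {α : Type*} (n f : ℕ) (hf : 2 * f < n) (v₀ : Fin n → α)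
    (E : ACASO.Execution n f v₀) (hcrash : E.faulty.ncard ≤ f) :
    E.history.Linearizable v₀ ∧
    (E.Fair → ∀ k i o, i ∉ E.faulty → E.history.IsOp k i o → E.history.Completes k) :=
  ⟨(E.viewAssignment hf).linearizable, fun hE _ _ _ hi hk =>
    E.completes_of_fair hE hf hcrash hi hk⟩
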